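/- Let $n\ge 2$ and $H>\frac{n-1}{n}$. Let $\mathbb{H}^n$ be the unit ball of $\mathbb{R}^n$ with the metric $4(1-|x|^2)^{-2}|dx|^2$, and give $\mathbb{H}^n\times\mathbb{R}$ the product metric. $B(0,r)$ denotes the hyperbolic ball of radius $r$ centred at $0$. A curve $(\rho(s),t(s))$ in a vertical plane through the axis $\{0\}\times\mathbb{R}$ ($\rho$ is the hyperbolic distance to the axis, $t$ the height) generates the rotation hypersurface $(s,\xi)\mapsto(\tanh(\rho(s)/2)\,\xi,\,t(s))$, $\xi\in S^{n-1}$. Put $I_{k}(t)=\int_0^t\sinh^{k}(r)\,dr$, and for $d\in\mathbb{R}$ $$Q_{H,d}(t)=\frac{nHI_{n-1}(t)+d}{\sqrt{\sinh^{2n-2}(t)-(nHI_{n-1}(t)+d)^2}}$$ for the $t>0$ at which the radicand is positive. Let $C_H>0$ be the number with $\coth C_H=\frac{nH}{n-1}$, and $D_H=\sinh^{n-1}(C_H)-nHI_{n-1}(C_H)$. A $C^2$ graph $t=\lambda(\rho)$ over a nonempty open interval of $(0,\infty)$ generates a hypersurface of constant (normalized) mean curvature $H$ with respect to the upward unit normal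 if and only if, for some constant $d$ (which is then unique), $$\dot\lambda(\rho)\,\bigl(1+\dot\lambda(\rho)^2\bigr)^{-1/2}\sinh^{n-1}(\rho)=nHI_{n-1}(\rho)+d .$$ The rotation $H$-hypersurfaces with constant $d$ are described as follows. In each case the complete curve $c$ that is mentioned contains, up to vertical translations, all graphs $\lambda$ with this constant $d$. 1. $d=0$. $Q_{H,0}$ exists exactly on an interval $(0,a)$, $a>0$, and is integrable on it. With $\lambda(\rho)=\int_0^\rho Q_{H,0}$, the set of the $(\rho,t)$ with $|\rho|\le a$ and $t=\lambda(|\rho|)$ or $t=2\lambda(a)-\lambda(|\rho|)$ is a smooth, simple, closed, strictly convex curve $c$ (the boundary of a compact strictly convex set with nonempty interior, with positive curvature). The hypersurface $\mathcal{K}_H$ obtained by rotating it is compact and is the image of a smooth embedding of the sphere $S^n$ with constant mean curvature $H$. 2. $d>0$. One has $D_H>0$, and $Q_{H,d}$ exists nowhere if $d\ge D_H$. If $0<d<D_H$, then $Q_{H,d}$ exists exactly on an interval $(a,b)$, $0<a<b$, and is integrable on it. The graph of $\lambda(\rho)=\int_a^\rho Q_{H,d}$ over $[a,b]$ extends by symmetry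 in the slice $t=0$ and by vertical translations by multiples of $T=2\lambda(b)>0$ to a smooth arc-length parametrized curve $c=(\rho,t):\mathbb{R}\to\mathbb{R}^2$. This curve has the shape of an unduloid: $\rho$ is periodic and oscillates monotonically between $a$ and $b$, and $t'>0$ everywhere. The hypersurface $\mathcal{U}_H$ generated by $c$ has constant mean curvature $H$, is complete, embedded and periodic in the $\mathbb{R}$-direction (invariant under the translation by $T$), and is contained in $(B(0,\beta)\setminus B(0,\alpha))\times\mathbb{R}$ for some constants $0<\alpha<\beta$ depending on $n,H,d$. 3. $d<0$. $Q_{H,d}$ exists exactly on an interval $(a,b)$, $0<a<b$, and is integrable on it. As before, the graph of $\lambda(\rho)=\int_a^\rho Q_{H,d}$ over $[a,b]$ extends by the symmetry and the translations by multiples of $T=2\lambda(b)>0$ to a smooth arc-length parametrized curve $c=(\rho,t)$. This curve has the shape of a nodoid: $\rho$ is periodic and oscillates monotonically between $a$ and $b$, the curvature of $c$ is positive everywhere, $t'<0$ where $\rho=a$ and $t'>0$ where $\rho=b$, and $c$ crosses itself transversally. The hypersurface $\mathcal{N}_H$ generated by $c$ is immersed with constant mean curvature $H$, is complete, periodic in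 the $\mathbb{R}$-direction (invariant under the translation by $T$) and has self-intersections, and it is contained in $(B(0,\beta)\setminus B(0,\alpha))\times\mathbb{R}$ for some constants $0<\alpha<\beta$ depending on $n,H,d$. -/

import Mathlib

open Set Filter Topology MeasureTheory Metric
open scoped Manifold ContDiff ENNReal

noncomputable section

namespace RotH

/-- The space in which `ℍⁿ × ℝ` lives: the ball model of `ℍⁿ` is the open unit ball of the first
factor, and the second factor is the vertical direction. -/
abbrev Amb (n : ℕ) : Type := EuclideanSpace ℝ (Fin n) × ℝ

/-- The product metric `ĝ = 4 (1 - |x|²)⁻² |dx|² + dt²` at the point `q = (x, t)`. -/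
def ghat {n : ℕ} (q u v : Amb n) : ℝ :=
  4 / (1 - ‖q.1‖ ^ 2) ^ 2 * inner ℝ u.1 v.1 + u.2 * v.2

/-- The Christoffel symbol of the first kind of `ĝ`: for constant vectors `u, v, w` this is
`ĝ(∇_u v, w)`, where `∇` is the Levi-Civita connection of `ĝ`. -/
def christoffel {n : ℕ} (q u v w : Amb n) : ℝ :=
  (fderiv ℝ (fun p => ghat p v w) q u + fderiv ℝ (fun p => ghat p u w) q v
    - fderiv ℝ (fun p => ghat p u v) q w) / 2

/-- The open hyperbolic ball with centre `0` and hyperbolic radius `r`, in the ball model: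
`x` is at hyperbolic distance `ρ` from `0` when `‖x‖ = tanh (ρ / 2)`. -/
def hypBall (n : ℕ) (r : ℝ) : Set (EuclideanSpace ℝ (Fin n)) :=
  {x | ‖x‖ < Real.tanh (r / 2)}

section Immersions

variable {n : ℕ} {V : Type*} [NormedAddCommGroup V] [NormedSpace ℝ V]
  {B : Type*} [TopologicalSpace B] (I : ModelWithCorners ℝ V B)
  {M : Type*} [TopologicalSpace M] [ChartedSpace B M]

/-- `f` is a smooth immersion. -/
def IsSmoothImm (f : M → Amb n) : Prop :=
  ContMDiff I 𝓘(ℝ, Amb n) ∞ f ∧ ∀ p, Function.Injective (mfderiv I 𝓘(ℝ, Amb n) f p)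

/-- `f` is a smooth embedding: a smooth immersion and a homeomorphism onto its image. -/
def IsSmoothEmb (f : M → Amb n) : Prop :=
  IsSmoothImm I f ∧ IsEmbedding f

/-- `f` read in the preferred chart at `p`. -/
def inChart (f : M → Amb n) (p : M) : V → Amb n := f ∘ (extChartAt I p).symm

/-- The second fundamental form at `p` of the hypersurface `f`, in the direction of the normal
vector `ν` and read in the preferred chart at `p`: `(u, v) ↦ ĝ(∇_u (df v), ν)`. -/
def secondFF (f : M → Amb n) (p : M) (ν : Amb n) (u v : V) : ℝ :=
  ghat (f p) (fderiv ℝ (fderiv ℝ (inChart I f p)) (extChartAt I p p) u v) ν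
    + christoffel (f p) (fderiv ℝ (inChart I f p) (extChartAt I p p) u)
        (fderiv ℝ (inChart I f p) (extChartAt I p p) v) ν

/-- At `p`, the map `f` is an immersion into `ℍⁿ × ℝ`, `ν` is a `ĝ`-unit normal vector, and the
(normalized) mean curvature with respect to `ν`, that is `1 / n` times the trace of the shape
operator `S`, is equal to `H`. -/
def HasMeanCurvatureAt (f : M → Amb n) (p : M) (ν : Amb n) (H : ℝ) : Prop :=
  ‖(f p).1‖ < 1 ∧
  Function.Injective (fderiv ℝ (inChart I f p) (extChartAt I p p)) ∧
  ghat (f p) ν ν = 1 ∧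
  (∀ u : V, ghat (f p) (fderiv ℝ (inChart I f p) (extChartAt I p p) u) ν = 0) ∧
  ∃ S : V →ₗ[ℝ] V,
    (∀ u v : V,
      ghat (f p) (fderiv ℝ (inChart I f p) (extChartAt I p p) (S u))
        (fderiv ℝ (inChart I f p) (extChartAt I p p) v) = secondFF I f p ν u v) ∧
    LinearMap.trace ℝ V S = n * H

/-- The metric induced by `ĝ` through the immersion `f` is complete: every `C¹` path
`[0, 1) → M` that eventually leaves every compact set of `M` has infinite length. -/
def IsCompleteImm (f : M → Amb n) : Prop :=
  ∀ γ : ℝ → M, ContMDiffOn 𝓘(ℝ, ℝ) I 1 γ (Ico 0 1) →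
    (∀ K : Set M, IsCompact K → ∀ᶠ t in 𝓝[<] (1 : ℝ), γ t ∉ K) →
    ∫⁻ t in Ioo (0 : ℝ) 1, ENNReal.ofReal
      (Real.sqrt (ghat (f (γ t)) (deriv (f ∘ γ) t) (deriv (f ∘ γ) t))) = ⊤

end Immersions

/-- The rotation hypersurface about the axis `{0} × ℝ` generated by the curve
`s ↦ c s = (ρ s, t s)`, where `ρ` is the hyperbolic distance to the axis and `t` the height:
`(s, ξ) ↦ (tanh (ρ s / 2) ξ, t s)`, with `ξ` in the unit sphere of `ℝⁿ`, `n = m + 1`. -/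
def rotImm (m : ℕ) (c : ℝ → ℝ × ℝ)
    (p : ℝ × sphere (0 : EuclideanSpace ℝ (Fin (m + 1))) 1) : Amb (m + 1) :=
  (Real.tanh ((c p.1).1 / 2) • (p.2 : EuclideanSpace ℝ (Fin (m + 1))), (c p.1).2)

/-- The field `(-t' ξ / (2 cosh² (ρ / 2)), ρ')`, normal to the rotation hypersurface generated by
`c = (ρ, t)`; it points upwards where `ρ' > 0`. It is a unit field if `c` has unit speed. -/
def rotNormal (m : ℕ) (c : ℝ → ℝ × ℝ)
    (p : ℝ × sphere (0 : EuclideanSpace ℝ (Fin (m + 1))) 1) : Amb (m + 1) :=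
  ((-(deriv c p.1).2 / (2 * Real.cosh ((c p.1).1 / 2) ^ 2)) •
    (p.2 : EuclideanSpace ℝ (Fin (m + 1))), (deriv c p.1).1)

/-- The set obtained by rotating about the axis a set `C` of a vertical plane through the axis;
the first coordinate in the plane is the signed distance to the axis. -/
def rotSet (m : ℕ) (C : Set (ℝ × ℝ)) : Set (Amb (m + 1)) :=
  {q | ∃ p ∈ C, ∃ ξ : sphere (0 : EuclideanSpace ℝ (Fin (m + 1))) 1,
    q = (Real.tanh (p.1 / 2) • (ξ : EuclideanSpace ℝ (Fin (m + 1))), p.2)}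

/-- `I_k(t) = ∫_0^t sinh^k r dr`. -/
def I (k : ℕ) (t : ℝ) : ℝ := ∫ r in (0 : ℝ)..t, Real.sinh r ^ k

/-- `n H I_{n-1}(t) + d`, with `n = m + 1`. -/
def F (m : ℕ) (H d t : ℝ) : ℝ := (m + 1) * H * I m t + d

/-- `M_{H,d}(t) = sinh^{n-1} t - n H I_{n-1}(t) - d`. -/
def M (m : ℕ) (H d t : ℝ) : ℝ := Real.sinh t ^ m - F m H d t

/-- `P_{H,d}(t) = sinh^{n-1} t + n H I_{n-1}(t) + d`. -/
def P (m : ℕ) (H d t : ℝ) : ℝ := Real.sinh t ^ m + F m H d t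

/-- `Q_{H,d}(t) = (n H I_{n-1}(t) + d) (M_{H,d}(t) P_{H,d}(t))^{-1/2}`. -/
def Q (m : ℕ) (H d t : ℝ) : ℝ := F m H d t / Real.sqrt (M m H d t * P m H d t)

/-- The set of the `t > 0` at which `Q_{H,d}(t)` exists. -/
def dom (m : ℕ) (H d : ℝ) : Set ℝ := {t | 0 < t ∧ 0 < M m H d t * P m H d t}

/-- `λ_{H,d}(ρ) = ∫_a^ρ Q_{H,d}(t) dt`. -/
def height (m : ℕ) (H d a ρ : ℝ) : ℝ := ∫ t in a..ρ, Q m H d t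

/-- `C_H`, the number with `coth C_H = n H / (n - 1)`. -/
def CH (m : ℕ) (H : ℝ) : ℝ := Real.artanh (m / ((m + 1) * H))

/-- `D_H = sinh^{n-1} C_H - n H I_{n-1}(C_H)`. -/
def DH (m : ℕ) (H : ℝ) : ℝ := M m H 0 (CH m H)

/-- The vertical graph `t = l ρ`, `ρ ∈ J`, rotated about the axis, has constant mean curvature `H`
with respect to the unit normal pointing upwards. -/
def IsRotHGraph (m : ℕ) (H : ℝ) (J : Set ℝ) (l : ℝ → ℝ) : Prop :=
  ∀ p : ℝ × sphere (0 : EuclideanSpace ℝ (Fin (m + 1))) 1, p.1 ∈ J →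
    ∃ ν : Amb (m + 1), 0 < ν.2 ∧
      HasMeanCurvatureAt (𝓘(ℝ, ℝ).prod (𝓡 m)) (rotImm m (fun s => (s, l s))) p ν H

/-- The equation `λ' (1 + λ'²)^{-1/2} sinh^{n-1} ρ = n H I_{n-1}(ρ) + d` on `J`, with `λ` called
`l`: it is the definition of the constant `d`. -/
def HasConst (m : ℕ) (H d : ℝ) (J : Set ℝ) (l : ℝ → ℝ) : Prop :=
  ∀ ρ ∈ J, deriv l ρ / Real.sqrt (1 + deriv l ρ ^ 2) * Real.sinh ρ ^ m = F m H d ρ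

/-- Admissible height functions: `C²` on a nonempty open interval `J` of `(0, ∞)`. -/
def IsHeightFun (J : Set ℝ) (l : ℝ → ℝ) : Prop :=
  IsOpen J ∧ J.Nonempty ∧ J.OrdConnected ∧ J ⊆ Ioi 0 ∧ ContDiffOn ℝ 2 l J

/-- Up to a vertical translation, the set `C` contains every generating curve `t = l ρ` of a
rotation `H`-hypersurface with constant `d`. -/
def ContainsAll (m : ℕ) (H d : ℝ) (C : Set (ℝ × ℝ)) : Prop :=
  ∀ (J : Set ℝ) (l : ℝ → ℝ), IsHeightFun J l → IsRotHGraph m H J l → HasConst m H d J l →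
    ∃ τ : ℝ, ∀ ρ ∈ J, (ρ, l ρ + τ) ∈ C

/-- `c` is a smooth plane curve with unit speed (the metric on a vertical plane through the axis
is `dρ² + dt²`). -/
def IsUnitSpeed (c : ℝ → ℝ × ℝ) : Prop :=
  ContDiff ℝ ∞ c ∧ ∀ s, (deriv c s).1 ^ 2 + (deriv c s).2 ^ 2 = 1

/-- The curvature of a unit speed plane curve. -/
def curv (c : ℝ → ℝ × ℝ) (s : ℝ) : ℝ :=
  (deriv c s).1 * (deriv (deriv c) s).2 - (deriv c s).2 * (deriv (deriv c) s).1

/-- `c` is the curve, parametrized by arc length, that is obtained from the graph of `λ_{H,d}`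
over `[a, b]` by symmetry: `c` describes this graph on `[0, L / 2]`, it is symmetric with respect
to the slice `t = 0`, and a parameter shift by `L` is a vertical translation by `T > 0`. -/
structure IsPeriodicExtension (m : ℕ) (H d a b L T : ℝ) (c : ℝ → ℝ × ℝ) : Prop where
  unitSpeed : IsUnitSpeed c
  L_pos : 0 < L
  T_pos : 0 < T
  start : (c 0).1 = a
  finish : (c (L / 2)).1 = b
  mono : StrictMonoOn (fun s => (c s).1) (Icc 0 (L / 2))
  graph : ∀ s ∈ Icc 0 (L / 2), (c s).2 = height m H d a (c s).1
  symm : ∀ s, c (-s) = ((c s).1, -(c s).2)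
  period : ∀ s, c (s + L) = c s + (0, T)

/-- The part of the conclusion that the cases `d > 0` and `d < 0` share: `Q_{H,d}` exists exactly
on `(a, b)` and is integrable there, `c` is the periodic curve generated by `λ_{H,d}`, and the
rotation hypersurface generated by `c` is an immersed hypersurface with constant mean
curvature `H`, complete, periodic in the vertical direction, and contained in a domain
`(B(0,β) \ B(0,α)) × ℝ`. Moreover `c` contains all the generating curves with constant `d`. -/
structure IsDelaunay (m : ℕ) (H d a b L T : ℝ) (c : ℝ → ℝ × ℝ) : Prop where
  a_pos : 0 < a
  a_lt_b : a < b
  dom_eq : dom m H d = Ioo a b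
  integrable : IntervalIntegrable (Q m H d) volume a b
  extension : IsPeriodicExtension m H d a b L T c
  immersion : IsSmoothImm (𝓘(ℝ, ℝ).prod (𝓡 m)) (rotImm m c)
  cmc : ∀ p, HasMeanCurvatureAt (𝓘(ℝ, ℝ).prod (𝓡 m)) (rotImm m c) p (rotNormal m c p) H
  complete : IsCompleteImm (𝓘(ℝ, ℝ).prod (𝓡 m)) (rotImm m c)
  periodic : (fun q : Amb (m + 1) => q + (0, T)) '' range (rotImm m c) = range (rotImm m c)
  bounded : ∃ α β : ℝ, 0 < α ∧ α < β ∧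
    range (rotImm m c) ⊆ (hypBall (m + 1) β \ hypBall (m + 1) α) ×ˢ univ
  all : ContainsAll m H d (range c)

/-- The case `d = 0`: the graph of `λ_{H,0}` over `[0, a]` extends by symmetries to a closed curve
`c` of length `L`, simple and strictly convex, which generates a hypersurface that is compact,
diffeomorphic to the `n`-sphere (`n = m + 1`) and of constant mean curvature `H`. -/
structure IsSphereLike (m : ℕ) (H a L : ℝ) (c : ℝ → ℝ × ℝ) : Prop where
  a_pos : 0 < a
  dom_eq : dom m H 0 = Ioo 0 a
  integrable : IntervalIntegrable (Q m H 0) volume 0 a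
  unitSpeed : IsUnitSpeed c
  L_pos : 0 < L
  closed : Function.Periodic c L
  simple : InjOn c (Ico 0 L)
  range_eq : range c = {q | |q.1| ≤ a ∧ (q.2 = height m H 0 0 |q.1| ∨
    q.2 = 2 * height m H 0 0 a - height m H 0 0 |q.1|)}
  convex : ∃ K : Set (ℝ × ℝ), IsCompact K ∧ StrictConvex ℝ K ∧ (interior K).Nonempty ∧
    range c = frontier K
  curv_pos : ∀ s, 0 < curv c s
  compact : IsCompact (rotSet m (range c))
  sphere : ∃ f : sphere (0 : EuclideanSpace ℝ (Fin (m + 1 + 1))) 1 → Amb (m + 1),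
    IsSmoothEmb (𝓡 (m + 1)) f ∧ range f = rotSet m (range c) ∧
    ∃ ν : sphere (0 : EuclideanSpace ℝ (Fin (m + 1 + 1))) 1 → Amb (m + 1),
      Continuous ν ∧ ∀ p, HasMeanCurvatureAt (𝓡 (m + 1)) f p (ν p) H
  all : ContainsAll m H 0 (range c)

end RotH

end

noncomputable section

namespace RotH

/-! Let `G = sin θ`, where `θ` is the angle between a generating curve and the horizontal. The
principal curvatures of the rotation hypersurface are the curvature `κ` of the curve and, `m = n -
1` times, `G coth ρ`. Viewed as a function of `ρ`, `G` has derivative `κ`, so constant mean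
curvature is the linear equation `G' + m coth ρ G = (m + 1) H`. The integrating factor `sinh^m`
gives the first integral `sinh^m G = F`, whose constant is `d`. Thus `G = Gfun m H d`, and `Q`
exists exactly where `G² < 1`, since `M P = sinh^(2m) (1 - G²)`.

A complete generating curve solves `t' = G(ρ)`, `ρ'² = 1 - G(ρ)²`: the radius oscillates between
consecutive zeros of `1 - G²`. When these zeros are simple, the substitution `ρ = (α + β) / 2 - A
cos θ` (with `θ` now an auxiliary phase) removes the singularity at the turning points; a quadrature
and an inversion then give a smooth periodic `ρ`, without any existence theorem for differential
equations (`exists_oscillator`, `exists_profile`). The symmetry, the period, the integrability of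
`Q` and the mean curvature all follow from the resulting `IsProfile`.

The cases differ through the signs of `M` and `P`. The function `M` starts at `-d`, increases up to
`C_H`, where it equals `D_H - d`, then decreases and becomes negative. For `0 < d < D_H` both
turning points are zeros of `M`, `G` is positive, and the height is a global parameter, so the
surface is embedded. For `d < 0` the inner turning point is a zero of `P`; there `G` increases from
`-1` to `1`. The quantity `t + ρ' / ((m + 1) H)` is monotone, which gives `T > 0`; since the height
first decreases, it returns to `0` before half a period, and reflection yields a transversal
crossing.

For `d = 0`, `G` extends to a smooth odd function of the signed distance to the axis, and the same
construction on `[-a, a]` gives a closed curve, strictly convex because the slope is increasing.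
With `x = tanh (ρ / 2)` one has `G = x g(x²)`. The rotated set is parametrized by the unit sphere
through `(y, u) ↦ (R y, capHeight u)`, and its smoothness at the equator comes from dividing `1 - v
g(v)²` by its simple zero `v = R²`. The mean curvature is then computed at all points at once, poles
and equator included, by identities that never divide by `u` or by `x`. -/

/-- The inverse of the preferred chart of the unit sphere at `ξ`, as a map to the ambient space. -/
def sphChart {m : ℕ} (ξ : sphere (0 : EuclideanSpace ℝ (Fin (m + 1))) 1)
    (y : EuclideanSpace ℝ (Fin m)) : EuclideanSpace ℝ (Fin (m + 1)) :=
  ((extChartAt (𝓡 m) ξ).symm y : sphere (0 : EuclideanSpace ℝ (Fin (m + 1))) 1)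

/-! ### First and second derivatives of the stereographic charts of the unit sphere -/

section sphChart

variable {m : ℕ} (ξ : sphere (0 : EuclideanSpace ℝ (Fin (m + 1))) 1)

/-- The preferred chart at `ξ` is stereographic projection from `-ξ`, hence onto. This makes
`sphChart ξ` smooth on the whole model space, so ordinary derivatives can be used throughout. -/
theorem sphere_chart_target : (extChartAt (𝓡 m) ξ).target = univ := by
  have : Fact (Module.finrank ℝ (EuclideanSpace ℝ (Fin (m + 1))) = m + 1) :=
    ⟨finrank_euclideanSpace_fin⟩
  have h : (chartAt (EuclideanSpace ℝ (Fin m)) ξ) = stereographic' m (-ξ) := rfl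
  simp [h]

theorem sphChart_self : sphChart ξ (extChartAt (𝓡 m) ξ ξ) = ξ := by
  simp [sphChart]

theorem norm_sphChart (y : EuclideanSpace ℝ (Fin m)) : ‖sphChart ξ y‖ = 1 :=
  norm_eq_of_mem_sphere _

theorem contDiff_sphChart {k : ℕ∞ω} : ContDiff ℝ k (sphChart ξ) := by
  have : Fact (Module.finrank ℝ (EuclideanSpace ℝ (Fin (m + 1))) = m + 1) :=
    ⟨finrank_euclideanSpace_fin⟩
  have h := (contMDiffOn_extChartAt_symm (I := 𝓡 m) (n := k) ξ)
  rw [sphere_chart_target, contMDiffOn_univ] at h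
  exact ((contMDiff_coe_sphere (m := k) (n := m) (E := EuclideanSpace ℝ (Fin (m + 1)))).comp
    h).contDiff

/-- Identifying this derivative with the differential of the inclusion of the sphere transfers to
the chart its injectivity and its range, the orthogonal complement of `ξ`. -/
theorem fderiv_sphChart :
    fderiv ℝ (sphChart ξ) (extChartAt (𝓡 m) ξ ξ) =
      mvfderiv (𝓡 m)
        (Subtype.val : sphere (0 : EuclideanSpace ℝ (Fin (m + 1))) 1 → _) ξ := by
  have : Fact (Module.finrank ℝ (EuclideanSpace ℝ (Fin (m + 1))) = m + 1) :=
    ⟨finrank_euclideanSpace_fin⟩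
  rw [((contMDiff_coe_sphere (m := 1) (n := m) (E := EuclideanSpace ℝ (Fin (m + 1)))) ξ
    |>.mdifferentiableAt one_ne_zero).mvfderiv]
  simp only [fderivWithin_univ, mfld_simps]
  rfl

theorem fderiv_sphChart_injective :
    Function.Injective (fderiv ℝ (sphChart ξ) (extChartAt (𝓡 m) ξ ξ)) := by
  have : Fact (Module.finrank ℝ (EuclideanSpace ℝ (Fin (m + 1))) = m + 1) :=
    ⟨finrank_euclideanSpace_fin⟩
  rw [fderiv_sphChart]
  exact injective_mvfderiv_subtypeVal_sphere ξ

theorem fderiv_sphChart_range :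
    (fderiv ℝ (sphChart ξ) (extChartAt (𝓡 m) ξ ξ)).range =
      (Submodule.span ℝ {(ξ : EuclideanSpace ℝ (Fin (m + 1)))})ᗮ := by
  have : Fact (Module.finrank ℝ (EuclideanSpace ℝ (Fin (m + 1))) = m + 1) :=
    ⟨finrank_euclideanSpace_fin⟩
  rw [fderiv_sphChart]
  exact range_mvfderiv_subtypeVal ξ

variable {ξ}

theorem hasFDerivAt_sphChart (y : EuclideanSpace ℝ (Fin m)) :
    HasFDerivAt (sphChart ξ) (fderiv ℝ (sphChart ξ) y) y :=
  ((contDiff_sphChart ξ (k := 1)).differentiable one_ne_zero y).hasFDerivAt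

theorem hasFDerivAt_fderiv_sphChart (y : EuclideanSpace ℝ (Fin m)) :
    HasFDerivAt (fderiv ℝ (sphChart ξ)) (fderiv ℝ (fderiv ℝ (sphChart ξ)) y) y :=
  (((contDiff_sphChart ξ (k := 2)).fderiv_right (m := 1) le_rfl).differentiable one_ne_zero
    y).hasFDerivAt

theorem inner_fderiv_sphChart (y u : EuclideanSpace ℝ (Fin m)) :
    inner ℝ (fderiv ℝ (sphChart ξ) y u) (sphChart ξ y) = 0 := by
  have h1 := (hasFDerivAt_sphChart (ξ := ξ) y).inner ℝ (hasFDerivAt_sphChart (ξ := ξ) y)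
  have h2 : (fun y => inner ℝ (sphChart ξ y) (sphChart ξ y)) = fun _ => (1 : ℝ) := by
    ext y; rw [real_inner_self_eq_norm_sq, norm_sphChart]; norm_num
  rw [h2] at h1
  have h3 := congrArg (fun L => L u) (h1.unique (hasFDerivAt_const _ _))
  simp only [ContinuousLinearMap.comp_apply, ContinuousLinearMap.prod_apply,
    fderivInnerCLM_apply, zero_apply] at h3
  rw [real_inner_comm] at h3
  linarith

/-- Differentiating the orthogonality of `sphChart` to its first derivatives gives this relation,
the second fundamental form of the unit sphere. It is the only second-order information about the
chart that the curvature computations need. -/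
theorem inner_fderiv_fderiv_sphChart (y u v : EuclideanSpace ℝ (Fin m)) :
    inner ℝ (fderiv ℝ (fderiv ℝ (sphChart ξ)) y u v) (sphChart ξ y) =
      - inner ℝ (fderiv ℝ (sphChart ξ) y u) (fderiv ℝ (sphChart ξ) y v) := by
  have h1 := ((hasFDerivAt_fderiv_sphChart (ξ := ξ) y).clm_apply
    (hasFDerivAt_const v y)).inner ℝ (hasFDerivAt_sphChart (ξ := ξ) y)
  have h2 : (fun y => inner ℝ (fderiv ℝ (sphChart ξ) y v) (sphChart ξ y)) = fun _ => (0 : ℝ) := by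
    ext y; exact inner_fderiv_sphChart y v
  rw [h2] at h1
  have h3 := congrArg (fun L => L u) (h1.unique (hasFDerivAt_const _ _))
  simp [fderivInnerCLM_apply] at h3
  rw [real_inner_comm] at h3
  linarith

end sphChart

/-! ### The rotation hypersurface in the product chart -/

/-- The Christoffel symbols of the product metric. -/
theorem christoffel_eq {n : ℕ} {q : Amb n} (hq : ‖q.1‖ < 1) (u v w : Amb n) :
    christoffel q u v w = 8 / (1 - ‖q.1‖ ^ 2) ^ 3 *
      (inner ℝ q.1 u.1 * inner ℝ v.1 w.1 + inner ℝ q.1 v.1 * inner ℝ u.1 w.1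
        - inner ℝ q.1 w.1 * inner ℝ u.1 v.1) := by
  have h0 : (1 - ‖q.1‖ ^ 2) ≠ 0 := by
    have := norm_nonneg q.1
    nlinarith
  have key : ∀ u v w : Amb n, fderiv ℝ (fun p => ghat p v w) q u =
      16 / (1 - ‖q.1‖ ^ 2) ^ 3 * inner ℝ q.1 u.1 * inner ℝ v.1 w.1 := by
    intro u v w
    have h1 : HasFDerivAt (fun p : Amb n => ‖p.1‖ ^ 2)
        (2 • (innerSL ℝ q.1).comp (ContinuousLinearMap.fst ℝ _ _)) q := by
      simpa using (hasFDerivAt_fst (𝕜 := ℝ) (p := q)).norm_sq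
    have h2 : HasDerivAt (fun s : ℝ => 4 / (1 - s) ^ 2) (8 / (1 - ‖q.1‖ ^ 2) ^ 3) (‖q.1‖ ^ 2) := by
      have := ((((hasDerivAt_id (‖q.1‖ ^ 2)).const_sub 1).pow 2).inv (pow_ne_zero 2 h0)).const_mul 4
      refine HasDerivAt.congr_deriv (this.congr_of_eventuallyEq ?_) ?_
      · filter_upwards with s
        simp [div_eq_mul_inv]
      · simp; field_simp; ring
    have h3 := (h2.comp_hasFDerivAt q h1).mul_const (inner ℝ v.1 w.1) |>.add_const (v.2 * w.2)
    have h4 : HasFDerivAt (fun p => ghat p v w) _ q := h3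
    rw [h4.fderiv]
    simp
    ring
  simp only [christoffel, key]
  rw [real_inner_comm w.1 u.1, real_inner_comm v.1 u.1] 
  ring_nf

/-- The rotation hypersurface with radius function `r` (in the ball model) and height function `z`,
read in the product chart. -/
def rotChart {m : ℕ} (r z : ℝ → ℝ) (ξ : sphere (0 : EuclideanSpace ℝ (Fin (m + 1))) 1)
    (x : ℝ × EuclideanSpace ℝ (Fin m)) : Amb (m + 1) :=
  (r x.1 • sphChart ξ x.2, z x.1)

section rotChart

variable {m : ℕ} {r z : ℝ → ℝ} {ξ : sphere (0 : EuclideanSpace ℝ (Fin (m + 1))) 1}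

theorem inChart_rotImm (c : ℝ → ℝ × ℝ) (p : ℝ × sphere (0 : EuclideanSpace ℝ (Fin (m + 1))) 1) :
    inChart (𝓘(ℝ, ℝ).prod (𝓡 m)) (rotImm m c) p =
      rotChart (fun s => Real.tanh ((c s).1 / 2)) (fun s => (c s).2) p.2 := by
  rfl

theorem extChartAt_prod_sphere (p : ℝ × sphere (0 : EuclideanSpace ℝ (Fin (m + 1))) 1) :
    extChartAt (𝓘(ℝ, ℝ).prod (𝓡 m)) p p = (p.1, extChartAt (𝓡 m) p.2 p.2) := rfl

theorem hasFDerivAt_rotChart {x : ℝ × EuclideanSpace ℝ (Fin m)}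
    (hr : DifferentiableAt ℝ r x.1) (hz : DifferentiableAt ℝ z x.1) :
    HasFDerivAt (rotChart r z ξ)
      ((r x.1 • (fderiv ℝ (sphChart ξ) x.2).comp (ContinuousLinearMap.snd ℝ _ _) +
        (deriv r x.1 • ContinuousLinearMap.fst ℝ _ _).smulRight (sphChart ξ x.2)).prod
        (deriv z x.1 • ContinuousLinearMap.fst ℝ _ _)) x := by
  have h1 : HasFDerivAt (fun x : ℝ × EuclideanSpace ℝ (Fin m) => r x.1)
      (deriv r x.1 • ContinuousLinearMap.fst ℝ _ _) x :=
    hr.hasDerivAt.comp_hasFDerivAt x hasFDerivAt_fst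
  have h2 : HasFDerivAt (fun x : ℝ × EuclideanSpace ℝ (Fin m) => z x.1)
      (deriv z x.1 • ContinuousLinearMap.fst ℝ _ _) x :=
    hz.hasDerivAt.comp_hasFDerivAt x hasFDerivAt_fst
  have h3 : HasFDerivAt (fun x : ℝ × EuclideanSpace ℝ (Fin m) => sphChart ξ x.2)
      ((fderiv ℝ (sphChart ξ) x.2).comp (ContinuousLinearMap.snd ℝ _ _)) x :=
    (hasFDerivAt_sphChart x.2).comp x hasFDerivAt_snd
  exact (h1.smul h3).prodMk h2

theorem fderiv_rotChart_apply {x : ℝ × EuclideanSpace ℝ (Fin m)}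
    (hr : DifferentiableAt ℝ r x.1) (hz : DifferentiableAt ℝ z x.1)
    (u : ℝ × EuclideanSpace ℝ (Fin m)) :
    fderiv ℝ (rotChart r z ξ) x u =
      (r x.1 • fderiv ℝ (sphChart ξ) x.2 u.2 + (deriv r x.1 * u.1) • sphChart ξ x.2,
        deriv z x.1 * u.1) := by
  rw [(hasFDerivAt_rotChart hr hz).fderiv]
  simp

theorem eventually_differentiableAt {f : ℝ → ℝ} {s : ℝ} (hf : ContDiffAt ℝ 2 f s) :
    ∀ᶠ y in 𝓝 s, DifferentiableAt ℝ f y :=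
  (hf.eventually (by simp)).mono fun _ h => h.differentiableAt (by norm_num)

theorem differentiableAt_deriv {f : ℝ → ℝ} {s : ℝ} (hf : ContDiffAt ℝ 2 f s) :
    DifferentiableAt ℝ (deriv f) s := by
  have h : ContDiffAt ℝ 1 (fderiv ℝ f) s := hf.fderiv_right (by norm_num)
  exact (h.differentiableAt (by norm_num)).clm_apply (differentiableAt_const 1)

theorem contDiffAt_rotChart {k : ℕ∞ω} {x : ℝ × EuclideanSpace ℝ (Fin m)}
    (hr : ContDiffAt ℝ k r x.1) (hz : ContDiffAt ℝ k z x.1) :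
    ContDiffAt ℝ k (rotChart r z ξ) x :=
  ((hr.comp x contDiffAt_fst).smul
    ((contDiff_sphChart ξ).contDiffAt.comp x contDiffAt_snd)).prodMk (hz.comp x contDiffAt_fst)

theorem fderiv_fderiv_rotChart_apply {x : ℝ × EuclideanSpace ℝ (Fin m)}
    (hr : ContDiffAt ℝ 2 r x.1) (hz : ContDiffAt ℝ 2 z x.1)
    (u v : ℝ × EuclideanSpace ℝ (Fin m)) :
    fderiv ℝ (fderiv ℝ (rotChart r z ξ)) x u v =
      (r x.1 • fderiv ℝ (fderiv ℝ (sphChart ξ)) x.2 u.2 v.2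
        + (deriv r x.1 * u.1) • fderiv ℝ (sphChart ξ) x.2 v.2
        + (deriv r x.1 * v.1) • fderiv ℝ (sphChart ξ) x.2 u.2
        + (deriv (deriv r) x.1 * u.1 * v.1) • sphChart ξ x.2,
        deriv (deriv z) x.1 * u.1 * v.1) := by
  have hd : DifferentiableAt ℝ (fderiv ℝ (rotChart r z ξ)) x :=
    ((contDiffAt_rotChart hr hz).fderiv_right (m := 1) (by norm_num)).differentiableAt
      (by norm_num)
  have h1 : fderiv ℝ (fderiv ℝ (rotChart r z ξ)) x u v =
      fderiv ℝ (fun y => fderiv ℝ (rotChart r z ξ) y v) x u := by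
    rw [fderiv_clm_apply hd (differentiableAt_const v)]
    simp
  have h2 : (fun y => fderiv ℝ (rotChart r z ξ) y v) =ᶠ[𝓝 x] fun y =>
      (r y.1 • fderiv ℝ (sphChart ξ) y.2 v.2 + (deriv r y.1 * v.1) • sphChart ξ y.2,
        deriv z y.1 * v.1) := by
    have e1 := continuousAt_fst.eventually (eventually_differentiableAt hr)
    have e2 := continuousAt_fst.eventually (eventually_differentiableAt hz)
    filter_upwards [e1, e2] with y h1 h2 using fderiv_rotChart_apply h1 h2 v
  rw [h1, h2.fderiv_eq]
  have k1 : HasFDerivAt (fun x : ℝ × EuclideanSpace ℝ (Fin m) => r x.1)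
      (deriv r x.1 • ContinuousLinearMap.fst ℝ _ _) x :=
    (hr.differentiableAt (by norm_num)).hasDerivAt.comp_hasFDerivAt x hasFDerivAt_fst
  have k1' : HasFDerivAt (fun x : ℝ × EuclideanSpace ℝ (Fin m) => deriv r x.1)
      (deriv (deriv r) x.1 • ContinuousLinearMap.fst ℝ _ _) x :=
    (differentiableAt_deriv hr).hasDerivAt.comp_hasFDerivAt x hasFDerivAt_fst
  have k2' : HasFDerivAt (fun x : ℝ × EuclideanSpace ℝ (Fin m) => deriv z x.1)
      (deriv (deriv z) x.1 • ContinuousLinearMap.fst ℝ _ _) x :=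
    (differentiableAt_deriv hz).hasDerivAt.comp_hasFDerivAt x hasFDerivAt_fst
  have k3 : HasFDerivAt (fun x : ℝ × EuclideanSpace ℝ (Fin m) => sphChart ξ x.2)
      ((fderiv ℝ (sphChart ξ) x.2).comp (ContinuousLinearMap.snd ℝ _ _)) x :=
    (hasFDerivAt_sphChart x.2).comp x hasFDerivAt_snd
  have k4 : HasFDerivAt (fun x : ℝ × EuclideanSpace ℝ (Fin m) => fderiv ℝ (sphChart ξ) x.2)
      ((fderiv ℝ (fderiv ℝ (sphChart ξ)) x.2).comp (ContinuousLinearMap.snd ℝ _ _)) x :=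
    (hasFDerivAt_fderiv_sphChart x.2).comp x hasFDerivAt_snd
  have k5 := (((k1.smul (k4.clm_apply (hasFDerivAt_const v.2 x))).add
    ((k1'.mul_const v.1).smul k3)).prodMk (k2'.mul_const v.1))
  have k6 : HasFDerivAt (fun y : ℝ × EuclideanSpace ℝ (Fin m) =>
      ((r y.1 • fderiv ℝ (sphChart ξ) y.2 v.2 + (deriv r y.1 * v.1) • sphChart ξ y.2,
        deriv z y.1 * v.1) : Amb (m + 1))) _ x := k5
  rw [k6.fderiv]
  simp
  constructor
  · module
  · ring

/-- The inner product with `ξ` isolates the radial speed, because the derivatives of the sphere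
chart are orthogonal to `ξ`. Regularity of the curve then kills the first component of a kernel
vector, and the rest is injectivity of the sphere chart. -/
theorem fderiv_rotChart_injective {x₀ : ℝ}
    (hr : DifferentiableAt ℝ r x₀) (hz : DifferentiableAt ℝ z x₀) (hpos : r x₀ ≠ 0)
    (hreg : deriv r x₀ ≠ 0 ∨ deriv z x₀ ≠ 0) :
    Function.Injective (fderiv ℝ (rotChart r z ξ) (x₀, extChartAt (𝓡 m) ξ ξ)) := by
  rw [injective_iff_map_eq_zero]
  rintro ⟨a, η⟩ h
  rw [fderiv_rotChart_apply hr hz] at h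
  simp only [Prod.mk_eq_zero] at h
  obtain ⟨h1, h2⟩ := h
  have h3 := congrArg (fun w => inner ℝ w (sphChart ξ (extChartAt (𝓡 m) ξ ξ))) h1
  simp only [inner_add_left, inner_smul_left, inner_fderiv_sphChart, real_inner_self_eq_norm_sq,
    norm_sphChart, inner_zero_left] at h3
  simp at h3
  have ha : a = 0 := by
    rcases hreg with h | h
    · exact h3.resolve_left h
    · exact (mul_eq_zero.1 h2).resolve_left h
  subst ha
  simp [hpos] at h1
  refine Prod.ext rfl (fderiv_sphChart_injective ξ ?_)
  simp [h1]

end rotChart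

/-! ### Unit normal, shape operator and principal curvatures of a rotation hypersurface -/

section curvature

variable {m : ℕ} {c : ℝ → ℝ × ℝ} {p : ℝ × sphere (0 : EuclideanSpace ℝ (Fin (m + 1))) 1}

theorem contDiff_tanh {k : ℕ∞ω} : ContDiff ℝ k Real.tanh := by
  have : Real.tanh = fun x => Real.sinh x / Real.cosh x := by
    ext x; exact Real.tanh_eq_sinh_div_cosh x
  rw [this]
  exact Real.contDiff_sinh.div Real.contDiff_cosh fun x => (Real.cosh_pos x).ne'

theorem hasDerivAt_tanh (x : ℝ) : HasDerivAt Real.tanh (1 - Real.tanh x ^ 2) x := by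
  have : Real.tanh = fun x => Real.sinh x / Real.cosh x := by
    ext x; exact Real.tanh_eq_sinh_div_cosh x
  rw [this]
  have h := (Real.cosh_pos x).ne'
  refine ((Real.hasDerivAt_sinh x).div (Real.hasDerivAt_cosh x) h).congr_deriv ?_
  field_simp

theorem hasDerivAt_tanh_half {f : ℝ → ℝ} {f' s : ℝ} (hf : HasDerivAt f f' s) :
    HasDerivAt (fun s => Real.tanh (f s / 2)) ((1 - Real.tanh (f s / 2) ^ 2) / 2 * f') s := by
  refine ((hasDerivAt_tanh (f s / 2)).comp s (hf.div_const 2)).congr_deriv ?_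
  ring

theorem deriv_deriv_tanh_half {f : ℝ → ℝ} {s : ℝ} (hf : ContDiffAt ℝ 2 f s) :
    deriv (deriv fun s => Real.tanh (f s / 2)) s =
      (1 - Real.tanh (f s / 2) ^ 2) / 2 *
        (deriv (deriv f) s - Real.tanh (f s / 2) * deriv f s ^ 2) := by
  have h1 : (deriv fun s => Real.tanh (f s / 2)) =ᶠ[𝓝 s]
      fun s => (1 - Real.tanh (f s / 2) ^ 2) / 2 * deriv f s := by
    filter_upwards [eventually_differentiableAt hf] with y hy
    exact (hasDerivAt_tanh_half hy.hasDerivAt).deriv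
  rw [h1.deriv_eq]
  have h2 := hasDerivAt_tanh_half (hf.differentiableAt (by norm_num)).hasDerivAt
  have h3 := ((((h2.pow 2).const_sub 1).div_const 2).mul (differentiableAt_deriv hf).hasDerivAt)
  refine (HasDerivAt.congr_of_eventuallyEq h3 ?_).deriv.trans ?_
  · filter_upwards with y; simp
  · simp; ring

theorem norm_rotImm_fst (p : ℝ × sphere (0 : EuclideanSpace ℝ (Fin (m + 1))) 1) :
    ‖(rotImm m c p).1‖ = |Real.tanh ((c p.1).1 / 2)| := by
  simp [rotImm, norm_smul]

/-- The unit normal of a rotation hypersurface. The number `w` is the speed of the generating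
curve. -/
def rotUnitNormal (c : ℝ → ℝ × ℝ) (w : ℝ)
    (p : ℝ × sphere (0 : EuclideanSpace ℝ (Fin (m + 1))) 1) : Amb (m + 1) :=
  ((-(deriv (fun s => (c s).2) p.1 / w) * ((1 - Real.tanh ((c p.1).1 / 2) ^ 2) / 2)) •
    (p.2 : EuclideanSpace ℝ (Fin (m + 1))), deriv (fun s => (c s).1) p.1 / w)

/-- The curvature of the generating curve, with speed `w`. -/
def planeCurv (c : ℝ → ℝ × ℝ) (w s : ℝ) : ℝ :=
  (deriv (fun s => (c s).1) s * deriv (deriv fun s => (c s).2) s -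
    deriv (fun s => (c s).2) s * deriv (deriv fun s => (c s).1) s) / w ^ 3

/-- The principal curvature of a rotation hypersurface in the direction of the parallels. -/
def parallelCurv (c : ℝ → ℝ × ℝ) (w s : ℝ) : ℝ :=
  deriv (fun s => (c s).2) s / w *
    ((1 + Real.tanh ((c s).1 / 2) ^ 2) / (2 * Real.tanh ((c s).1 / 2)))

/-- The shape operator of a rotation hypersurface in the product chart. -/
def rotShape (m : ℕ) (c : ℝ → ℝ × ℝ) (w s : ℝ) :
    (ℝ × EuclideanSpace ℝ (Fin m)) →ₗ[ℝ] (ℝ × EuclideanSpace ℝ (Fin m)) :=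
  LinearMap.prodMap (planeCurv c w s • LinearMap.id) (parallelCurv c w s • LinearMap.id)

theorem trace_rotShape (w s : ℝ) :
    LinearMap.trace ℝ _ (rotShape m c w s) = planeCurv c w s + m * parallelCurv c w s := by
  rw [rotShape, LinearMap.trace_prodMap', map_smul, map_smul, LinearMap.trace_id,
    LinearMap.trace_id]
  simp [mul_comm]

theorem contDiffAt_tanh_half {k : ℕ∞ω} {f : ℝ → ℝ} {s : ℝ} (hf : ContDiffAt ℝ k f s) :
    ContDiffAt ℝ k (fun s => Real.tanh (f s / 2)) s :=
  contDiff_tanh.contDiffAt.comp s (hf.div_const 2)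

theorem inner_fderiv_sphChart_self (ξ : sphere (0 : EuclideanSpace ℝ (Fin (m + 1))) 1)
    (u : EuclideanSpace ℝ (Fin m)) :
    inner ℝ (fderiv ℝ (sphChart ξ) (extChartAt (𝓡 m) ξ ξ) u)
      (ξ : EuclideanSpace ℝ (Fin (m + 1))) = 0 := by
  have := inner_fderiv_sphChart (ξ := ξ) (extChartAt (𝓡 m) ξ ξ) u
  rwa [sphChart_self] at this

theorem inner_fderiv_fderiv_sphChart_self (ξ : sphere (0 : EuclideanSpace ℝ (Fin (m + 1))) 1)
    (u v : EuclideanSpace ℝ (Fin m)) :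
    inner ℝ (fderiv ℝ (fderiv ℝ (sphChart ξ)) (extChartAt (𝓡 m) ξ ξ) u v)
      (ξ : EuclideanSpace ℝ (Fin (m + 1))) =
      - inner ℝ (fderiv ℝ (sphChart ξ) (extChartAt (𝓡 m) ξ ξ) u)
        (fderiv ℝ (sphChart ξ) (extChartAt (𝓡 m) ξ ξ) v) := by
  have := inner_fderiv_fderiv_sphChart (ξ := ξ) (extChartAt (𝓡 m) ξ ξ) u v
  rwa [sphChart_self] at this

theorem fderiv_inChart_rotImm (h1 : ContDiffAt ℝ 2 (fun s => (c s).1) p.1)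
    (h2 : ContDiffAt ℝ 2 (fun s => (c s).2) p.1) (u : ℝ × EuclideanSpace ℝ (Fin m)) :
    fderiv ℝ (inChart (𝓘(ℝ, ℝ).prod (𝓡 m)) (rotImm m c) p)
      (extChartAt (𝓘(ℝ, ℝ).prod (𝓡 m)) p p) u =
    (Real.tanh ((c p.1).1 / 2) • fderiv ℝ (sphChart p.2) (extChartAt (𝓡 m) p.2 p.2) u.2 +
      ((1 - Real.tanh ((c p.1).1 / 2) ^ 2) / 2 * deriv (fun s => (c s).1) p.1 * u.1) •
        (p.2 : EuclideanSpace ℝ (Fin (m + 1))), deriv (fun s => (c s).2) p.1 * u.1) := by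
  have hr := (contDiffAt_tanh_half h1).differentiableAt (by norm_num)
  rw [inChart_rotImm, extChartAt_prod_sphere, fderiv_rotChart_apply hr
    (h2.differentiableAt (by norm_num)), sphChart_self,
    (hasDerivAt_tanh_half (h1.differentiableAt (by norm_num)).hasDerivAt).deriv]

theorem one_sub_tanh_sq_pos (x : ℝ) : 0 < 1 - Real.tanh x ^ 2 := by
  have := Real.tanh_sq_lt_one x
  linarith

theorem ghat_inChart_rotImm (h1 : ContDiffAt ℝ 2 (fun s => (c s).1) p.1)
    (h2 : ContDiffAt ℝ 2 (fun s => (c s).2) p.1) (u v : ℝ × EuclideanSpace ℝ (Fin m)) :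
    ghat (rotImm m c p)
      (fderiv ℝ (inChart (𝓘(ℝ, ℝ).prod (𝓡 m)) (rotImm m c) p)
        (extChartAt (𝓘(ℝ, ℝ).prod (𝓡 m)) p p) u)
      (fderiv ℝ (inChart (𝓘(ℝ, ℝ).prod (𝓡 m)) (rotImm m c) p)
        (extChartAt (𝓘(ℝ, ℝ).prod (𝓡 m)) p p) v) =
    (deriv (fun s => (c s).1) p.1 ^ 2 + deriv (fun s => (c s).2) p.1 ^ 2) * u.1 * v.1 +
      4 * Real.tanh ((c p.1).1 / 2) ^ 2 / (1 - Real.tanh ((c p.1).1 / 2) ^ 2) ^ 2 *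
      inner ℝ (fderiv ℝ (sphChart p.2) (extChartAt (𝓡 m) p.2 p.2) u.2)
        (fderiv ℝ (sphChart p.2) (extChartAt (𝓡 m) p.2 p.2) v.2) := by
  rw [fderiv_inChart_rotImm h1 h2, fderiv_inChart_rotImm h1 h2, ghat, norm_rotImm_fst, sq_abs]
  have e1 := inner_fderiv_sphChart_self p.2 u.2
  have e2 := inner_fderiv_sphChart_self p.2 v.2
  have e2' := e2
  rw [real_inner_comm] at e2'
  have e3 : inner ℝ (p.2 : EuclideanSpace ℝ (Fin (m + 1))) p.2 = 1 := by
    rw [real_inner_self_eq_norm_sq]; simp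
  have h0 := (one_sub_tanh_sq_pos ((c p.1).1 / 2)).ne'
  simp only [inner_add_left, inner_add_right, real_inner_smul_left, real_inner_smul_right, e1, e2',
    e3]
  field_simp
  ring

theorem ghat_inChart_rotImm_normal (h1 : ContDiffAt ℝ 2 (fun s => (c s).1) p.1)
    (h2 : ContDiffAt ℝ 2 (fun s => (c s).2) p.1) (u : ℝ × EuclideanSpace ℝ (Fin m))
    (ν : Amb (m + 1)) :
    ghat (rotImm m c p)
      (fderiv ℝ (inChart (𝓘(ℝ, ℝ).prod (𝓡 m)) (rotImm m c) p)
        (extChartAt (𝓘(ℝ, ℝ).prod (𝓡 m)) p p) u) ν =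
    4 / (1 - Real.tanh ((c p.1).1 / 2) ^ 2) ^ 2 * (Real.tanh ((c p.1).1 / 2) *
      inner ℝ (fderiv ℝ (sphChart p.2) (extChartAt (𝓡 m) p.2 p.2) u.2) ν.1 +
      (1 - Real.tanh ((c p.1).1 / 2) ^ 2) / 2 * deriv (fun s => (c s).1) p.1 * u.1 *
        inner ℝ (p.2 : EuclideanSpace ℝ (Fin (m + 1))) ν.1) +
      deriv (fun s => (c s).2) p.1 * u.1 * ν.2 := by
  rw [fderiv_inChart_rotImm h1 h2, ghat, norm_rotImm_fst, sq_abs]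
  simp only [inner_add_left, real_inner_smul_left]

/-- Meridian and parallel directions do not mix, since every first derivative of the sphere chart is
orthogonal to `ξ`. In the meridian direction the Christoffel term cancels the `ρ'²` part of the
second derivative of `tanh (ρ / 2)`, because `ρ` is a geodesic coordinate; only `ρ''` and `t''`
remain. -/
theorem secondFF_rotImm (h1 : ContDiffAt ℝ 2 (fun s => (c s).1) p.1)
    (h2 : ContDiffAt ℝ 2 (fun s => (c s).2) p.1) (α β : ℝ)
    (u v : ℝ × EuclideanSpace ℝ (Fin m)) :
    secondFF (𝓘(ℝ, ℝ).prod (𝓡 m)) (rotImm m c) p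
      (α • (p.2 : EuclideanSpace ℝ (Fin (m + 1))), β) u v =
    (2 * α / (1 - Real.tanh ((c p.1).1 / 2) ^ 2) * deriv (deriv (fun s => (c s).1)) p.1 +
      β * deriv (deriv (fun s => (c s).2)) p.1) * u.1 * v.1 -
      4 * α * Real.tanh ((c p.1).1 / 2) * (1 + Real.tanh ((c p.1).1 / 2) ^ 2) /
        (1 - Real.tanh ((c p.1).1 / 2) ^ 2) ^ 3 *
      inner ℝ (fderiv ℝ (sphChart p.2) (extChartAt (𝓡 m) p.2 p.2) u.2)
        (fderiv ℝ (sphChart p.2) (extChartAt (𝓡 m) p.2 p.2) v.2) := by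
  have hlt : ‖(rotImm m c p).1‖ < 1 := by
    rw [norm_rotImm_fst]; exact Real.abs_tanh_lt_one _
  rw [secondFF, christoffel_eq hlt, fderiv_inChart_rotImm h1 h2, fderiv_inChart_rotImm h1 h2,
    ghat, norm_rotImm_fst, sq_abs, inChart_rotImm, extChartAt_prod_sphere,
    fderiv_fderiv_rotChart_apply (contDiffAt_tanh_half h1) h2, deriv_deriv_tanh_half h1,
    (hasDerivAt_tanh_half (h1.differentiableAt (by norm_num)).hasDerivAt).deriv, sphChart_self]
  have e1 := inner_fderiv_sphChart_self p.2 u.2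
  have e2 := inner_fderiv_sphChart_self p.2 v.2
  have e1' := e1
  have e2' := e2
  rw [real_inner_comm] at e2' e1'
  have e3 : inner ℝ (p.2 : EuclideanSpace ℝ (Fin (m + 1))) p.2 = 1 := by
    rw [real_inner_self_eq_norm_sq]; simp
  have h0 := (one_sub_tanh_sq_pos ((c p.1).1 / 2)).ne'
  simp only [rotImm, inner_add_left, inner_add_right, real_inner_smul_left, real_inner_smul_right,
    e1, e2, e1', e2', e3, inner_fderiv_fderiv_sphChart_self]
  field_simp
  ring

theorem rotShape_spec (h1 : ContDiffAt ℝ 2 (fun s => (c s).1) p.1)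
    (h2 : ContDiffAt ℝ 2 (fun s => (c s).2) p.1) (hpos : 0 < (c p.1).1) {w : ℝ} (hw : 0 < w)
    (hspeed : w ^ 2 = deriv (fun s => (c s).1) p.1 ^ 2 + deriv (fun s => (c s).2) p.1 ^ 2)
    (u v : ℝ × EuclideanSpace ℝ (Fin m)) :
    ghat (rotImm m c p)
      (fderiv ℝ (inChart (𝓘(ℝ, ℝ).prod (𝓡 m)) (rotImm m c) p)
        (extChartAt (𝓘(ℝ, ℝ).prod (𝓡 m)) p p) (rotShape m c w p.1 u))
      (fderiv ℝ (inChart (𝓘(ℝ, ℝ).prod (𝓡 m)) (rotImm m c) p)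
        (extChartAt (𝓘(ℝ, ℝ).prod (𝓡 m)) p p) v) =
    secondFF (𝓘(ℝ, ℝ).prod (𝓡 m)) (rotImm m c) p (rotUnitNormal c w p) u v := by
  have h0 := (one_sub_tanh_sq_pos ((c p.1).1 / 2)).ne'
  have ht : Real.tanh ((c p.1).1 / 2) ≠ 0 := by
    rw [Real.tanh_eq_sinh_div_cosh]
    exact (div_pos (Real.sinh_pos_iff.2 (by linarith)) (Real.cosh_pos _)).ne'
  rw [ghat_inChart_rotImm h1 h2, rotUnitNormal, secondFF_rotImm h1 h2, ← hspeed]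
  simp only [rotShape, planeCurv, parallelCurv, LinearMap.prodMap_apply, LinearMap.smul_apply,
    LinearMap.id_apply, map_smul, real_inner_smul_left, smul_eq_mul]
  field_simp
  ring

theorem tanh_half_pos {x : ℝ} (hx : 0 < x) : 0 < Real.tanh (x / 2) := by
  rw [Real.tanh_eq_sinh_div_cosh]
  exact div_pos (Real.sinh_pos_iff.2 (by linarith)) (Real.cosh_pos _)

theorem fderiv_inChart_rotImm_injective (h1 : ContDiffAt ℝ 2 (fun s => (c s).1) p.1)
    (h2 : ContDiffAt ℝ 2 (fun s => (c s).2) p.1) (hpos : 0 < (c p.1).1) {w : ℝ} (hw : 0 < w)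
    (hspeed : w ^ 2 = deriv (fun s => (c s).1) p.1 ^ 2 + deriv (fun s => (c s).2) p.1 ^ 2) :
    Function.Injective (fderiv ℝ (inChart (𝓘(ℝ, ℝ).prod (𝓡 m)) (rotImm m c) p)
      (extChartAt (𝓘(ℝ, ℝ).prod (𝓡 m)) p p)) := by
  have h0 := (one_sub_tanh_sq_pos ((c p.1).1 / 2))
  rw [inChart_rotImm, extChartAt_prod_sphere]
  refine fderiv_rotChart_injective ((contDiffAt_tanh_half h1).differentiableAt (by norm_num))
    (h2.differentiableAt (by norm_num)) (tanh_half_pos hpos).ne' ?_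
  rw [(hasDerivAt_tanh_half (h1.differentiableAt (by norm_num)).hasDerivAt).deriv]
  by_contra! h
  obtain ⟨h3, h4⟩ := h
  have : deriv (fun s => (c s).1) p.1 = 0 := by
    rcases mul_eq_zero.1 h3 with h | h
    · linarith
    · exact h
  rw [this, h4] at hspeed
  nlinarith

theorem hasMeanCurvatureAt_rotImm (h1 : ContDiffAt ℝ 2 (fun s => (c s).1) p.1)
    (h2 : ContDiffAt ℝ 2 (fun s => (c s).2) p.1) (hpos : 0 < (c p.1).1) {w : ℝ} (hw : 0 < w)
    (hspeed : w ^ 2 = deriv (fun s => (c s).1) p.1 ^ 2 + deriv (fun s => (c s).2) p.1 ^ 2)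
    {H : ℝ} (hH : planeCurv c w p.1 + m * parallelCurv c w p.1 = (m + 1) * H) :
    HasMeanCurvatureAt (𝓘(ℝ, ℝ).prod (𝓡 m)) (rotImm m c) p (rotUnitNormal c w p) H := by
  have h0 := (one_sub_tanh_sq_pos ((c p.1).1 / 2)).ne'
  have e3 : inner ℝ (p.2 : EuclideanSpace ℝ (Fin (m + 1))) p.2 = 1 := by
    rw [real_inner_self_eq_norm_sq]; simp
  refine ⟨?_, fderiv_inChart_rotImm_injective h1 h2 hpos hw hspeed, ?_, fun u => ?_,
    rotShape m c w p.1, rotShape_spec h1 h2 hpos hw hspeed, ?_⟩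
  · rw [norm_rotImm_fst]; exact Real.abs_tanh_lt_one _
  · rw [rotUnitNormal, ghat, norm_rotImm_fst, sq_abs]
    simp only [real_inner_smul_left, real_inner_smul_right, e3]
    field_simp
    linarith
  · rw [ghat_inChart_rotImm_normal h1 h2, rotUnitNormal]
    simp only [real_inner_smul_right, inner_fderiv_sphChart_self, e3]
    field_simp
    ring
  · rw [trace_rotShape, hH]; push_cast; ring

/-- The data in `HasMeanCurvatureAt` are unique. Orthogonality to the parallels makes the horizontal
part of `ν` a multiple of `ξ`; orthogonality to the meridian, unit length and `0 < ν.2` then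
determine `ν`; and `S` is determined because the induced metric is positive definite. -/
theorem HasMeanCurvatureAt.rotImm_eq (h1 : ContDiffAt ℝ 2 (fun s => (c s).1) p.1)
    (h2 : ContDiffAt ℝ 2 (fun s => (c s).2) p.1) (hpos : 0 < (c p.1).1) {w : ℝ} (hw : 0 < w)
    (hspeed : w ^ 2 = deriv (fun s => (c s).1) p.1 ^ 2 + deriv (fun s => (c s).2) p.1 ^ 2)
    (hρ : 0 < deriv (fun s => (c s).1) p.1) {ν : Amb (m + 1)} (hν : 0 < ν.2) {H : ℝ}
    (h : HasMeanCurvatureAt (𝓘(ℝ, ℝ).prod (𝓡 m)) (rotImm m c) p ν H) :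
    planeCurv c w p.1 + m * parallelCurv c w p.1 = (m + 1) * H := by
  obtain ⟨-, -, hunit, hort, S, hS, htr⟩ := h
  have h0 := (one_sub_tanh_sq_pos ((c p.1).1 / 2))
  have hr := tanh_half_pos hpos
  have e3 : inner ℝ (p.2 : EuclideanSpace ℝ (Fin (m + 1))) p.2 = 1 := by
    rw [real_inner_self_eq_norm_sq]; simp
  have hmem : ν.1 ∈ Submodule.span ℝ {(p.2 : EuclideanSpace ℝ (Fin (m + 1)))} := by
    rw [← Submodule.orthogonal_orthogonal (Submodule.span ℝ _), ← fderiv_sphChart_range,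
      Submodule.mem_orthogonal]
    rintro _ ⟨η, rfl⟩
    have := hort (0, η)
    rw [ghat_inChart_rotImm_normal h1 h2] at this
    simpa [h0.ne', hr.ne'] using this
  obtain ⟨α, hα⟩ := Submodule.mem_span_singleton.1 hmem
  have hν' : ν = (α • (p.2 : EuclideanSpace ℝ (Fin (m + 1))), ν.2) := Prod.ext hα.symm rfl
  have k1 := hort (1, 0)
  rw [ghat_inChart_rotImm_normal h1 h2, ← hα] at k1
  rw [ghat, norm_rotImm_fst, sq_abs, ← hα] at hunit
  simp only [real_inner_smul_left, real_inner_smul_right, e3, map_zero, inner_zero_left] at k1 hunit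
  have hν2 : ν.2 = deriv (fun s => (c s).1) p.1 / w ∧
      α = -(deriv (fun s => (c s).2) p.1 / w) *
        ((1 - Real.tanh ((c p.1).1 / 2) ^ 2) / 2) := by
    generalize Real.tanh ((c p.1).1 / 2) = r at *
    generalize deriv (fun s => (c s).1) p.1 = ρ₁ at *
    generalize deriv (fun s => (c s).2) p.1 = t₁ at *
    obtain ⟨A, rfl⟩ : ∃ A, α = A * ((1 - r ^ 2) / 2) := ⟨α / ((1 - r ^ 2) / 2), by field_simp⟩
    have k2 : A * ρ₁ + t₁ * ν.2 = 0 := by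
      have h0' := h0.ne'
      field_simp at k1
      have k : (1 - r ^ 2) ^ 2 * (A * ρ₁ + t₁ * ν.2) = 0 := by linear_combination k1 / 4
      exact (mul_eq_zero.1 k).resolve_left (pow_ne_zero 2 h0')
    have k3 : A ^ 2 + ν.2 ^ 2 = 1 := by
      field_simp at hunit
      nlinarith
    -- Eliminating `A` leaves `ν.2 = ± ρ₁ / w`; the positivity of `ν.2` and `ρ₁` selects the sign.
    have k4 : (ρ₁ - w * ν.2) * (ρ₁ + w * ν.2) = 0 := by
      linear_combination (-ν.2 ^ 2) * hspeed + (A * ρ₁ - t₁ * ν.2) * k2 - ρ₁ ^ 2 * k3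
    have k5 : ρ₁ = w * ν.2 := by
      have : 0 < ρ₁ + w * ν.2 := by positivity
      linarith [(mul_eq_zero.1 k4).resolve_right this.ne']
    refine ⟨by rw [k5]; field_simp, ?_⟩
    have k6 : ν.2 * (A * w + t₁) = 0 := by rw [k5] at k2; linarith
    have k7 := (mul_eq_zero.1 k6).resolve_left hν.ne'
    have : A = -(t₁ / w) := by field_simp; linarith
    rw [this]
  have hνN : ν = rotUnitNormal c w p := by
    rw [hν', hν2.1, hν2.2]; rfl
  have hSS : S = rotShape m c w p.1 := by
    refine LinearMap.ext fun u => sub_eq_zero.1 ?_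
    -- Testing the two shape operators against their own difference at `u` shows that this
    -- difference has induced norm zero.
    have k := (hS u (S u - rotShape m c w p.1 u)).trans
      (hνN ▸ (rotShape_spec h1 h2 hpos hw hspeed u (S u - rotShape m c w p.1 u)).symm)
    rw [ghat_inChart_rotImm h1 h2, ghat_inChart_rotImm h1 h2, ← hspeed, ← sub_eq_zero] at k
    generalize S u = a at *
    generalize rotShape m c w p.1 u = b at *
    have k2 : w ^ 2 * (a.1 - b.1) ^ 2 + 4 * Real.tanh ((c p.1).1 / 2) ^ 2 /
        (1 - Real.tanh ((c p.1).1 / 2) ^ 2) ^ 2 *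
        ‖fderiv ℝ (sphChart p.2) (extChartAt (𝓡 m) p.2 p.2) (a - b).2‖ ^ 2 = 0 := by
      rw [← k, ← real_inner_self_eq_norm_sq]
      simp only [Prod.snd_sub, Prod.fst_sub, map_sub, inner_sub_left, inner_sub_right]
      ring
    have k3 : 0 < 4 * Real.tanh ((c p.1).1 / 2) ^ 2 /
        (1 - Real.tanh ((c p.1).1 / 2) ^ 2) ^ 2 := by positivity
    have k4 := (add_eq_zero_iff_of_nonneg (by positivity) (by positivity)).1 k2
    refine Prod.ext ?_ (fderiv_sphChart_injective p.2 ?_)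
    · simpa [hw.ne'] using k4.1
    · simpa [k3.ne'] using k4.2
  rw [← trace_rotShape, ← hSS, htr]
  push_cast
  ring

end curvature

/-! ### The first integral of the constant mean curvature equation for graphs -/

theorem hasDerivAt_I (k : ℕ) (t : ℝ) : HasDerivAt (I k) (Real.sinh t ^ k) t :=
  intervalIntegral.integral_hasDerivAt_right
    ((Real.continuous_sinh.pow k).intervalIntegrable _ _)
    ((Real.continuous_sinh.pow k).stronglyMeasurableAtFilter _ _)
    (Real.continuous_sinh.pow k).continuousAt

theorem hasDerivAt_F (m : ℕ) (H d t : ℝ) :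
    HasDerivAt (F m H d) ((m + 1) * H * Real.sinh t ^ m) t :=
  ((hasDerivAt_I m t).const_mul _).add_const d

theorem coth_eq_tanh_half {x : ℝ} (hx : 0 < x) :
    (1 + Real.tanh (x / 2) ^ 2) / (2 * Real.tanh (x / 2)) = Real.cosh x / Real.sinh x := by
  have h1 := Real.sinh_two_mul (x / 2)
  have h2 := Real.cosh_two_mul (x / 2)
  rw [mul_div_cancel₀ x (two_ne_zero)] at h1 h2
  have h3 : 0 < Real.sinh (x / 2) := Real.sinh_pos_iff.2 (by linarith)
  have h4 := Real.cosh_pos (x / 2)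
  rw [h1, h2, Real.tanh_eq_sinh_div_cosh]
  field_simp

section graph

variable {m : ℕ} {H : ℝ} {J : Set ℝ} {l : ℝ → ℝ}

/-- The left side is `κ + m G coth ρ` for a graph, with `G = λ' / √(1 + λ'²)`. Rotational symmetry
makes a single point of each parallel sufficient for the forward direction. -/
theorem isRotHGraph_iff (hl : IsHeightFun J l) :
    IsRotHGraph m H J l ↔ ∀ ρ ∈ J, deriv (deriv l) ρ / √(1 + deriv l ρ ^ 2) ^ 3 +
      m * (deriv l ρ / √(1 + deriv l ρ ^ 2) * (Real.cosh ρ / Real.sinh ρ)) = (m + 1) * H := by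
  obtain ⟨hJ, -, -, hpos, hC⟩ := hl
  have key : ∀ ρ ∈ J, planeCurv (fun s => (s, l s)) √(1 + deriv l ρ ^ 2) ρ +
      m * parallelCurv (fun s => (s, l s)) √(1 + deriv l ρ ^ 2) ρ =
      deriv (deriv l) ρ / √(1 + deriv l ρ ^ 2) ^ 3 +
      m * (deriv l ρ / √(1 + deriv l ρ ^ 2) * (Real.cosh ρ / Real.sinh ρ)) := by
    intro ρ hρ
    rw [planeCurv, parallelCurv, coth_eq_tanh_half (hpos hρ)]
    simp
  have hsq : ∀ ρ, √(1 + deriv l ρ ^ 2) ^ 2 = deriv (fun s : ℝ => s) ρ ^ 2 + deriv l ρ ^ 2 := by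
    intro ρ
    rw [Real.sq_sqrt (by positivity)]
    simp
  constructor
  · intro h ρ hρ
    obtain ⟨ξ, hξ⟩ := (NormedSpace.sphere_nonempty (E := EuclideanSpace ℝ (Fin (m + 1)))
      (x := 0)).2 zero_le_one
    obtain ⟨ν, hν, hm⟩ := h (ρ, ⟨ξ, hξ⟩) hρ
    rw [← key ρ hρ]
    exact hm.rotImm_eq (p := (ρ, ⟨ξ, hξ⟩)) contDiffAt_id (hC.contDiffAt (hJ.mem_nhds hρ)) (hpos hρ)
      (by positivity) (hsq ρ) (by simp) hν
  · intro h p hp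
    refine ⟨rotUnitNormal (fun s => (s, l s)) √(1 + deriv l p.1 ^ 2) p, ?_,
      hasMeanCurvatureAt_rotImm contDiffAt_id (hC.contDiffAt (hJ.mem_nhds hp)) (hpos hp)
      (by positivity) (hsq p.1) ((key p.1 hp).trans (h p.1 hp))⟩
    simp only [rotUnitNormal, deriv_id'']
    positivity

/-- `sinh^m` is an integrating factor: the derivative of the flux difference is `sinh^m` times the
defect in the curvature equation. -/
theorem hasDerivAt_fluxDiff (hl : IsHeightFun J l) {ρ : ℝ} (hρ : ρ ∈ J) (d : ℝ) :
    HasDerivAt (fun ρ => deriv l ρ / √(1 + deriv l ρ ^ 2) * Real.sinh ρ ^ m - F m H d ρ)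
      (Real.sinh ρ ^ m * (deriv (deriv l) ρ / √(1 + deriv l ρ ^ 2) ^ 3 +
      m * (deriv l ρ / √(1 + deriv l ρ ^ 2) * (Real.cosh ρ / Real.sinh ρ)) - (m + 1) * H)) ρ := by
  obtain ⟨hJ, -, -, hpos, hC⟩ := hl
  have h1 := (differentiableAt_deriv (hC.contDiffAt (hJ.mem_nhds hρ))).hasDerivAt
  have hp : 0 < 1 + deriv l ρ ^ 2 := by positivity
  have h2 := ((h1.fun_pow 2).const_add 1).sqrt hp.ne'
  have h3 := ((h1.fun_div h2 (Real.sqrt_pos.2 hp).ne').fun_mul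
    ((Real.hasDerivAt_sinh ρ).fun_pow m)).fun_sub (hasDerivAt_F m H d ρ)
  refine h3.congr_deriv ?_
  have hs : 0 < Real.sinh ρ := Real.sinh_pos_iff.2 (hpos hρ)
  have hq := Real.sqrt_pos.2 hp
  have hq2 := Real.sq_sqrt hp.le
  generalize √(1 + deriv l ρ ^ 2) = q at *
  rcases m with _ | m
  · simp
    field_simp
    rw [hq2]; ring
  · simp only [Nat.add_sub_cancel, pow_succ (Real.sinh ρ) m]
    field_simp
    simp only [Nat.reduceSub, pow_one]
    push_cast
    linear_combination 2 * deriv (deriv l) ρ * Real.sinh ρ * hq2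

/-- Since `sinh^m` does not vanish on `J`, the defect is zero exactly when the flux difference is
constant on the interval `J`. Nonemptiness of `J` makes the constant unique. -/
theorem isRotHGraph_iff_existsUnique (hl : IsHeightFun J l) :
    IsRotHGraph m H J l ↔ ∃! d : ℝ, HasConst m H d J l := by
  rw [isRotHGraph_iff hl]
  have hl' := hl
  obtain ⟨hJ, ⟨ρ₀, hρ₀⟩, hord, hpos, hC⟩ := hl'
  constructor
  · intro h
    set g : ℝ → ℝ := fun ρ => deriv l ρ / √(1 + deriv l ρ ^ 2) * Real.sinh ρ ^ m - F m H 0 ρ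
    have hg : ∀ ρ ∈ J, HasDerivAt g 0 ρ := fun ρ hρ => by
      have := hasDerivAt_fluxDiff (m := m) (H := H) hl hρ 0
      rwa [h ρ hρ, sub_self, mul_zero] at this
    have hconst : ∀ ρ ∈ J, g ρ = g ρ₀ := fun ρ hρ =>
      hJ.is_const_of_deriv_eq_zero hord.isPreconnected
        (fun x hx => (hg x hx).differentiableAt.differentiableWithinAt)
        (fun x hx => (hg x hx).deriv) hρ hρ₀
    refine ⟨g ρ₀, fun ρ hρ => ?_, fun d' hd' => ?_⟩
    · have := hconst ρ hρ
      simp only [g, F] at this ⊢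
      linarith
    · have := hd' ρ₀ hρ₀
      simp only [g, F] at this ⊢
      linarith
  · rintro ⟨d, hd, -⟩ ρ hρ
    have h1 := hasDerivAt_fluxDiff (m := m) (H := H) hl hρ d
    have h2 : (fun ρ => deriv l ρ / √(1 + deriv l ρ ^ 2) * Real.sinh ρ ^ m - F m H d ρ)
        =ᶠ[𝓝 ρ] fun _ => 0 := by
      filter_upwards [hJ.mem_nhds hρ] with x hx
      exact sub_eq_zero.2 (hd x hx)
    have h3 := (h1.congr_of_eventuallyEq h2.symm).unique (hasDerivAt_const ρ (0 : ℝ))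
    have hs : 0 < Real.sinh ρ := Real.sinh_pos_iff.2 (hpos hρ)
    exact sub_eq_zero.1 ((mul_eq_zero.1 h3).resolve_left (pow_pos hs m).ne')

end graph

/-! ### Immersion, completeness and embeddedness of rotated curves -/

section regularity

variable {m : ℕ} {c : ℝ → ℝ × ℝ}

theorem IsUnitSpeed.hasDerivAt (hc : IsUnitSpeed c) (s : ℝ) : HasDerivAt c (deriv c s) s :=
  (hc.1.differentiable (by simp) s).hasDerivAt

theorem IsUnitSpeed.hasDerivAt_fst (hc : IsUnitSpeed c) (s : ℝ) :
    HasDerivAt (fun s => (c s).1) (deriv c s).1 s :=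
  (ContinuousLinearMap.fst ℝ ℝ ℝ).hasFDerivAt.comp_hasDerivAt s (hc.hasDerivAt s)

theorem IsUnitSpeed.hasDerivAt_snd (hc : IsUnitSpeed c) (s : ℝ) :
    HasDerivAt (fun s => (c s).2) (deriv c s).2 s :=
  (ContinuousLinearMap.snd ℝ ℝ ℝ).hasFDerivAt.comp_hasDerivAt s (hc.hasDerivAt s)

theorem contMDiff_rotImm (hc : IsUnitSpeed c) :
    ContMDiff (𝓘(ℝ, ℝ).prod (𝓡 m)) 𝓘(ℝ, Amb (m + 1)) ∞ (rotImm m c) := by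
  have : Fact (Module.finrank ℝ (EuclideanSpace ℝ (Fin (m + 1))) = m + 1) :=
    ⟨finrank_euclideanSpace_fin⟩
  have h1 : ContMDiff (𝓘(ℝ, ℝ).prod (𝓡 m)) 𝓘(ℝ, ℝ) ∞
      (fun p : ℝ × sphere (0 : EuclideanSpace ℝ (Fin (m + 1))) 1 => Real.tanh ((c p.1).1 / 2)) :=
    (contDiff_tanh.comp (hc.1.fst.div_const 2)).contMDiff.comp contMDiff_fst
  have h2 : ContMDiff (𝓘(ℝ, ℝ).prod (𝓡 m)) 𝓘(ℝ, ℝ) ∞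
      (fun p : ℝ × sphere (0 : EuclideanSpace ℝ (Fin (m + 1))) 1 => (c p.1).2) :=
    hc.1.snd.contMDiff.comp contMDiff_fst
  have h3 : ContMDiff (𝓘(ℝ, ℝ).prod (𝓡 m)) 𝓘(ℝ, EuclideanSpace ℝ (Fin (m + 1))) ∞
      (fun p : ℝ × sphere (0 : EuclideanSpace ℝ (Fin (m + 1))) 1 =>
        (p.2 : EuclideanSpace ℝ (Fin (m + 1)))) :=
    (contMDiff_coe_sphere (n := m)).comp contMDiff_snd
  exact (h1.smul h3).prodMk_space h2

theorem isSmoothImm_rotImm (hc : IsUnitSpeed c) (hpos : ∀ s, 0 < (c s).1) :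
    IsSmoothImm (𝓘(ℝ, ℝ).prod (𝓡 m)) (rotImm m c) := by
  refine ⟨contMDiff_rotImm hc, fun p => ?_⟩
  rw [((contMDiff_rotImm hc).mdifferentiable (by simp) p).mfderiv]
  have h := fderiv_inChart_rotImm_injective (m := m) (c := c) (p := p)
    (contDiff_infty.1 hc.1.fst 2).contDiffAt (contDiff_infty.1 hc.1.snd 2).contDiffAt (hpos _)
    one_pos (by rw [(hc.hasDerivAt_fst _).deriv, (hc.hasDerivAt_snd _).deriv, hc.2]; norm_num)
  have hr : range (𝓘(ℝ, ℝ).prod (𝓡 m)) = univ := (𝓘(ℝ, ℝ).prod (𝓡 m)).range_eq_univ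
  rw [hr, fderivWithin_univ]
  exact h

/-- For a unit speed generating curve the induced metric is `ds²` plus a nonnegative term along the
sphere, so a path is at least as long as the variation of its curve parameter. -/
theorem abs_deriv_le_speed (hc : IsUnitSpeed c)
    {γ : ℝ → ℝ × sphere (0 : EuclideanSpace ℝ (Fin (m + 1))) 1} {t : ℝ}
    (h1 : DifferentiableAt ℝ (fun t => (γ t).1) t)
    (h2 : DifferentiableAt ℝ (fun t => ((γ t).2 : EuclideanSpace ℝ (Fin (m + 1)))) t) :
    |deriv (fun t => (γ t).1) t| ≤ √(ghat (rotImm m c (γ t)) (deriv (rotImm m c ∘ γ) t)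
      (deriv (rotImm m c ∘ γ) t)) := by
  have e1 : HasDerivAt (fun t => (c (γ t).1).1) _ t :=
    HasDerivAt.comp (h := fun t => (γ t).1) t (hc.hasDerivAt_fst (γ t).1) h1.hasDerivAt
  have e2 : HasDerivAt (fun t => (c (γ t).1).2) _ t :=
    HasDerivAt.comp (h := fun t => (γ t).1) t (hc.hasDerivAt_snd (γ t).1) h1.hasDerivAt
  have e3 : HasDerivAt (rotImm m c ∘ γ) _ t :=
    ((hasDerivAt_tanh_half e1).smul h2.hasDerivAt).prodMk e2
  have e4 : inner ℝ ((γ t).2 : EuclideanSpace ℝ (Fin (m + 1)))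
      (deriv (fun t => ((γ t).2 : EuclideanSpace ℝ (Fin (m + 1)))) t) = 0 := by
    have k := h2.hasDerivAt.norm_sq
    have k2 : (fun t => ‖((γ t).2 : EuclideanSpace ℝ (Fin (m + 1)))‖ ^ 2) = fun _ => (1 : ℝ) := by
      ext t; simp
    rw [k2] at k
    linarith [k.unique (hasDerivAt_const t (1 : ℝ))]
  have e4' := e4
  rw [real_inner_comm] at e4'
  have e5 : inner ℝ ((γ t).2 : EuclideanSpace ℝ (Fin (m + 1))) (γ t).2 = 1 := by
    rw [real_inner_self_eq_norm_sq]; simp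
  have hu := hc.2 (γ t).1
  apply Real.le_sqrt_of_sq_le
  rw [sq_abs, e3.deriv, ghat, norm_rotImm_fst, sq_abs]
  simp only [inner_add_left, inner_add_right, real_inner_smul_left, real_inner_smul_right,
    e4, e4', e5]
  rw [real_inner_self_eq_norm_sq]
  have h0 := (one_sub_tanh_sq_pos ((c (γ t).1).1 / 2))
  generalize Real.tanh ((c (γ t).1).1 / 2) = r at *
  have k : 0 ≤ 4 / (1 - r ^ 2) ^ 2 * (r ^ 2 *
      ‖deriv (fun t => ((γ t).2 : EuclideanSpace ℝ (Fin (m + 1)))) t‖ ^ 2) := by positivity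
  refine le_of_sub_nonneg (k.trans_eq ?_)
  have h0' := h0.ne'
  field_simp
  linear_combination -4 * deriv (fun t => (γ t).1) t ^ 2 * (1 - r ^ 2) ^ 2 * hu

/-- A path of finite length `C'` changes its curve parameter by at most `C'`. It therefore stays in
a compact interval times the sphere and cannot leave every compact set. -/
theorem isCompleteImm_rotImm (hc : IsUnitSpeed c) :
    IsCompleteImm (𝓘(ℝ, ℝ).prod (𝓡 m)) (rotImm m c) := by
  have : Fact (Module.finrank ℝ (EuclideanSpace ℝ (Fin (m + 1))) = m + 1) :=
    ⟨finrank_euclideanSpace_fin⟩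
  intro γ hγ hK
  by_contra hfin
  have hs : ContinuousOn (fun t => (γ t).1) (Ico 0 1) :=
      continuous_fst.comp_continuousOn hγ.continuousOn
  have hat : ∀ t ∈ Ioo (0 : ℝ) 1, ContMDiffAt 𝓘(ℝ, ℝ) (𝓘(ℝ, ℝ).prod (𝓡 m)) 1 γ t := fun t ht =>
    (hγ t ⟨ht.1.le, ht.2⟩).contMDiffAt (Ico_mem_nhds ht.1 ht.2)
  have hd1 : ∀ t ∈ Ioo (0 : ℝ) 1, DifferentiableAt ℝ (fun t => (γ t).1) t := fun t ht =>
    ((contMDiffAt_fst.comp t (hat t ht)).contDiffAt).differentiableAt (by norm_num)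
  have hd2 : ∀ t ∈ Ioo (0 : ℝ) 1,
      DifferentiableAt ℝ (fun t => ((γ t).2 : EuclideanSpace ℝ (Fin (m + 1)))) t := fun t ht =>
    (((contMDiff_coe_sphere (n := m)).contMDiffAt.comp t
      (contMDiffAt_snd.comp t (hat t ht))).contDiffAt).differentiableAt (by norm_num)
  have hint : IntegrableOn (deriv fun t => (γ t).1) (Ioo 0 1) := by
    refine ⟨(measurable_deriv _).aestronglyMeasurable, ?_⟩
    refine lt_of_le_of_lt (setLIntegral_mono' measurableSet_Ioo fun t ht => ?_)
      (lt_top_iff_ne_top.2 hfin)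
    rw [Real.enorm_eq_ofReal_abs]
    exact ENNReal.ofReal_le_ofReal (abs_deriv_le_speed hc (hd1 t ht) (hd2 t ht))
  set C := ∫ t in Ioo (0 : ℝ) 1, ‖deriv (fun t => (γ t).1) t‖
  have hbound : ∀ t ∈ Ioo (0 : ℝ) 1, |(γ t).1 - (γ 0).1| ≤ C := by
    intro t ht
    have hsub : Ioo 0 t ⊆ Ioo (0 : ℝ) 1 := Ioo_subset_Ioo_right ht.2.le
    have hint' : IntervalIntegrable (deriv fun t => (γ t).1) volume 0 t :=
      (intervalIntegrable_iff_integrableOn_Ioo_of_le ht.1.le).2 (hint.mono_set hsub)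
    rw [← intervalIntegral.integral_eq_sub_of_hasDerivAt_of_le ht.1.le
      (hs.mono (Icc_subset_Ico_right ht.2)) (fun x hx => (hd1 x (hsub hx)).hasDerivAt) hint',
      intervalIntegral.integral_of_le ht.1.le, integral_Ioc_eq_integral_Ioo]
    exact (norm_integral_le_integral_norm _).trans
      (setIntegral_mono_set hint.norm (Eventually.of_forall fun _ => norm_nonneg _)
        hsub.eventuallyLE)
  have h1 := hK (Icc ((γ 0).1 - C) ((γ 0).1 + C) ×ˢ univ) (isCompact_Icc.prod isCompact_univ)
  obtain ⟨t, ht, ht'⟩ := (h1.and (Ioo_mem_nhdsLT (zero_lt_one' ℝ))).exists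
  have := abs_le.1 (hbound t ht')
  exact ht ⟨⟨by linarith, by linarith⟩, mem_univ _⟩

/-- The height recovers the curve parameter continuously, and dividing by the nonzero radius
recovers the point of the sphere. The continuous map `g` performs both operations, and its
composition with the immersion is an evident embedding. -/
theorem isEmbedding_rotImm (hc : IsUnitSpeed c) (hpos : ∀ s, 0 < (c s).1) (e : ℝ ≃ₜ ℝ)
    (he : ∀ s, (c s).2 = e s) : IsEmbedding (rotImm m c) := by
  have hcont : Continuous c := hc.1.continuous
  have htanh : Continuous Real.tanh := (contDiff_tanh (k := 0)).continuous
  let g : Amb (m + 1) → ℝ × EuclideanSpace ℝ (Fin (m + 1)) := fun q =>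
    (e.symm q.2, (Real.tanh ((c (e.symm q.2)).1 / 2))⁻¹ • q.1)
  have hr : Continuous fun q : Amb (m + 1) => Real.tanh ((c (e.symm q.2)).1 / 2) := by fun_prop
  have hg : Continuous g := by
    refine Continuous.prodMk (by fun_prop) ((hr.inv₀ fun q => ?_).smul continuous_fst)
    exact (tanh_half_pos (hpos _)).ne'
  refine IsEmbedding.of_comp (contMDiff_rotImm hc).continuous hg ?_
  have : g ∘ rotImm m c = Prod.map id Subtype.val := by
    ext1 p
    simp only [g, rotImm, Function.comp_apply, he, e.symm_apply_apply, Prod.map, id]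
    rw [inv_smul_smul₀ (tanh_half_pos (hpos _)).ne']
  rw [this]
  exact IsEmbedding.id.prodMap IsEmbedding.subtypeVal

end regularity

/-! ### Smooth division by simple zeros -/

section smoothness

variable {S : Set ℝ} {w ψ φ : ℝ → ℝ}

/-- Differentiation under the integral sign, with the derivative bounded on a compact product. The
dilation factor `ψ u` is general so as to serve both Hadamard's lemma (`ψ u = u`) and the function
`Jint` (`ψ u = u²`). -/
theorem hasDerivAt_integral_dilation (hS : IsOpen S)
    (hstar : ∀ x ∈ S, ∀ u ∈ Icc (0 : ℝ) 1, u * x ∈ S) (hψ : Continuous ψ)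
    (hψ' : ∀ u ∈ Icc (0 : ℝ) 1, ψ u ∈ Icc (0 : ℝ) 1) (hw : Continuous w) (hφ : ContDiffOn ℝ 1 φ S)
    {x₀ : ℝ} (hx₀ : x₀ ∈ S) :
    HasDerivAt (fun x => ∫ u in (0 : ℝ)..1, w u * φ (ψ u * x))
      (∫ u in (0 : ℝ)..1, (w u * ψ u) * deriv φ (ψ u * x₀)) x₀ := by
  obtain ⟨ε, hε, hball⟩ := Metric.nhds_basis_closedBall.mem_iff.1 (hS.mem_nhds hx₀)
  have hφ' : ContinuousOn (deriv φ) S := hφ.continuousOn_deriv_of_isOpen hS le_rfl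
  have hint : ∀ x ∈ S, ContinuousOn (fun u => w u * φ (ψ u * x)) (Icc 0 1) := fun x hx =>
    hw.continuousOn.mul (hφ.continuousOn.comp (hψ.mul continuous_const).continuousOn
      fun u hu => hstar x hx _ (hψ' u hu))
  have hint' : ∀ x ∈ S, ContinuousOn (fun u => (w u * ψ u) * deriv φ (ψ u * x)) (Icc 0 1) :=
    fun x hx => (hw.mul hψ).continuousOn.mul (hφ'.comp (hψ.mul continuous_const).continuousOn
      fun u hu => hstar x hx _ (hψ' u hu))
  have hjoint : ContinuousOn (fun q : ℝ × ℝ => (w q.1 * ψ q.1) * deriv φ (ψ q.1 * q.2))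
      (Icc 0 1 ×ˢ closedBall x₀ ε) := by
    refine ContinuousOn.mul (by fun_prop) (hφ'.comp (by fun_prop) fun q hq => ?_)
    exact hstar _ (hball hq.2) _ (hψ' _ hq.1)
  obtain ⟨C, hC⟩ := (isCompact_Icc.prod (isCompact_closedBall x₀ ε)).exists_bound_of_continuousOn
    hjoint
  have hIoc : uIoc (0 : ℝ) 1 ⊆ Icc 0 1 := by rw [uIoc_of_le zero_le_one]; exact Ioc_subset_Icc_self
  refine (intervalIntegral.hasDerivAt_integral_of_dominated_loc_of_deriv_le
    (F := fun x u => w u * φ (ψ u * x)) (F' := fun x u => (w u * ψ u) * deriv φ (ψ u * x))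
    (bound := fun _ => C) (closedBall_mem_nhds x₀ hε) ?_ ?_ ?_ ?_ ?_ ?_).2
  · filter_upwards [hS.mem_nhds hx₀] with x hx
    exact ((hint x hx).mono hIoc).aestronglyMeasurable measurableSet_uIoc
  · exact ContinuousOn.intervalIntegrable_of_Icc zero_le_one (hint x₀ hx₀)
  · exact ((hint' x₀ hx₀).mono hIoc).aestronglyMeasurable measurableSet_uIoc
  · exact Eventually.of_forall fun u hu x hx => hC (u, x) ⟨hIoc hu, hx⟩
  · exact intervalIntegrable_const
  · refine Eventually.of_forall fun u hu x hx => ?_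
    have h1 : HasDerivAt φ (deriv φ (ψ u * x)) (ψ u * x) :=
      ((hφ.contDiffAt (hS.mem_nhds (hstar x (hball hx) _ (hψ' u (hIoc hu))))).differentiableAt
        (by norm_num)).hasDerivAt
    have h2 : HasDerivAt (fun x => ψ u * x) (ψ u) x := by
      simpa using (hasDerivAt_id x).const_mul (ψ u)
    refine ((HasDerivAt.comp x h1 h2).const_mul (w u)).congr_deriv ?_
    ring

/-- The class of such integrals is closed under differentiation, which replaces `w` by `w ψ` and `φ`
by `φ'`; hence the induction generalizes over both. -/
theorem contDiffOn_integral_dilation (hS : IsOpen S)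
    (hstar : ∀ x ∈ S, ∀ u ∈ Icc (0 : ℝ) 1, u * x ∈ S) (hψ : Continuous ψ)
    (hψ' : ∀ u ∈ Icc (0 : ℝ) 1, ψ u ∈ Icc (0 : ℝ) 1) (hw : Continuous w)
    (hφ : ContDiffOn ℝ ∞ φ S) :
    ContDiffOn ℝ ∞ (fun x => ∫ u in (0 : ℝ)..1, w u * φ (ψ u * x)) S := by
  rw [contDiffOn_infty]
  intro n
  induction n generalizing w φ with
  | zero =>
    refine contDiffOn_zero.2 fun x hx => ?_
    exact (hasDerivAt_integral_dilation hS hstar hψ hψ' hw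
      (contDiffOn_infty.1 hφ 1) hx).continuousAt.continuousWithinAt
  | succ n ih =>
    have hd := fun x hx => hasDerivAt_integral_dilation hS hstar hψ hψ' hw
      (contDiffOn_infty.1 hφ 1) (x₀ := x) hx
    push_cast
    refine (contDiffOn_succ_iff_deriv_of_isOpen hS).2
      ⟨fun x hx => (hd x hx).differentiableAt.differentiableWithinAt, by simp, ?_⟩
    refine (ih (hw.mul hψ) (hφ.deriv_of_isOpen hS (by simp))).congr fun x hx => ?_
    exact (hd x hx).deriv

/-- Hadamard's lemma: near `a` the slope is the average of `f'` over the segment from `a` to `z`,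
which is smooth in `z`. Away from `a` it is an ordinary quotient. -/
theorem contDiffOn_dslope {f : ℝ → ℝ} {a : ℝ} {U : Set ℝ} (hU : IsOpen U) (ha : a ∈ U)
    (hf : ContDiffOn ℝ ∞ f U) : ContDiffOn ℝ ∞ (dslope f a) U := by
  intro x hx
  refine ContDiffAt.contDiffWithinAt ?_
  rcases eq_or_ne x a with rfl | hne
  · obtain ⟨ε, hε, hball⟩ := Metric.isOpen_iff.1 hU x ha
    have hmap : ∀ y ∈ ball (0 : ℝ) ε, x + y ∈ U := fun y hy => hball (by simpa using hy)
    have hφ : ContDiffOn ℝ ∞ (fun y => deriv f (x + y)) (ball 0 ε) :=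
      (hf.deriv_of_isOpen (m := ∞) hU (by simp)).comp (by fun_prop) hmap
    have hstar : ∀ y ∈ ball (0 : ℝ) ε, ∀ u ∈ Icc (0 : ℝ) 1, u * y ∈ ball (0 : ℝ) ε := by
      intro y hy u hu
      simp only [mem_ball, dist_zero_right, norm_mul, Real.norm_eq_abs, abs_of_nonneg hu.1] at *
      exact (mul_le_of_le_one_left (abs_nonneg _) hu.2).trans_lt hy
    have h := contDiffOn_integral_dilation (w := fun _ => 1) (ψ := fun u => u) isOpen_ball hstar
      continuous_id (fun u hu => hu) continuous_const hφ
    have h2 : ContDiffAt ℝ ∞ (fun z => ∫ u in (0 : ℝ)..1, 1 * deriv f (x + u * (z - x))) x := by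
      have h3 := (h.contDiffAt (ball_mem_nhds 0 hε))
      have h4 : ContDiffAt ℝ ∞ (fun z : ℝ => z - x) x := by fun_prop
      have h5 : ContDiffAt ℝ ∞ (fun y => ∫ u in (0 : ℝ)..1, 1 * deriv f (x + u * y)) (x - x) := by
        rwa [sub_self]
      exact ContDiffAt.comp (f := fun z : ℝ => z - x) x h5 h4
    refine h2.congr_of_eventuallyEq ?_
    filter_upwards [ball_mem_nhds x hε] with z hz
    rcases eq_or_ne z x with rfl | hzx
    · simp
    · rw [dslope_of_ne _ hzx, slope_def_field]
      have hz' : z - x ∈ ball (0 : ℝ) ε := by simpa [dist_eq_norm] using hz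
      have hin : ∀ u ∈ Icc (0 : ℝ) 1, x + u * (z - x) ∈ U := fun u hu =>
        hmap _ (hstar _ hz' u hu)
      have hder : ∀ u ∈ uIcc (0 : ℝ) 1, HasDerivAt (fun u => f (x + u * (z - x)))
          (deriv f (x + u * (z - x)) * (z - x)) u := by
        intro u hu
        rw [uIcc_of_le zero_le_one] at hu
        have k1 : HasDerivAt f (deriv f (x + u * (z - x))) (x + u * (z - x)) :=
          ((hf.contDiffAt (hU.mem_nhds (hin u hu))).differentiableAt (by simp)).hasDerivAt
        have k2 : HasDerivAt (fun u => x + u * (z - x)) (z - x) u := by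
          simpa using ((hasDerivAt_id u).mul_const (z - x)).const_add x
        exact HasDerivAt.comp u k1 k2
      have hcont : ContinuousOn (fun u => deriv f (x + u * (z - x)) * (z - x)) (uIcc 0 1) := by
        rw [uIcc_of_le zero_le_one]
        exact ((hf.continuousOn_deriv_of_isOpen hU (by simp)).comp (by fun_prop) hin).mul_const _
      have := intervalIntegral.integral_eq_sub_of_hasDerivAt hder hcont.intervalIntegrable
      rw [intervalIntegral.integral_mul_const] at this
      simp only [one_mul, zero_mul, add_zero, add_sub_cancel] at this ⊢
      rw [← this]
      exact mul_div_cancel_right₀ _ (sub_ne_zero.2 hzx)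
  · have h1 : ContDiffAt ℝ ∞ (slope f a) x := by
      have : slope f a = fun x => (x - a)⁻¹ * (f x - f a) := by ext; simp [slope]
      rw [this]
      exact ((contDiffAt_id.sub contDiffAt_const).inv (sub_ne_zero.2 hne)).mul
        ((hf.contDiffAt (hU.mem_nhds hx)).sub contDiffAt_const)
    refine h1.congr_of_eventuallyEq ?_
    filter_upwards [isOpen_ne.mem_nhds hne] with y hy using dslope_of_ne _ hy

/-- Division of a smooth function by the polynomial of its two simple zeros. -/
theorem exists_quotient_of_simple_zeros {f : ℝ → ℝ} {α β : ℝ} {U : Set ℝ} (hU : IsOpen U)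
    (hαβ : α < β) (hsub : Icc α β ⊆ U) (hf : ContDiffOn ℝ ∞ f U) (hα : f α = 0) (hβ : f β = 0)
    (hpos : ∀ x ∈ Ioo α β, 0 < f x) (hα' : 0 < deriv f α) (hβ' : deriv f β < 0) :
    ∃ h : ℝ → ℝ, ContDiffOn ℝ ∞ h U ∧ (∀ x, f x = (x - α) * (β - x) * h x) ∧
      ∀ x ∈ Icc α β, 0 < h x := by
  have hαU := hsub (left_mem_Icc.2 hαβ.le)
  have hβU := hsub (right_mem_Icc.2 hαβ.le)
  set g := dslope f α
  have hg : ∀ x, f x = (x - α) * g x := fun x => by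
    have := sub_smul_dslope f α x
    rw [smul_eq_mul, hα, sub_zero] at this
    exact this.symm
  have hgβ : g β = 0 := by
    have := hg β
    rw [hβ] at this
    exact (mul_eq_zero.1 this.symm).resolve_left (sub_ne_zero.2 hαβ.ne')
  have hh : ∀ x, g x = (x - β) * dslope g β x := fun x => by
    have := sub_smul_dslope g β x
    rw [smul_eq_mul, hgβ, sub_zero] at this
    exact this.symm
  have hsm : ContDiffOn ℝ ∞ (fun x => -dslope g β x) U :=
    (contDiffOn_dslope hU hβU (contDiffOn_dslope hU hαU hf)).neg
  have heq : ∀ x, f x = (x - α) * (β - x) * (-dslope g β x) := fun x => by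
    rw [hg, hh]; ring
  refine ⟨_, hsm, heq, fun x hx => ?_⟩
  -- At `α` and `β` the sign of the quotient is read off from the derivative of `f`, and in between
  -- from the sign of `f` itself.
  have hder : ∀ y ∈ U, HasDerivAt f (((β - y) - (y - α)) * (-dslope g β y) +
      (y - α) * (β - y) * deriv (fun x => -dslope g β x) y) y := by
    intro y hy
    have k1 := ((hsm.contDiffAt (hU.mem_nhds hy)).differentiableAt (by simp)).hasDerivAt
    have k2 := (((hasDerivAt_id y).sub_const α).fun_mul ((hasDerivAt_id y).const_sub β)).fun_mul k1
    refine (k2.congr_of_eventuallyEq (Eventually.of_forall heq)).congr_deriv ?_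
    simp only [id]
    ring
  rcases eq_or_lt_of_le hx.1 with rfl | h1
  · rw [(hder α hαU).deriv] at hα'
    simp only [sub_self, zero_mul, add_zero, sub_zero] at hα'
    exact (pos_iff_pos_of_mul_pos hα').1 (sub_pos.2 hαβ)
  rcases eq_or_lt_of_le hx.2 with rfl | h2
  · rw [(hder x hβU).deriv] at hβ'
    nlinarith
  · have := hpos x ⟨h1, h2⟩
    rw [heq] at this
    exact (pos_iff_pos_of_mul_pos this).1 (mul_pos (sub_pos.2 h1) (sub_pos.2 h2))

end smoothness

/-! ### Oscillation between two simple zeros by quadrature -/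

section oscillator

/-- A smooth periodic solution of `ρ' ² = f(ρ)`, `ρ'' = f'(ρ) / 2` that oscillates between two
consecutive simple zeros of `f`. -/
structure IsOscillator (f : ℝ → ℝ) (α β L : ℝ) (ρ : ℝ → ℝ) : Prop where
  contDiff : ContDiff ℝ ∞ ρ
  L_pos : 0 < L
  mem : ∀ s, ρ s ∈ Icc α β
  start : ρ 0 = α
  finish : ρ (L / 2) = β
  even : ∀ s, ρ (-s) = ρ s
  periodic : ∀ s, ρ (s + L) = ρ s
  sq_deriv : ∀ s, deriv ρ s ^ 2 = f (ρ s)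
  deriv_deriv : ∀ s, deriv (deriv ρ) s = deriv f (ρ s) / 2
  deriv_pos : ∀ s ∈ Ioo 0 (L / 2), 0 < deriv ρ s

/-- Write `f(x) = (x - α)(β - x) h(x)` and seek `ρ = R(θ)` with `R(θ) = (α + β) / 2 - A cos θ`. Then
`f(R) = A² sin² θ h(R)`, so `ρ'² = f(ρ)` is implied by `θ' = k(θ)` with `k = √(h ∘ R)` smooth,
positive, even and `2π`-periodic. The time `τ = ∫ 1/k` is strictly increasing and onto, and `θ` is
its inverse. The turning points are just `θ ∈ ℤ π`, where nothing is singular. -/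
theorem exists_oscillator {f : ℝ → ℝ} {α β : ℝ} {U : Set ℝ} (hU : IsOpen U)
    (hαβ : α < β) (hsub : Icc α β ⊆ U) (hf : ContDiffOn ℝ ∞ f U) (hα : f α = 0) (hβ : f β = 0)
    (hpos : ∀ x ∈ Ioo α β, 0 < f x) (hα' : 0 < deriv f α) (hβ' : deriv f β < 0) :
    ∃ L ρ, IsOscillator f α β L ρ := by
  obtain ⟨h, hh, hfh, hhpos⟩ := exists_quotient_of_simple_zeros hU hαβ hsub hf hα hβ hpos hα' hβ'
  set A := (β - α) / 2 with hA
  have hA0 : 0 < A := by linarith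
  set R : ℝ → ℝ := fun θ => (α + β) / 2 - A * Real.cos θ with hR
  have hRmem : ∀ θ, R θ ∈ Icc α β := fun θ => by
    have h1 := Real.neg_one_le_cos θ
    have h2 := Real.cos_le_one θ
    constructor <;> simp only [hR] <;> nlinarith
  have hRsm : ContDiff ℝ ∞ R := contDiff_const.sub (contDiff_const.mul Real.contDiff_cos)
  have hRder : ∀ θ, HasDerivAt R (A * Real.sin θ) θ := fun θ => by
    simpa using ((Real.hasDerivAt_cos θ).const_mul A).const_sub ((α + β) / 2)
  set k : ℝ → ℝ := fun θ => √(h (R θ)) with hk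
  have hkpos : ∀ θ, 0 < k θ := fun θ => Real.sqrt_pos.2 (hhpos _ (hRmem θ))
  have hksq : ∀ θ, k θ ^ 2 = h (R θ) := fun θ => Real.sq_sqrt (hhpos _ (hRmem θ)).le
  have hksm : ContDiff ℝ ∞ k := by
    rw [contDiff_iff_contDiffAt]
    intro θ
    refine ContDiffAt.sqrt ?_ (hhpos _ (hRmem θ)).ne'
    exact ContDiffAt.comp θ (hh.contDiffAt (hU.mem_nhds (hsub (hRmem θ)))) hRsm.contDiffAt
  have hkinv : Continuous fun θ => (k θ)⁻¹ := hksm.continuous.inv₀ fun θ => (hkpos θ).ne'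
  -- An upper bound for `k` bounds `1/k` below by `ε > 0`; so `τ` grows at least linearly in both
  -- directions and is onto.
  obtain ⟨C, hC⟩ := isCompact_Icc.exists_bound_of_continuousOn (hh.continuousOn.mono hsub)
  set ε := (√(|C| + 1))⁻¹ with hε
  have hε0 : 0 < ε := by positivity
  have hεk : ∀ θ, ε ≤ (k θ)⁻¹ := fun θ => by
    refine inv_anti₀ (hkpos θ) (Real.sqrt_le_sqrt ?_)
    have := hC _ (hRmem θ)
    rw [Real.norm_eq_abs] at this
    linarith [le_abs_self (h (R θ)), le_abs_self C]
  set τ : ℝ → ℝ := fun θ => ∫ x in (0 : ℝ)..θ, (k x)⁻¹ with hτ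
  have hτder : ∀ θ, HasDerivAt τ (k θ)⁻¹ θ := fun θ =>
    intervalIntegral.integral_hasDerivAt_right (hkinv.intervalIntegrable _ _)
      (hkinv.stronglyMeasurableAtFilter _ _) hkinv.continuousAt
  have hτ0 : τ 0 = 0 := by simp [hτ]
  have hτmono : StrictMono τ := strictMono_of_deriv_pos fun θ => by
    rw [(hτder θ).deriv]; exact inv_pos.2 (hkpos θ)
  have hτcont : Continuous τ := continuous_iff_continuousAt.2 fun θ => (hτder θ).continuousAt
  have hσmono : Monotone fun θ => τ θ - ε * θ := by
    have hd : ∀ θ, HasDerivAt (fun θ => τ θ - ε * θ) ((k θ)⁻¹ - ε * 1) θ := fun θ =>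
      (hτder θ).sub ((hasDerivAt_id θ).const_mul ε)
    refine monotone_of_deriv_nonneg (fun θ => (hd θ).differentiableAt) fun θ => ?_
    rw [(hd θ).deriv]; linarith [hεk θ]
  have hτsurj : Function.Surjective τ := by
    refine hτcont.surjective ?_ ?_
    · refine tendsto_atTop_mono' atTop ?_ (tendsto_id.const_mul_atTop hε0)
      filter_upwards [eventually_ge_atTop 0] with θ hθ
      have := hσmono hθ
      simp only [hτ0] at this
      simp only [id]
      linarith
    · refine tendsto_atBot_mono' atBot ?_ (tendsto_id.const_mul_atBot hε0)
      filter_upwards [eventually_le_atBot 0] with θ hθ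
      have := hσmono hθ
      simp only [hτ0] at this
      simp only [id]
      linarith
  let e : ℝ ≃o ℝ := hτmono.orderIsoOfSurjective τ hτsurj
  set θ : ℝ → ℝ := fun s => e.symm s with hθ
  have hτθ : ∀ s, τ (θ s) = s := fun s => e.apply_symm_apply s
  have hθτ : ∀ x, θ (τ x) = x := fun x => e.symm_apply_apply x
  have hθmono : StrictMono θ := e.symm.strictMono
  have hθder : ∀ s, HasDerivAt θ (k (θ s)) s := fun s => by
    have := HasDerivAt.of_local_left_inverse (f := τ) (g := θ) (a := s)
      e.symm.toHomeomorph.continuous.continuousAt (hτder (θ s)) (inv_ne_zero (hkpos _).ne')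
      (Eventually.of_forall hτθ)
    rwa [inv_inv] at this
  -- Bootstrapping: `θ' = k ∘ θ` is as regular as `θ`, so each degree of regularity yields the next.
  have hθsm : ContDiff ℝ ∞ θ := by
    rw [contDiff_infty]
    intro n
    induction n with
    | zero => exact contDiff_zero.2 e.symm.toHomeomorph.continuous
    | succ n ih =>
      push_cast
      refine contDiff_succ_iff_deriv.2 ⟨fun s => (hθder s).differentiableAt, by simp, ?_⟩
      have : deriv θ = k ∘ θ := by ext s; exact (hθder s).deriv
      rw [this]
      exact (contDiff_infty.1 hksm n).comp ih
  have hkeven : ∀ x, k (-x) = k x := fun x => by simp [hk, hR]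
  have hkper : ∀ x, k (x + 2 * Real.pi) = k x := fun x => by simp [hk, hR]
  have hτodd : ∀ x, τ (-x) = -τ x := fun x => by
    have := intervalIntegral.integral_comp_neg (fun x => (k x)⁻¹) (a := 0) (b := x)
    simp only [hkeven, neg_zero] at this
    rw [hτ]
    simp only
    rw [this, intervalIntegral.integral_symm]
  have hτper : ∀ x, τ (x + 2 * Real.pi) = τ x + τ (2 * Real.pi) := fun x => by
    have h1 : (fun x => (k x)⁻¹).Periodic (2 * Real.pi) := fun x => by simp only [hkper]
    have h2 := h1.intervalIntegral_add_eq 0 x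
    rw [zero_add] at h2
    simp only [hτ]
    rw [h2, intervalIntegral.integral_add_adjacent_intervals] <;>
    exact hkinv.intervalIntegrable _ _
  set L := τ (2 * Real.pi) with hL
  have hL0 : 0 < L := by
    rw [← hτ0]; exact hτmono Real.two_pi_pos
  have hLpi : τ Real.pi = L / 2 := by
    -- Oddness and quasi-periodicity of `τ` at `-π` show that half a turn takes half the period.
    have h1 := hτper (-Real.pi)
    rw [hτodd, show -Real.pi + 2 * Real.pi = Real.pi by ring] at h1
    linarith
  have hθodd : ∀ s, θ (-s) = -θ s := fun s => by
    rw [← hθτ (-θ s), hτodd, hτθ]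
  have hθper : ∀ s, θ (s + L) = θ s + 2 * Real.pi := fun s => by
    rw [← hθτ (θ s + 2 * Real.pi), hτper, hτθ]
  have hθ0 : θ 0 = 0 := by have := hθτ 0; rwa [hτ0] at this
  have hθL : θ (L / 2) = Real.pi := by rw [← hLpi, hθτ]
  have hρder : ∀ s, HasDerivAt (fun s => R (θ s)) (A * Real.sin (θ s) * k (θ s)) s := fun s =>
    HasDerivAt.comp (h₂ := R) (h := θ) s (hRder (θ s)) (hθder s)
  have hfA : ∀ x, f (R x) = A ^ 2 * Real.sin x ^ 2 * h (R x) := fun x => by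
    rw [hfh]
    simp only [hR]
    rw [Real.sin_sq, hA]; ring
  refine ⟨L, fun s => R (θ s), hRsm.comp hθsm, hL0, fun s => hRmem _, ?_, ?_, ?_, ?_, ?_, ?_, ?_⟩
  · simp [hR, hθ0, hA]; ring
  · simp [hR, hθL, hA]; ring
  · intro s; simp [hR, hθodd]
  · intro s; simp [hR, hθper]
  · intro s
    rw [(hρder s).deriv, hfA, ← hksq]; ring
  · intro s
    have h1 : deriv (fun s => R (θ s)) = fun s => A * Real.sin (θ s) * k (θ s) := by
      ext s; exact (hρder s).deriv
    have hhd : HasDerivAt h (deriv h (R (θ s))) (R (θ s)) :=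
      ((hh.contDiffAt (hU.mem_nhds (hsub (hRmem _)))).differentiableAt (by simp)).hasDerivAt
    have h2 : HasDerivAt k (deriv h (R (θ s)) * (A * Real.sin (θ s)) / (2 * k (θ s))) (θ s) :=
      (HasDerivAt.comp (θ s) hhd (hRder (θ s))).sqrt (hhpos _ (hRmem _)).ne'
    have h3 := (((Real.hasDerivAt_sin (θ s)).const_mul A).mul h2).comp s (hθder s)
    have h4 := (((hasDerivAt_id (R (θ s))).sub_const α).fun_mul
      ((hasDerivAt_id (R (θ s))).const_sub β)).fun_mul hhd
    have h5 : HasDerivAt f _ (R (θ s)) := h4.congr_of_eventuallyEq (Eventually.of_forall hfh)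
    have h6 : HasDerivAt (fun s => A * Real.sin (θ s) * k (θ s)) _ s := h3
    rw [h1, h6.deriv, h5.deriv]
    have hk0 := (hkpos (θ s)).ne'
    simp only [id]
    rw [← hksq]
    have h7 : R (θ s) - α = A * (1 - Real.cos (θ s)) := by simp only [hR, hA]; ring
    have h8 : β - R (θ s) = A * (1 + Real.cos (θ s)) := by simp only [hR, hA]; ring
    rw [h7, h8]
    field_simp
    rw [Real.sin_sq]
    ring
  · intro s hs
    rw [(hρder s).deriv]
    have h1 : 0 < θ s := by rw [← hθ0]; exact hθmono hs.1
    have h2 : θ s < Real.pi := by rw [← hθL]; exact hθmono hs.2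
    exact mul_pos (mul_pos hA0 (Real.sin_pos_of_pos_of_lt_pi h1 h2)) (hkpos _)

end oscillator

/-! ### Profile curves `t' = G(ρ)`, `ρ'² + t'² = 1` -/

/-- A unit speed curve `c = (ρ, t)` with `t' = G(ρ)` whose first coordinate oscillates between `α`
and `β`. -/
structure IsProfile (G : ℝ → ℝ) (α β L T : ℝ) (c : ℝ → ℝ × ℝ) : Prop where
  unitSpeed : IsUnitSpeed c
  L_pos : 0 < L
  mem : ∀ s, (c s).1 ∈ Icc α β
  start : c 0 = (α, 0)
  finish : (c (L / 2)).1 = β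
  symm : ∀ s, c (-s) = ((c s).1, -(c s).2)
  period : ∀ s, c (s + L) = c s + (0, T)
  deriv_snd : ∀ s, (deriv c s).2 = G (c s).1
  hasDerivAt_deriv : ∀ s, HasDerivAt (deriv c)
    (-(G (c s).1 * deriv G (c s).1), deriv G (c s).1 * (deriv c s).1) s
  deriv_fst_pos : ∀ s ∈ Ioo 0 (L / 2), 0 < (deriv c s).1

/-- The oscillator for `f = 1 - G²` supplies `ρ`, and `t` is the primitive of `G ∘ ρ`. The sign
conditions on `G G'` say that `±1` is reached by `G` with nonzero speed, so that the zeros of `f`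
are simple. Evenness and periodicity of `ρ` give the symmetries of `t`. -/
theorem exists_profile {G : ℝ → ℝ} {α β : ℝ} {U : Set ℝ} (hU : IsOpen U)
    (hαβ : α < β) (hsub : Icc α β ⊆ U) (hG : ContDiffOn ℝ ∞ G U) (hα : G α ^ 2 = 1)
    (hβ : G β ^ 2 = 1) (hlt : ∀ x ∈ Ioo α β, G x ^ 2 < 1) (hα' : G α * deriv G α < 0)
    (hβ' : 0 < G β * deriv G β) : ∃ L T c, IsProfile G α β L T c := by
  have hf : ContDiffOn ℝ ∞ (fun x => 1 - G x ^ 2) U := contDiffOn_const.sub (hG.pow 2)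
  have hGd : ∀ x ∈ U, HasDerivAt G (deriv G x) x := fun x hx =>
    ((hG.contDiffAt (hU.mem_nhds hx)).differentiableAt (by simp)).hasDerivAt
  have hfd : ∀ x ∈ U, deriv (fun x => 1 - G x ^ 2) x = -(2 * (G x * deriv G x)) := fun x hx => by
    rw [(((hGd x hx).fun_pow 2).const_sub 1).deriv]
    simp; ring
  obtain ⟨L, ρ, hρ⟩ := exists_oscillator hU hαβ hsub hf (by simp [hα]) (by simp [hβ])
    (fun x hx => sub_pos.2 (hlt x hx))
    (by rw [hfd α (hsub (left_mem_Icc.2 hαβ.le))]; linarith)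
    (by rw [hfd β (hsub (right_mem_Icc.2 hαβ.le))]; linarith)
  have hGρ : ContDiff ℝ ∞ fun s => G (ρ s) := by
    rw [contDiff_iff_contDiffAt]
    exact fun s => ContDiffAt.comp s (hG.contDiffAt (hU.mem_nhds (hsub (hρ.mem s))))
      hρ.contDiff.contDiffAt
  set t : ℝ → ℝ := fun s => ∫ x in (0 : ℝ)..s, G (ρ x) with ht
  have hint : ∀ a b, IntervalIntegrable (fun s => G (ρ s)) volume a b := fun a b =>
    hGρ.continuous.intervalIntegrable a b
  have htd : ∀ s, HasDerivAt t (G (ρ s)) s := fun s =>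
    intervalIntegral.integral_hasDerivAt_right (hint _ _)
      (hGρ.continuous.stronglyMeasurableAtFilter _ _) hGρ.continuous.continuousAt
  have htsm : ContDiff ℝ ∞ t := by
    refine contDiff_infty_iff_deriv.2 ⟨fun s => (htd s).differentiableAt, ?_⟩
    have : deriv t = fun s => G (ρ s) := by ext s; exact (htd s).deriv
    rwa [this]
  have hρd : ∀ s, HasDerivAt ρ (deriv ρ s) s := fun s =>
    (hρ.contDiff.differentiable (by simp) s).hasDerivAt
  have hcd : ∀ s, HasDerivAt (fun s => (ρ s, t s)) (deriv ρ s, G (ρ s)) s := fun s =>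
    (hρd s).prodMk (htd s)
  have hcd' : deriv (fun s => (ρ s, t s)) = fun s => (deriv ρ s, G (ρ s)) := by
    ext1 s; exact (hcd s).deriv
  refine ⟨L, t L, fun s => (ρ s, t s), ⟨hρ.contDiff.prodMk htsm, fun s => ?_⟩, hρ.L_pos, hρ.mem,
    ?_, hρ.finish, fun s => ?_, fun s => ?_, fun s => ?_, fun s => ?_, fun s hs => ?_⟩
  · rw [hcd', hρ.sq_deriv]; simp
  · simp [ht, hρ.start]
  · refine Prod.ext (hρ.even s) ?_
    have := intervalIntegral.integral_comp_neg (fun x => G (ρ x)) (a := 0) (b := s)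
    simp only [hρ.even, neg_zero] at this
    simp only [ht]
    rw [this, intervalIntegral.integral_symm]
  · refine Prod.ext (by simp [hρ.periodic s]) ?_
    have h1 : (fun x => G (ρ x)).Periodic L := fun x => by simp only [hρ.periodic]
    have h2 := h1.intervalIntegral_add_eq 0 s
    rw [zero_add] at h2
    simp only [ht, Prod.snd_add]
    rw [h2, intervalIntegral.integral_add_adjacent_intervals (hint _ _) (hint _ _)]
  · rw [hcd']
  · rw [hcd']
    have h1 : HasDerivAt (deriv ρ) (deriv (deriv ρ) s) s :=
      ((contDiff_infty_iff_deriv.1 hρ.contDiff).2.differentiable (by simp) s).hasDerivAt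
    rw [hρ.deriv_deriv, hfd _ (hsub (hρ.mem s))] at h1
    have h2 : HasDerivAt (fun s => G (ρ s)) _ s :=
      HasDerivAt.comp s (hGd _ (hsub (hρ.mem s))) (hρd s)
    refine (h1.prodMk h2).congr_deriv ?_
    ext <;> simp
    ring
  · rw [hcd']; exact hρ.deriv_pos s hs

namespace IsProfile

variable {G : ℝ → ℝ} {α β L T : ℝ} {c : ℝ → ℝ × ℝ}

theorem strictMonoOn (hc : IsProfile G α β L T c) :
    StrictMonoOn (fun s => (c s).1) (Icc 0 (L / 2)) := by
  refine strictMonoOn_of_deriv_pos (convex_Icc _ _) hc.unitSpeed.1.fst.continuous.continuousOn ?_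
  intro s hs
  rw [interior_Icc] at hs
  rw [(hc.unitSpeed.hasDerivAt_fst s).deriv]
  exact hc.deriv_fst_pos s hs

theorem image_Ioo (hc : IsProfile G α β L T c) {s : ℝ} (hs : s ∈ Icc 0 (L / 2)) :
    (fun s => (c s).1) '' Ioo 0 s = Ioo α (c s).1 := by
  have h0 : (c 0).1 = α := by rw [hc.start]
  have hL := hc.L_pos
  have h0m : (0 : ℝ) ∈ Icc 0 (L / 2) := ⟨le_rfl, by linarith⟩
  refine Subset.antisymm ?_ ?_
  · rintro _ ⟨x, hx, rfl⟩
    have hxm : x ∈ Icc 0 (L / 2) := ⟨hx.1.le, hx.2.le.trans hs.2⟩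
    exact ⟨h0 ▸ hc.strictMonoOn h0m hxm hx.1, hc.strictMonoOn hxm hs hx.2⟩
  · have := intermediate_value_Ioo hs.1 (f := fun s => (c s).1)
      hc.unitSpeed.1.fst.continuous.continuousOn
    rwa [h0] at this

theorem deriv_fst_eq (hc : IsProfile G α β L T c) {s : ℝ} (hs : s ∈ Ioo 0 (L / 2)) :
    (deriv c s).1 = √(1 - G (c s).1 ^ 2) := by
  have h := hc.unitSpeed.2 s
  rw [hc.deriv_snd] at h
  rw [← h, add_sub_cancel_right, Real.sqrt_sq (hc.deriv_fst_pos s hs).le]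

theorem sq_lt_one (hc : IsProfile G α β L T c) {x : ℝ} (hx : x ∈ Ioo α β) : G x ^ 2 < 1 := by
  have hL := hc.L_pos
  rw [← hc.finish, ← hc.image_Ioo (s := L / 2) ⟨by linarith, le_rfl⟩] at hx
  obtain ⟨s, hs, rfl⟩ := hx
  have h := hc.unitSpeed.2 s
  rw [hc.deriv_snd] at h
  have := hc.deriv_fst_pos s hs
  simp only
  nlinarith

theorem abs_smul_eq (hc : IsProfile G α β L T c) {s : ℝ} (hs : s ∈ Ioo 0 (L / 2)) :
    |(deriv c s).1| • (G (c s).1 / √(1 - G (c s).1 ^ 2)) = (deriv c s).2 := by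
  have h := hc.deriv_fst_pos s hs
  rw [abs_of_pos h, ← hc.deriv_fst_eq hs, hc.deriv_snd, smul_eq_mul]
  exact mul_div_cancel₀ _ h.ne'

theorem continuous_deriv_snd (hc : IsProfile G α β L T c) : Continuous fun s => (deriv c s).2 :=
  (hc.unitSpeed.1.continuous_deriv (by simp)).snd

/-- Under the change of variable `x = ρ(s)` the Jacobian `ρ' = √(1 - G²)` cancels the singular
denominator. The improper integral becomes that of the continuous function `t'` over half a period.
-/
theorem integrableOn (hc : IsProfile G α β L T c) :
    IntegrableOn (fun x => G x / √(1 - G x ^ 2)) (Ioo α β) := by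
  have hL := hc.L_pos
  have hm : L / 2 ∈ Icc 0 (L / 2) := ⟨by linarith, le_rfl⟩
  rw [← hc.finish, ← hc.image_Ioo hm,
    integrableOn_image_iff_integrableOn_abs_deriv_smul measurableSet_Ioo
      (fun s _ => (hc.unitSpeed.hasDerivAt_fst s).hasDerivWithinAt)
      (hc.strictMonoOn.injOn.mono Ioo_subset_Icc_self)]
  have h1 : IntegrableOn (fun s => (deriv c s).2) (Ioo 0 (L / 2)) :=
    (hc.continuous_deriv_snd.continuousOn.integrableOn_Icc).mono_set Ioo_subset_Icc_self
  exact h1.congr_fun (fun s hs => (hc.abs_smul_eq hs).symm) measurableSet_Ioo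

theorem snd_eq_integral (hc : IsProfile G α β L T c) {s : ℝ} (hs : s ∈ Icc 0 (L / 2)) :
    (c s).2 = ∫ x in α..(c s).1, G x / √(1 - G x ^ 2) := by
  have hsub : Ioo 0 s ⊆ Ioo 0 (L / 2) := Ioo_subset_Ioo_right hs.2
  rw [intervalIntegral.integral_of_le (hc.mem s).1, integral_Ioc_eq_integral_Ioo,
    ← hc.image_Ioo hs, integral_image_eq_integral_abs_deriv_smul measurableSet_Ioo
      (fun s _ => (hc.unitSpeed.hasDerivAt_fst s).hasDerivWithinAt)
      (hc.strictMonoOn.injOn.mono (hsub.trans Ioo_subset_Icc_self)),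
    setIntegral_congr_fun measurableSet_Ioo fun x hx => hc.abs_smul_eq (hsub hx),
    ← integral_Ioc_eq_integral_Ioo, ← intervalIntegral.integral_of_le hs.1,
    intervalIntegral.integral_eq_sub_of_hasDerivAt
      (fun x _ => hc.unitSpeed.hasDerivAt_snd x)
      (hc.continuous_deriv_snd.intervalIntegrable _ _), hc.start]
  simp

theorem exists_param (hc : IsProfile G α β L T c) {x : ℝ} (hx : x ∈ Icc α β) :
    ∃ s ∈ Icc 0 (L / 2), (c s).1 = x := by
  have hL := hc.L_pos
  have := intermediate_value_Icc (show (0 : ℝ) ≤ L / 2 by linarith) (f := fun s => (c s).1)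
      hc.unitSpeed.1.fst.continuous.continuousOn
  simp only [hc.start, hc.finish] at this
  exact this hx

/-- With `t' = sin θ = G(ρ)` and `ρ' = cos θ`, differentiation gives `κ = θ' = G'(ρ)`. The equation
for `c''` contained in `IsProfile` makes this valid at the turning points too, where `ρ' = 0`. -/
theorem curv_eq (hc : IsProfile G α β L T c) (s : ℝ) : curv c s = deriv G (c s).1 := by
  have h := hc.unitSpeed.2 s
  rw [curv, (hc.hasDerivAt_deriv s).deriv, hc.deriv_snd]
  rw [hc.deriv_snd] at h
  linear_combination deriv G (c s).1 * h

theorem T_eq (hc : IsProfile G α β L T c) : T = 2 * (c (L / 2)).2 := by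
  have h := hc.period (-(L / 2))
  rw [hc.symm, show -(L / 2) + L = L / 2 by ring] at h
  have := congrArg Prod.snd h
  simp at this
  linarith

/-- The principal curvatures are `G'(ρ)` and `G(ρ) coth ρ`, so the hypothesis on `G` is exactly the
constant mean curvature equation. It is imposed on the closed interval, and hence the conclusion
includes the turning points. -/
theorem hasMeanCurvatureAt (hc : IsProfile G α β L T c) {m : ℕ} {H : ℝ} (hα : 0 < α)
    (hG : ∀ x ∈ Icc α β, deriv G x + m * (Real.cosh x / Real.sinh x * G x) = (m + 1) * H)
    (p : ℝ × sphere (0 : EuclideanSpace ℝ (Fin (m + 1))) 1) :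
    HasMeanCurvatureAt (𝓘(ℝ, ℝ).prod (𝓡 m)) (rotImm m c) p (rotNormal m c p) H := by
  have hpos : ∀ s, 0 < (c s).1 := fun s => hα.trans_le (hc.mem s).1
  have e1 : deriv (fun s => (c s).1) = fun s => (deriv c s).1 := by
    ext s; exact (hc.unitSpeed.hasDerivAt_fst s).deriv
  have e2 : deriv (fun s => (c s).2) = fun s => (deriv c s).2 := by
    ext s; exact (hc.unitSpeed.hasDerivAt_snd s).deriv
  have e3 : deriv (fun s => (deriv c s).1) p.1 = -(G (c p.1).1 * deriv G (c p.1).1) :=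
    ((ContinuousLinearMap.fst ℝ ℝ ℝ).hasFDerivAt.comp_hasDerivAt p.1
      (hc.hasDerivAt_deriv p.1)).deriv
  have e4 : deriv (fun s => (deriv c s).2) p.1 = deriv G (c p.1).1 * (deriv c p.1).1 :=
    ((ContinuousLinearMap.snd ℝ ℝ ℝ).hasFDerivAt.comp_hasDerivAt p.1
      (hc.hasDerivAt_deriv p.1)).deriv
  have hu := hc.unitSpeed.2 p.1
  have h := hasMeanCurvatureAt_rotImm (m := m) (c := c) (p := p) (w := 1) (H := H)
    (contDiff_infty.1 hc.unitSpeed.1.fst 2).contDiffAt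
    (contDiff_infty.1 hc.unitSpeed.1.snd 2).contDiffAt (hpos _) one_pos
    (by rw [e1, e2]; simp [hu]) ?_
  · convert h using 1
    simp only [rotNormal, rotUnitNormal, e1, e2, div_one]
    have h1 : 1 - Real.tanh ((c p.1).1 / 2) ^ 2 = 1 / Real.cosh ((c p.1).1 / 2) ^ 2 := by
      have := Real.cosh_sq (((c p.1).1 / 2))
      have h0 := Real.cosh_pos ((c p.1).1 / 2)
      rw [Real.tanh_eq_sinh_div_cosh]
      field_simp
      linarith
    rw [h1]
    congr 2
    have h0 := Real.cosh_pos ((c p.1).1 / 2)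
    field_simp
  · rw [planeCurv, parallelCurv, e1, e2, coth_eq_tanh_half (hpos _), e3, e4, ← hG _ (hc.mem p.1)]
    simp only [hc.deriv_snd] at hu ⊢
    linear_combination deriv G (c p.1).1 * hu

end IsProfile

/-! ### The sine of the slope angle: its linear equation and its monotonicity -/

/-- The function `F_{H,d} / sinh^{n-1}`, which along a generating curve is the sine of the angle
between the curve and the horizontal direction. -/
def Gfun (m : ℕ) (H d t : ℝ) : ℝ := F m H d t / Real.sinh t ^ m

section Gfun

variable {m : ℕ} {H d t : ℝ}

/-- `M P = sinh^(2m) - F²`, so `Q` exists exactly where `Gfun` is the sine of a non-vertical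
direction. -/
theorem M_mul_P_eq (ht : 0 < t) :
    M m H d t * P m H d t = (Real.sinh t ^ m) ^ 2 * (1 - Gfun m H d t ^ 2) := by
  have hs : 0 < Real.sinh t ^ m := pow_pos (Real.sinh_pos_iff.2 ht) m
  rw [M, P, Gfun]
  field_simp
  ring

theorem Q_eq (ht : 0 < t) : Q m H d t = Gfun m H d t / √(1 - Gfun m H d t ^ 2) := by
  have hs : 0 < Real.sinh t ^ m := pow_pos (Real.sinh_pos_iff.2 ht) m
  rw [Q, M_mul_P_eq ht, Real.sqrt_mul (by positivity), Real.sqrt_sq hs.le, Gfun, div_div]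

theorem mem_dom_iff (ht : 0 < t) : t ∈ dom m H d ↔ Gfun m H d t ^ 2 < 1 := by
  have hs : 0 < Real.sinh t ^ m := pow_pos (Real.sinh_pos_iff.2 ht) m
  rw [dom, mem_ofPred_eq, M_mul_P_eq ht, mul_pos_iff_of_pos_left (by positivity), sub_pos]
  exact and_iff_right ht

/-- This linear equation is the constant mean curvature equation, with `d / sinh^m` as the
homogeneous part of its solution. -/
theorem hasDerivAt_Gfun (ht : 0 < t) :
    HasDerivAt (Gfun m H d) ((m + 1) * H - m * (Real.cosh t / Real.sinh t * Gfun m H d t)) t := by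
  have hs : 0 < Real.sinh t := Real.sinh_pos_iff.2 ht
  refine ((hasDerivAt_F m H d t).fun_div ((Real.hasDerivAt_sinh t).fun_pow m)
    (pow_pos hs m).ne').congr_deriv ?_
  rw [Gfun]
  rcases m with _ | m
  · simp
  · simp only [Nat.add_sub_cancel, pow_succ (Real.sinh t) m]
    field_simp
    try ring

theorem deriv_Gfun (ht : 0 < t) :
    deriv (Gfun m H d) t = (m + 1) * H - m * (Real.cosh t / Real.sinh t * Gfun m H d t) :=
  (hasDerivAt_Gfun ht).deriv

theorem contDiff_I {k : ℕ} : ContDiff ℝ ∞ (I k) := by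
  refine contDiff_infty_iff_deriv.2 ⟨fun s => (hasDerivAt_I k s).differentiableAt, ?_⟩
  have : deriv (I k) = fun s => Real.sinh s ^ k := by ext s; exact (hasDerivAt_I k s).deriv
  rw [this]
  exact Real.contDiff_sinh.pow k

theorem contDiffOn_Gfun : ContDiffOn ℝ ∞ (Gfun m H d) (Ioi 0) := by
  refine ContDiffOn.div ?_ (Real.contDiff_sinh.pow m).contDiffOn
    fun t ht => (pow_pos (Real.sinh_pos_iff.2 ht) m).ne'
  exact ((contDiff_const.mul contDiff_I).add contDiff_const).contDiffOn

theorem continuousOn_Q : ContinuousOn (Q m H d) (dom m H d) := by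
  intro t ht
  have hs : ContinuousAt (Gfun m H d) t := (hasDerivAt_Gfun ht.1).continuousAt
  have h1 := (mem_dom_iff ht.1).1 ht
  have h2 : ContinuousAt (fun t => Gfun m H d t / √(1 - Gfun m H d t ^ 2)) t :=
    hs.div (Real.continuous_sqrt.continuousAt.comp (continuousAt_const.sub (hs.pow 2)))
      (Real.sqrt_pos.2 (sub_pos.2 h1)).ne'
  refine (h2.congr ?_).continuousWithinAt
  filter_upwards [Ioi_mem_nhds ht.1] with x hx using (Q_eq hx).symm

theorem I_zero (k : ℕ) : I k 0 = 0 := by simp [I]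

theorem I_nonneg (k : ℕ) (ht : 0 ≤ t) : 0 ≤ I k t :=
  intervalIntegral.integral_nonneg ht fun _ hr => pow_nonneg (Real.sinh_nonneg_iff.2 hr.1) k

theorem strictMonoOn_I (k : ℕ) : StrictMonoOn (I k) (Ici 0) := by
  refine strictMonoOn_of_deriv_pos (convex_Ici 0) contDiff_I.continuous.continuousOn fun t ht => ?_
  rw [interior_Ici] at ht
  rw [(hasDerivAt_I k t).deriv]
  exact pow_pos (Real.sinh_pos_iff.2 ht) k

/-- The difference `sinh^(m+1) / cosh - m I_m` vanishes at `0` and has derivative `sinh^m / cosh² >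
0`. -/
theorem mul_cosh_mul_I_lt (ht : 0 < t) :
    m * (Real.cosh t * I m t) < Real.sinh t ^ (m + 1) := by
  have hd : ∀ t, HasDerivAt (fun t => Real.sinh t ^ (m + 1) / Real.cosh t - m * I m t)
      (Real.sinh t ^ m / Real.cosh t ^ 2) t := fun t => by
    have h0 := Real.cosh_pos t
    refine ((((Real.hasDerivAt_sinh t).fun_pow (m + 1)).fun_div (Real.hasDerivAt_cosh t)
      h0.ne').fun_sub ((hasDerivAt_I m t).const_mul (m : ℝ))).congr_deriv ?_
    have h1 := Real.cosh_sq t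
    simp only [Nat.add_sub_cancel]
    push_cast
    field_simp
    linear_combination (Real.sinh t) ^ m * h1
  have hm : StrictMonoOn (fun t => Real.sinh t ^ (m + 1) / Real.cosh t - m * I m t) (Ici 0) := by
    refine strictMonoOn_of_deriv_pos (convex_Ici 0)
      (fun t _ => (hd t).continuousAt.continuousWithinAt) fun t ht => ?_
    rw [interior_Ici] at ht
    rw [(hd t).deriv]
    have := Real.sinh_pos_iff.2 ht
    have := Real.cosh_pos t
    positivity
  have h := hm self_mem_Ici ht.le ht
  simp only [I_zero, Real.sinh_zero, zero_pow (Nat.succ_ne_zero m), zero_div, mul_zero,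
    sub_zero] at h
  have h0 := Real.cosh_pos t
  rw [sub_pos, lt_div_iff₀ h0] at h
  linarith

/-- After clearing denominators the case `d = 0` is `mul_cosh_mul_I_lt`, and a negative `d` only
helps. By `IsProfile.curv_eq` this is the positivity of the curvature of nodoids. -/
theorem deriv_Gfun_pos (hH : 0 < H) (hd : d ≤ 0) (ht : 0 < t) : 0 < deriv (Gfun m H d) t := by
  have hs : 0 < Real.sinh t := Real.sinh_pos_iff.2 ht
  have h0 := Real.cosh_pos t
  rw [deriv_Gfun ht, Gfun, F, sub_pos]
  have h1 := mul_cosh_mul_I_lt (m := m) ht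
  have h2 : m * (Real.cosh t / Real.sinh t * (((m + 1) * H * I m t + d) / Real.sinh t ^ m)) =
      ((m + 1) * H * (m * (Real.cosh t * I m t)) + m * Real.cosh t * d) /
        Real.sinh t ^ (m + 1) := by
    field_simp
    ring
  rw [h2, div_lt_iff₀ (by positivity)]
  have h3 : m * Real.cosh t * d ≤ 0 := mul_nonpos_of_nonneg_of_nonpos (by positivity) hd
  have h4 : (m + 1) * H * (m * (Real.cosh t * I m t)) < (m + 1) * H * Real.sinh t ^ (m + 1) :=
    mul_lt_mul_of_pos_left h1 (by positivity)
  linarith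

end Gfun

/-! ### The signs of `M` and `P`, and the domain of `Q` in the three cases -/

section roots

variable {m : ℕ} {H d t : ℝ}

theorem tanh_strictMono : StrictMono Real.tanh := strictMono_of_deriv_pos fun x => by
  rw [(hasDerivAt_tanh x).deriv]; exact one_sub_tanh_sq_pos x

theorem H_pos (hH : (m : ℝ) / (m + 1) < H) : 0 < H := lt_of_le_of_lt (by positivity) hH

/-- The bound on `H` places `(n - 1) / (n H)` in the range of `tanh`, so that `C_H` exists and is
positive. -/
theorem critical_mem (hm : 1 ≤ m) (hH : (m : ℝ) / (m + 1) < H) :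
    (m : ℝ) / ((m + 1) * H) ∈ Ioo 0 1 := by
  have h0 := H_pos hH
  have hm' : (0 : ℝ) < m := by exact_mod_cast hm
  rw [div_lt_iff₀ (by positivity)] at hH
  refine ⟨by positivity, ?_⟩
  rw [div_lt_one (by positivity)]
  linarith

theorem CH_pos (hm : 1 ≤ m) (hH : (m : ℝ) / (m + 1) < H) : 0 < CH m H :=
  Real.artanh_pos (critical_mem hm hH)

theorem tanh_CH (hm : 1 ≤ m) (hH : (m : ℝ) / (m + 1) < H) :
    Real.tanh (CH m H) = m / ((m + 1) * H) :=
  Real.tanh_artanh ⟨by linarith [(critical_mem hm hH).1], (critical_mem hm hH).2⟩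

theorem mul_coth_lt_iff (hm : 1 ≤ m) (hH : (m : ℝ) / (m + 1) < H) (ht : 0 < t) :
    m * (Real.cosh t / Real.sinh t) < (m + 1) * H ↔ CH m H < t := by
  have hs : 0 < Real.sinh t := Real.sinh_pos_iff.2 ht
  have h0 := Real.cosh_pos t
  have hH0 := H_pos hH
  rw [← tanh_strictMono.lt_iff_lt (a := CH m H), tanh_CH hm hH, Real.tanh_eq_sinh_div_cosh,
    div_lt_div_iff₀ (by positivity) h0, ← mul_div_assoc, div_lt_iff₀ hs]
  constructor <;> intro h <;> linarith

theorem lt_mul_coth_iff (hm : 1 ≤ m) (hH : (m : ℝ) / (m + 1) < H) (ht : 0 < t) :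
    (m + 1) * H < m * (Real.cosh t / Real.sinh t) ↔ t < CH m H := by
  have hs : 0 < Real.sinh t := Real.sinh_pos_iff.2 ht
  have h0 := Real.cosh_pos t
  have hH0 := H_pos hH
  rw [← tanh_strictMono.lt_iff_lt (a := t), tanh_CH hm hH, Real.tanh_eq_sinh_div_cosh,
    div_lt_div_iff₀ h0 (by positivity), ← mul_div_assoc, lt_div_iff₀ hs]
  constructor <;> intro h <;> linarith

theorem hasDerivAt_M (ht : 0 < t) :
    HasDerivAt (M m H d) (Real.sinh t ^ m * (m * (Real.cosh t / Real.sinh t) - (m + 1) * H)) t := by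
  have hs : 0 < Real.sinh t := Real.sinh_pos_iff.2 ht
  refine (((Real.hasDerivAt_sinh t).fun_pow m).fun_sub (hasDerivAt_F m H d t)).congr_deriv ?_
  rcases m with _ | m
  · simp
  · simp only [Nat.add_sub_cancel, pow_succ (Real.sinh t) m]
    field_simp

theorem continuous_M : Continuous (M m H d) := by
  have hI : Continuous (I m) := contDiff_I.continuous
  unfold M F
  have := Real.continuous_sinh
  fun_prop

/-- `M' = sinh^m (m coth t - (m + 1) H)` changes sign once, at `C_H`. So `M` rises from `-d` at `0`
to its maximum `D_H - d` at `C_H` and falls afterwards; the case distinction in `d` rests on this.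
-/
theorem strictMonoOn_M (hm : 1 ≤ m) (hH : (m : ℝ) / (m + 1) < H) :
    StrictMonoOn (M m H d) (Icc 0 (CH m H)) := by
  refine strictMonoOn_of_deriv_pos (convex_Icc _ _) continuous_M.continuousOn fun t ht => ?_
  rw [interior_Icc] at ht
  rw [(hasDerivAt_M ht.1).deriv]
  exact mul_pos (pow_pos (Real.sinh_pos_iff.2 ht.1) m)
    (sub_pos.2 ((lt_mul_coth_iff hm hH ht.1).2 ht.2))

theorem strictAntiOn_M (hm : 1 ≤ m) (hH : (m : ℝ) / (m + 1) < H) :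
    StrictAntiOn (M m H d) (Ici (CH m H)) := by
  refine strictAntiOn_of_deriv_neg (convex_Ici _) continuous_M.continuousOn fun t ht => ?_
  rw [interior_Ici] at ht
  have h0 : 0 < t := (CH_pos hm hH).trans ht
  rw [(hasDerivAt_M h0).deriv]
  exact mul_neg_of_pos_of_neg (pow_pos (Real.sinh_pos_iff.2 h0) m)
    (sub_neg.2 ((mul_coth_lt_iff hm hH h0).2 ht))

/-- Past any point beyond `C_H` the slope of `M` stays below a negative constant, since `sinh`
increases and `coth` decreases; hence `M` falls at least linearly. -/
theorem exists_M_neg (hm : 1 ≤ m) (hH : (m : ℝ) / (m + 1) < H) :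
    ∃ t, CH m H < t ∧ M m H d t < 0 := by
  have hC := CH_pos hm hH
  set t₁ := CH m H + 1
  have ht₁ : CH m H < t₁ := by simp [t₁]
  have h1 : 0 < t₁ := hC.trans ht₁
  set δ := Real.sinh t₁ ^ m * ((m + 1) * H - m * (Real.cosh t₁ / Real.sinh t₁))
  have hδ : 0 < δ := mul_pos (pow_pos (Real.sinh_pos_iff.2 h1) m)
    (sub_pos.2 ((mul_coth_lt_iff hm hH h1).2 ht₁))
  have hder : ∀ t ∈ interior (Ici t₁), deriv (M m H d) t ≤ -δ := by
    intro t ht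
    rw [interior_Ici] at ht
    have h0 : 0 < t := h1.trans ht
    have hs1 : 0 < Real.sinh t₁ := Real.sinh_pos_iff.2 h1
    have hs : 0 < Real.sinh t := Real.sinh_pos_iff.2 h0
    have hc1 := Real.cosh_pos t₁
    have hc := Real.cosh_pos t
    have hp : Real.sinh t₁ ^ m ≤ Real.sinh t ^ m :=
      pow_le_pow_left₀ hs1.le (Real.sinh_lt_sinh.2 ht).le m
    have hcoth : Real.cosh t / Real.sinh t ≤ Real.cosh t₁ / Real.sinh t₁ := by
      have := tanh_strictMono ht
      rw [Real.tanh_eq_sinh_div_cosh, Real.tanh_eq_sinh_div_cosh, div_lt_div_iff₀ hc1 hc] at this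
      rw [div_le_div_iff₀ hs hs1]
      linarith
    have hq : 0 < (m + 1) * H - m * (Real.cosh t₁ / Real.sinh t₁) :=
      sub_pos.2 ((mul_coth_lt_iff hm hH h1).2 ht₁)
    have hq' : (m + 1) * H - m * (Real.cosh t₁ / Real.sinh t₁) ≤
        (m + 1) * H - m * (Real.cosh t / Real.sinh t) := by gcongr
    rw [(hasDerivAt_M h0).deriv]
    have := mul_le_mul hp hq' hq.le (by positivity)
    simp only [δ]
    linarith
  -- Chosen so that a decrease at rate `δ` brings `M` to at most `M(t₁) - |M(t₁)| - 1 < 0`.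
  set t := t₁ + (|M m H d t₁| + 1) / δ with ht
  have hle : t₁ ≤ t := by rw [ht]; linarith [show 0 < (|M m H d t₁| + 1) / δ by positivity]
  refine ⟨t, ht₁.trans_le hle, ?_⟩
  have h := (convex_Ici t₁).image_sub_le_mul_sub_of_deriv_le continuous_M.continuousOn
    (fun x hx => by
      rw [interior_Ici] at hx
      exact (hasDerivAt_M (h1.trans hx)).differentiableAt.differentiableWithinAt) hder
    t₁ self_mem_Ici t hle hle
  have h2 : -δ * (t - t₁) = -(|M m H d t₁| + 1) := by
    rw [ht]; field_simp; ring
  rw [h2] at h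
  linarith [le_abs_self (M m H d t₁)]

theorem M_zero (hm : 1 ≤ m) : M m H d 0 = -d := by
  simp [M, F, I_zero, Nat.one_le_iff_ne_zero.1 hm]

theorem M_CH : M m H d (CH m H) = DH m H - d := by
  simp [DH, M, F]; ring

theorem DH_pos (hm : 1 ≤ m) (hH : (m : ℝ) / (m + 1) < H) : 0 < DH m H := by
  have := strictMonoOn_M (d := 0) hm hH (left_mem_Icc.2 (CH_pos hm hH).le)
    (right_mem_Icc.2 (CH_pos hm hH).le) (CH_pos hm hH)
  rw [M_zero hm] at this
  simpa [DH] using this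

theorem exists_right_zero (hm : 1 ≤ m) (hH : (m : ℝ) / (m + 1) < H) (hd : d < DH m H) :
    ∃ b, CH m H < b ∧ M m H d b = 0 ∧ (∀ t, CH m H ≤ t → t < b → 0 < M m H d t) ∧
      ∀ t, b < t → M m H d t < 0 := by
  obtain ⟨t₁, ht₁, hM⟩ := exists_M_neg (d := d) hm hH
  have h1 : 0 < M m H d (CH m H) := by rw [M_CH]; linarith
  obtain ⟨b, hb, hb0⟩ := intermediate_value_Ioo' ht₁.le continuous_M.continuousOn ⟨hM, h1⟩
  refine ⟨b, hb.1, hb0, fun t ht htb => ?_, fun t ht => ?_⟩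
  · rw [← hb0]; exact strictAntiOn_M hm hH ht hb.1.le htb
  · rw [← hb0]; exact strictAntiOn_M hm hH hb.1.le (hb.1.trans ht).le ht

theorem dom_eq_empty (hm : 1 ≤ m) (hH : (m : ℝ) / (m + 1) < H) (hd : DH m H ≤ d) :
    dom m H d = ∅ := by
  have hC := CH_pos hm hH
  refine eq_empty_of_forall_notMem fun t ht => ?_
  have hd0 : 0 < d := (DH_pos hm hH).trans_le hd
  have hP : 0 < P m H d t := by
    have h1 := I_nonneg m ht.1.le
    have h2 := pow_pos (Real.sinh_pos_iff.2 ht.1) m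
    have h3 := H_pos hH
    unfold P F
    positivity
  have hM : M m H d t ≤ M m H d (CH m H) := by
    rcases le_total t (CH m H) with h | h
    · exact (strictMonoOn_M hm hH).monotoneOn ⟨ht.1.le, h⟩ (right_mem_Icc.2 hC.le) h
    · exact (strictAntiOn_M hm hH).antitoneOn self_mem_Ici h h
  rw [M_CH] at hM
  have := (pos_iff_pos_of_mul_pos ht.2).2 hP
  linarith

theorem P_pos (hH : 0 < H) (hd : 0 ≤ d) (ht : 0 < t) : 0 < P m H d t := by
  have h1 := I_nonneg m ht.le
  have h2 := pow_pos (Real.sinh_pos_iff.2 ht) m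
  unfold P F
  positivity

/-- Here `P > 0`, so the domain is `{M > 0}`. As `M` is negative at `0`, positive at `C_H` and
unimodal, this is an interval around `C_H`. The strict position of `a` and `b` relative to `C_H`
later gives simplicity of the turning points. -/
theorem dom_eq_unduloid (hm : 1 ≤ m) (hH : (m : ℝ) / (m + 1) < H) (hd : 0 < d)
    (hd' : d < DH m H) : ∃ a b, 0 < a ∧ a < CH m H ∧ CH m H < b ∧ M m H d a = 0 ∧ M m H d b = 0 ∧
      dom m H d = Ioo a b := by
  have hC := CH_pos hm hH
  obtain ⟨b, hb, hb0, hbpos, hbneg⟩ := exists_right_zero hm hH hd'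
  have h1 : 0 < M m H d (CH m H) := by rw [M_CH]; linarith
  obtain ⟨a, ha, ha0⟩ := intermediate_value_Ioo hC.le (continuous_M (d := d)).continuousOn
    ⟨show M m H d 0 < 0 by rw [M_zero hm]; linarith, h1⟩
  refine ⟨a, b, ha.1, ha.2, hb, ha0, hb0, ?_⟩
  ext t
  constructor
  · intro ht
    have hM : 0 < M m H d t := (pos_iff_pos_of_mul_pos ht.2).2 (P_pos (H_pos hH) hd.le ht.1)
    refine ⟨?_, ?_⟩
    · by_contra! h
      have := (strictMonoOn_M (d := d) hm hH).monotoneOn ⟨ht.1.le, h.trans ha.2.le⟩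
        ⟨ha.1.le, ha.2.le⟩ h
      linarith
    · by_contra! h
      rcases h.eq_or_lt with rfl | h
      · linarith
      · linarith [hbneg t h]
  · intro ht
    have h0 : 0 < t := ha.1.trans ht.1
    refine ⟨h0, mul_pos ?_ (P_pos (H_pos hH) hd.le h0)⟩
    rcases le_total t (CH m H) with h | h
    · rw [← ha0]
      exact strictMonoOn_M hm hH ⟨ha.1.le, ha.2.le⟩ ⟨h0.le, h⟩ ht.1
    · exact hbpos t h ht.2

theorem dom_eq_sphere (hm : 1 ≤ m) (hH : (m : ℝ) / (m + 1) < H) :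
    ∃ a, CH m H < a ∧ M m H 0 a = 0 ∧ dom m H 0 = Ioo 0 a := by
  have hC := CH_pos hm hH
  obtain ⟨b, hb, hb0, hbpos, hbneg⟩ := exists_right_zero hm hH (DH_pos hm hH)
  refine ⟨b, hb, hb0, ?_⟩
  ext t
  constructor
  · intro ht
    have hM : 0 < M m H 0 t := (pos_iff_pos_of_mul_pos ht.2).2 (P_pos (H_pos hH) le_rfl ht.1)
    refine ⟨ht.1, ?_⟩
    by_contra! h
    rcases h.eq_or_lt with rfl | h
    · linarith
    · linarith [hbneg t h]
  · intro ht
    refine ⟨ht.1, mul_pos ?_ (P_pos (H_pos hH) le_rfl ht.1)⟩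
    rcases le_total t (CH m H) with h | h
    · have := strictMonoOn_M (d := 0) hm hH (left_mem_Icc.2 hC.le) ⟨ht.1.le, h⟩ ht.1
      rwa [M_zero hm, neg_zero] at this
    · exact hbpos t h ht.2

theorem strictMonoOn_P (hm : 1 ≤ m) (hH : 0 < H) : StrictMonoOn (P m H d) (Ici 0) := by
  intro x hx y hy hxy
  have h1 := strictMonoOn_I m hx hy hxy
  have h2 : Real.sinh x ^ m < Real.sinh y ^ m :=
    pow_lt_pow_left₀ (Real.sinh_lt_sinh.2 hxy) (Real.sinh_nonneg_iff.2 hx) (by omega)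
  have h3 : (m + 1) * H * I m x < (m + 1) * H * I m y := mul_lt_mul_of_pos_left h1 (by positivity)
  unfold P F
  linarith

/-- Now `M(0) = -d > 0`, so `M` is positive up to its single zero `b`, while `P` increases strictly
from `d < 0`. Thus the left endpoint is the zero of `P`, where `G = -1`, and the right one is the
zero of `M`, where `G = 1`. Beyond `b` the two factors have opposite signs. -/
theorem dom_eq_nodoid (hm : 1 ≤ m) (hH : (m : ℝ) / (m + 1) < H) (hd : d < 0) :
    ∃ a b, 0 < a ∧ a < b ∧ CH m H < b ∧ P m H d a = 0 ∧ M m H d b = 0 ∧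
      dom m H d = Ioo a b := by
  have hC := CH_pos hm hH
  have hH0 := H_pos hH
  obtain ⟨b, hb, hb0, hbpos, hbneg⟩ := exists_right_zero hm hH (hd.trans (DH_pos hm hH))
  have hb1 : 0 < b := hC.trans hb
  have hPc : Continuous (P m H d) := by
    have hI : Continuous (I m) := contDiff_I.continuous
    unfold P F
    have := Real.continuous_sinh
    fun_prop
  have hMpos : ∀ t, 0 < t → t < b → 0 < M m H d t := fun t ht htb => by
    rcases le_total t (CH m H) with h | h
    · have := strictMonoOn_M (d := d) hm hH (left_mem_Icc.2 hC.le) ⟨ht.le, h⟩ ht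
      rw [M_zero hm] at this
      linarith
    · exact hbpos t h htb
  have hPb : 0 < P m H d b := by
    have := pow_pos (Real.sinh_pos_iff.2 hb1) m
    unfold M at hb0
    unfold P
    linarith
  have hP0 : P m H d 0 < 0 := by
    simpa [P, F, I_zero, Nat.one_le_iff_ne_zero.1 hm] using hd
  obtain ⟨a, ha, ha0⟩ := intermediate_value_Ioo hb1.le hPc.continuousOn ⟨hP0, hPb⟩
  have hPneg : ∀ t, 0 ≤ t → t < a → P m H d t < 0 := fun t h0 h => by
    rw [← ha0]; exact strictMonoOn_P hm hH0 h0 ha.1.le h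
  have hPpos : ∀ t, a < t → 0 < P m H d t := fun t h => by
    rw [← ha0]; exact strictMonoOn_P hm hH0 ha.1.le (ha.1.trans h).le h
  refine ⟨a, b, ha.1, ha.2, hb, ha0, hb0, ?_⟩
  ext t
  constructor
  · intro ht
    have hbt : t < b := by
      by_contra! h
      have h1 := hPpos t (ha.2.trans_le h)
      have h2 := (pos_iff_pos_of_mul_pos ht.2).2 h1
      rcases h.eq_or_lt with rfl | h
      · linarith
      · linarith [hbneg t h]
    refine ⟨?_, hbt⟩
    by_contra! h
    have h2 := (pos_iff_pos_of_mul_pos ht.2).1 (hMpos t ht.1 hbt)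
    rcases h.eq_or_lt with rfl | h
    · linarith
    · linarith [hPneg t ht.1.le h]
  · intro ht
    exact ⟨ha.1.trans ht.1, mul_pos (hMpos t (ha.1.trans ht.1) ht.2) (hPpos t ht.1)⟩

theorem Gfun_eq_one (ht : 0 < t) (h : M m H d t = 0) : Gfun m H d t = 1 := by
  have hs : 0 < Real.sinh t ^ m := pow_pos (Real.sinh_pos_iff.2 ht) m
  rw [Gfun, div_eq_one_iff_eq hs.ne']
  unfold M at h
  linarith

theorem Gfun_eq_neg_one (ht : 0 < t) (h : P m H d t = 0) : Gfun m H d t = -1 := by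
  have hs : 0 < Real.sinh t ^ m := pow_pos (Real.sinh_pos_iff.2 ht) m
  rw [Gfun, div_eq_iff hs.ne']
  unfold P at h
  linarith

end roots

/-! ### Every graph with constant `d` is a translate of the height function -/

section heights

variable {m : ℕ} {H d a b : ℝ} {J : Set ℝ} {l : ℝ → ℝ}

/-- The map `p ↦ p / √(1 + p²)` has inverse `g ↦ g / √(1 - g²)`, because `1 - g² = 1 / (1 + p²)`. So
the first integral can be solved for `λ'`, which gives `Q`. -/
theorem HasConst.mem_dom (h : HasConst m H d J l) (hJ : J ⊆ Ioi 0) {ρ : ℝ} (hρ : ρ ∈ J) :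
    ρ ∈ dom m H d ∧ deriv l ρ = Q m H d ρ := by
  have h0 : 0 < ρ := hJ hρ
  have hs : 0 < Real.sinh ρ ^ m := pow_pos (Real.sinh_pos_iff.2 h0) m
  have hG : Gfun m H d ρ = deriv l ρ / √(1 + deriv l ρ ^ 2) := by
    rw [Gfun, ← h ρ hρ, mul_div_cancel_right₀ _ hs.ne']
  have hp : 0 < 1 + deriv l ρ ^ 2 := by positivity
  have h1 : 1 - Gfun m H d ρ ^ 2 = 1 / (1 + deriv l ρ ^ 2) := by
    rw [hG, div_pow, Real.sq_sqrt hp.le]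
    field_simp
    ring
  refine ⟨(mem_dom_iff h0).2 (sub_pos.1 (h1 ▸ by positivity)), ?_⟩
  rw [Q_eq h0, h1, hG, Real.sqrt_div zero_le_one, Real.sqrt_one]
  have := Real.sqrt_pos.2 hp
  field_simp

theorem hasDerivAt_height (hdom : dom m H d = Ioo a b)
    (hint : IntervalIntegrable (Q m H d) volume a b) {ρ : ℝ} (hρ : ρ ∈ Ioo a b) :
    HasDerivAt (height m H d a) (Q m H d ρ) ρ := by
  have hc := (continuousOn_Q (m := m) (H := H) (d := d))
  rw [hdom] at hc
  refine intervalIntegral.integral_hasDerivAt_right (hint.mono_set ?_)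
    (hc.stronglyMeasurableAtFilter isOpen_Ioo ρ hρ) (hc.continuousAt (isOpen_Ioo.mem_nhds hρ))
  rw [uIcc_of_le hρ.1.le, uIcc_of_le (hρ.1.trans hρ.2).le]
  exact Icc_subset_Icc_right hρ.2.le

theorem exists_translation (hdom : dom m H d = Ioo a b)
    (hint : IntervalIntegrable (Q m H d) volume a b) (hl : IsHeightFun J l)
    (h : HasConst m H d J l) :
    ∃ τ : ℝ, ∀ ρ ∈ J, ρ ∈ Ioo a b ∧ l ρ + τ = height m H d a ρ := by
  obtain ⟨hJ, ⟨ρ₀, hρ₀⟩, hord, hpos, hC⟩ := hl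
  have hmem : ∀ ρ ∈ J, ρ ∈ Ioo a b := fun ρ hρ => hdom ▸ (h.mem_dom hpos hρ).1
  have hd : ∀ ρ ∈ J, HasDerivAt (fun ρ => height m H d a ρ - l ρ) 0 ρ := fun ρ hρ => by
    have h1 := ((hC.contDiffAt (hJ.mem_nhds hρ)).differentiableAt (by norm_num)).hasDerivAt
    rw [(h.mem_dom hpos hρ).2] at h1
    simpa using (hasDerivAt_height hdom hint (hmem ρ hρ)).fun_sub h1
  refine ⟨height m H d a ρ₀ - l ρ₀, fun ρ hρ => ⟨hmem ρ hρ, ?_⟩⟩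
  have := hJ.is_const_of_deriv_eq_zero hord.isPreconnected
    (fun x hx => (hd x hx).differentiableAt.differentiableWithinAt)
    (fun x hx => (hd x hx).deriv) hρ hρ₀
  linarith

end heights

/-! ### Unduloids and nodoids -/

section delaunay

variable {m : ℕ} {H d a b L T : ℝ} {c : ℝ → ℝ × ℝ}

theorem IsProfile.intervalIntegrable_Q (hc : IsProfile (Gfun m H d) a b L T c) (ha : 0 < a)
    (hab : a ≤ b) : IntervalIntegrable (Q m H d) volume a b := by
  rw [intervalIntegrable_iff_integrableOn_Ioo_of_le hab]
  exact hc.integrableOn.congr_fun (fun x hx => (Q_eq (ha.trans hx.1)).symm) measurableSet_Ioo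

theorem IsProfile.snd_eq_height (hc : IsProfile (Gfun m H d) a b L T c) (ha : 0 < a) {s : ℝ}
    (hs : s ∈ Icc 0 (L / 2)) : (c s).2 = height m H d a (c s).1 := by
  rw [hc.snd_eq_integral hs, height]
  refine intervalIntegral.integral_congr fun x hx => ?_
  rw [uIcc_of_le (hc.mem s).1] at hx
  exact (Q_eq (ha.trans_le hx.1)).symm

theorem IsProfile.isDelaunay (hc : IsProfile (Gfun m H d) a b L T c) (ha : 0 < a) (hab : a < b)
    (hdom : dom m H d = Ioo a b) (hT : 0 < T) : IsDelaunay m H d a b L T c := by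
  have hint := hc.intervalIntegrable_Q ha hab.le
  have hpos : ∀ s, 0 < (c s).1 := fun s => ha.trans_le (hc.mem s).1
  refine
    { a_pos := ha
      a_lt_b := hab
      dom_eq := hdom
      integrable := hint
      extension :=
        { unitSpeed := hc.unitSpeed
          L_pos := hc.L_pos
          T_pos := hT
          start := by rw [hc.start]
          finish := hc.finish
          mono := hc.strictMonoOn
          graph := fun s hs => hc.snd_eq_height ha hs
          symm := hc.symm
          period := hc.period }
      immersion := isSmoothImm_rotImm hc.unitSpeed hpos
      cmc := hc.hasMeanCurvatureAt ha fun x hx => by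
        rw [deriv_Gfun (ha.trans_le hx.1)]; ring
      complete := isCompleteImm_rotImm hc.unitSpeed
      periodic := ?_
      -- The distance `b` is attained and `hypBall` is open, so the outer radius has to exceed `b`;
      -- the inner radius can be `a` itself.
      bounded := ⟨a, b + 1, ha, by linarith, ?_⟩
      all := fun J l hl _ h => ?_ }
  · have hshift : ∀ s ξ, rotImm m c (s, ξ) + (0, T) = rotImm m c (s + L, ξ) := fun s ξ => by
      simp [rotImm, hc.period]
    ext q
    constructor
    · rintro ⟨_, ⟨p, rfl⟩, rfl⟩
      exact ⟨(p.1 + L, p.2), (hshift p.1 p.2).symm⟩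
    · rintro ⟨p, rfl⟩
      refine ⟨_, ⟨(p.1 - L, p.2), rfl⟩, ?_⟩
      simp only [hshift, sub_add_cancel]
  · rintro _ ⟨p, rfl⟩
    have h1 := tanh_half_pos (hpos p.1)
    refine ⟨⟨?_, ?_⟩, mem_univ _⟩
    · rw [hypBall, mem_ofPred_eq, norm_rotImm_fst, abs_of_pos h1]
      exact tanh_strictMono (by linarith [(hc.mem p.1).2])
    · rw [hypBall, mem_ofPred_eq, norm_rotImm_fst, abs_of_pos h1, not_lt]
      exact tanh_strictMono.monotone (by linarith [(hc.mem p.1).1])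
  · obtain ⟨τ, hτ⟩ := exists_translation hdom hint hl h
    refine ⟨τ, fun ρ hρ => ?_⟩
    obtain ⟨h1, h2⟩ := hτ ρ hρ
    obtain ⟨s, hs, rfl⟩ := hc.exists_param (Ioo_subset_Icc_self h1)
    exact ⟨s, Prod.ext rfl (by rw [h2, hc.snd_eq_height ha hs])⟩

/-- At both turning points `G = 1` and `G' = (m + 1) H - m coth`, whose sign is fixed by `a < C_H <
b`; so `exists_profile` applies. Since `F > 0`, the height is strictly increasing along the curve.
It is also unbounded both ways, hence a homeomorphism of `ℝ`, and `isEmbedding_rotImm` applies. -/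
theorem exists_unduloid (hm : 1 ≤ m) (hH : (m : ℝ) / (m + 1) < H) (hd : 0 < d)
    (hd' : d < DH m H) :
    ∃ (a b L T : ℝ) (c : ℝ → ℝ × ℝ), IsDelaunay m H d a b L T c ∧
      IsSmoothEmb (𝓘(ℝ, ℝ).prod (𝓡 m)) (rotImm m c) ∧ (∀ s, 0 < (deriv c s).2) := by
  obtain ⟨a, b, ha, haC, hCb, ha0, hb0, hdom⟩ := dom_eq_unduloid hm hH hd hd'
  have hb : 0 < b := ha.trans (haC.trans hCb)
  have hGa := Gfun_eq_one ha ha0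
  have hGb := Gfun_eq_one hb hb0
  obtain ⟨L, T, c, hc⟩ := exists_profile isOpen_Ioi (haC.trans hCb)
    (fun x hx => ha.trans_le hx.1 : Icc a b ⊆ Ioi 0) (contDiffOn_Gfun (m := m) (H := H) (d := d))
    (by rw [hGa]; norm_num) (by rw [hGb]; norm_num)
    (fun x hx => (mem_dom_iff (ha.trans hx.1)).1 (hdom ▸ hx))
    (by
      rw [deriv_Gfun ha, hGa]
      linarith [(lt_mul_coth_iff hm hH ha).2 haC])
    (by
      rw [deriv_Gfun hb, hGb]
      linarith [(mul_coth_lt_iff hm hH hb).2 hCb])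
  have hpos : ∀ s, 0 < (c s).1 := fun s => ha.trans_le (hc.mem s).1
  have ht' : ∀ s, 0 < (deriv c s).2 := fun s => by
    rw [hc.deriv_snd, Gfun, F]
    have h1 := I_nonneg m (hpos s).le
    have h2 := Real.sinh_pos_iff.2 (hpos s)
    have h3 := H_pos hH
    positivity
  have htmono : StrictMono fun s => (c s).2 := strictMono_of_deriv_pos fun s => by
    rw [(hc.unitSpeed.hasDerivAt_snd s).deriv]; exact ht' s
  have hT : 0 < T := by
    have := htmono hc.L_pos
    have h2 := hc.period 0
    rw [zero_add] at h2
    simp only [h2, hc.start] at this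
    simpa using this
  -- The heights at multiples of the period are unbounded in both directions, which makes the height
  -- onto by the intermediate value theorem.
  have htn : ∀ k : ℤ, (c (k * L)).2 = k * T := by
    intro k
    have hp : ∀ k : ℤ, (c (k * L + L)).2 = (c (k * L)).2 + T := fun k => by rw [hc.period]; rfl
    induction k using Int.induction_on with
    | zero => simp [hc.start]
    | succ i ih =>
      push_cast at ih ⊢
      rw [add_mul, one_mul]
      have := hp i
      push_cast at this
      rw [this, ih]; ring
    | pred i ih =>
      have := hp (-i - 1)
      push_cast at ih this ⊢
      rw [show (-(i : ℝ) - 1) * L + L = -i * L by ring, ih] at this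
      linarith
  have hsurj : Function.Surjective fun s => (c s).2 := by
    intro y
    obtain ⟨k, hk⟩ := exists_nat_ge (|y| / T)
    rw [div_le_iff₀ hT] at hk
    have h1 := htn k
    have h2 := htn (-k)
    push_cast at h1 h2
    have hL := hc.L_pos
    have := intermediate_value_Icc (show -(k : ℝ) * L ≤ k * L by
        have : 0 ≤ (k : ℝ) * L := by positivity
        linarith)
      (hc.unitSpeed.1.snd.continuous.continuousOn (s := Icc (-(k : ℝ) * L) (k * L)))
    rw [h1, h2] at this
    obtain ⟨s, -, hs⟩ := this (show y ∈ Icc (-(k : ℝ) * T) (k * T) from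
      ⟨by linarith [neg_abs_le y], by linarith [le_abs_self y]⟩)
    exact ⟨s, hs⟩
  exact ⟨a, b, L, T, c, hc.isDelaunay ha (haC.trans hCb) hdom hT,
    ⟨isSmoothImm_rotImm hc.unitSpeed hpos, isEmbedding_rotImm hc.unitSpeed hpos
      (htmono.orderIsoOfSurjective _ hsurj).toHomeomorph fun s => rfl⟩, ht'⟩

/-- The profile joins `G = -1` to `G = 1` with `G' > 0` throughout. The sign of `T` is the delicate
point and comes from a monotone combination of height and radial speed. Once `T > 0` is known, the
height, which initially decreases from `0`, vanishes again at some `s` in the first half period; the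
reflection then gives `c (-s) = c s`. -/
theorem exists_nodoid (hm : 1 ≤ m) (hH : (m : ℝ) / (m + 1) < H) (hd : d < 0) :
    ∃ (a b L T : ℝ) (c : ℝ → ℝ × ℝ), IsDelaunay m H d a b L T c ∧
      (∀ s, 0 < curv c s) ∧
      (deriv c 0).2 < 0 ∧ 0 < (deriv c (L / 2)).2 ∧
      (∃ s₁ s₂ : ℝ, s₁ ≠ s₂ ∧ c s₁ = c s₂ ∧
        LinearIndependent ℝ ![deriv c s₁, deriv c s₂]) ∧
      ¬ Function.Injective (rotImm m c) := by
  obtain ⟨a, b, ha, hab, hCb, ha0, hb0, hdom⟩ := dom_eq_nodoid hm hH hd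
  have hH0 := H_pos hH
  have hm0 : (0 : ℝ) < m := by exact_mod_cast hm
  have hb : 0 < b := ha.trans hab
  have hGa := Gfun_eq_neg_one ha ha0
  have hGb := Gfun_eq_one hb hb0
  obtain ⟨L, T, c, hc⟩ := exists_profile isOpen_Ioi hab
    (fun x hx => ha.trans_le hx.1 : Icc a b ⊆ Ioi 0) (contDiffOn_Gfun (m := m) (H := H) (d := d))
    (by rw [hGa]; norm_num) (by rw [hGb]; norm_num)
    (fun x hx => (mem_dom_iff (ha.trans hx.1)).1 (hdom ▸ hx))
    (by rw [hGa]; linarith [deriv_Gfun_pos (m := m) hH0 hd.le ha])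
    (by rw [hGb]; linarith [deriv_Gfun_pos (m := m) hH0 hd.le hb])
  have hL := hc.L_pos
  have hpos : ∀ s, 0 < (c s).1 := fun s => ha.trans_le (hc.mem s).1
  have hderiv0 : (deriv c 0).2 = -1 := by rw [hc.deriv_snd, hc.start, hGa]
  have hderivL : (deriv c (L / 2)).2 = 1 := by rw [hc.deriv_snd, hc.finish, hGb]
  have hfst0 : (deriv c 0).1 = 0 := by
    have := hc.unitSpeed.2 0
    rw [hderiv0] at this
    nlinarith
  have hfstL : (deriv c (L / 2)).1 = 0 := by
    have := hc.unitSpeed.2 (L / 2)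
    rw [hderivL] at this
    nlinarith
  set N := ((m : ℝ) + 1) * H
  have hN : 0 < N := by positivity
  -- With `N = (m + 1) H`, `t' + ρ'' / N = G - G G' / N`, and inserting `G' = N - m coth ρ G` leaves
  -- `m coth ρ G² / N ≥ 0`. At `0` and `L / 2` the correction `ρ' / N` vanishes, so monotonicity
  -- compares the heights there.
  have hY : ∀ s, HasDerivAt (fun s => (c s).2 + (deriv c s).1 / N)
      (m * (Real.cosh (c s).1 / Real.sinh (c s).1) * Gfun m H d (c s).1 ^ 2 / N) s := fun s => by
    have h1 : HasDerivAt (fun s => (deriv c s).1) _ s :=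
      (ContinuousLinearMap.fst ℝ ℝ ℝ).hasFDerivAt.comp_hasDerivAt s (hc.hasDerivAt_deriv s)
    refine ((hc.unitSpeed.hasDerivAt_snd s).add (h1.div_const N)).congr_deriv ?_
    rw [ContinuousLinearMap.coe_fst', hc.deriv_snd, deriv_Gfun (hpos s)]
    change _ + -(_ * (N - _)) / N = _
    field_simp
    ring
  have hYnonneg : ∀ s, 0 ≤ m * (Real.cosh (c s).1 / Real.sinh (c s).1) *
      Gfun m H d (c s).1 ^ 2 / N := fun s => by
    have h1 := Real.sinh_pos_iff.2 (hpos s)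
    have h2 := Real.cosh_pos (c s).1
    positivity
  have hYmono : Monotone fun s => (c s).2 + (deriv c s).1 / N :=
    monotone_of_deriv_nonneg (fun s => (hY s).differentiableAt) fun s => by
      rw [(hY s).deriv]; exact hYnonneg s
  have hT : 0 < T := by
    rw [hc.T_eq]
    have h1 := hYmono (show 0 ≤ L / 2 by linarith)
    simp only [hc.start, hfst0, hfstL, zero_div, add_zero] at h1
    rcases h1.lt_or_eq with h | h
    · linarith
    -- Equal heights would make the monotone quantity constant on the half period. Its derivative at
    -- `0` is nonzero, because `G = -1` there.
    exfalso
    have hconst : ∀ s ∈ Icc 0 (L / 2), (c s).2 + (deriv c s).1 / N = 0 := fun s hs => by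
      have k1 := hYmono hs.1
      have k2 := hYmono hs.2
      simp only [hc.start, hfst0, hfstL, zero_div, add_zero, ← h] at k1 k2
      exact le_antisymm k2 k1
    have h0 : (0 : ℝ) ∈ Icc 0 (L / 2) := ⟨le_rfl, by linarith⟩
    have k1 := (hY 0).hasDerivWithinAt (s := Icc 0 (L / 2))
    have k2 := ((hasDerivWithinAt_const (0 : ℝ) (Icc 0 (L / 2)) (0 : ℝ)).congr hconst
      (hconst 0 h0))
    have k3 := (uniqueDiffOn_Icc (show (0 : ℝ) < L / 2 by linarith) 0 h0).eq_deriv _ k1 k2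
    rw [hc.start, hGa] at k3
    have k4 := Real.sinh_pos_iff.2 ha
    have k5 := Real.cosh_pos a
    have : 0 < m * (Real.cosh a / Real.sinh a) * (-1) ^ 2 / N := by positivity
    exact this.ne' k3
  have hcurv : ∀ s, 0 < curv c s := fun s => by
    rw [hc.curv_eq]; exact deriv_Gfun_pos hH0 hd.le (hpos s)
  -- The height leaves `0` with derivative `-1` and reaches `T / 2 > 0` at `L / 2`.
  obtain ⟨s, hs, hs0⟩ : ∃ s ∈ Ioo 0 (L / 2), (c s).2 = 0 := by
    have h1 := hc.unitSpeed.hasDerivAt_snd 0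
    have h2 : ∀ᶠ s in 𝓝[>] (0 : ℝ), (c s).2 < 0 := by
      have h3 := (hasDerivWithinAt_iff_tendsto_slope' (s := Ioi (0 : ℝ)) (by simp)).1
        h1.hasDerivWithinAt
      rw [hderiv0] at h3
      filter_upwards [h3.eventually (gt_mem_nhds (show (-1 : ℝ) < 0 by norm_num)),
        self_mem_nhdsWithin] with s hs hs'
      rw [slope_def_field, hc.start] at hs
      simp only [sub_zero] at hs
      have : 0 < s := hs'
      by_contra! h
      linarith [div_nonneg h this.le]
    obtain ⟨s₁, hs₁, hs₁'⟩ := (h2.and (Ioo_mem_nhdsGT (show (0 : ℝ) < L / 2 by linarith))).exists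
    have h3 : 0 < (c (L / 2)).2 := by have := hc.T_eq; linarith
    obtain ⟨s, hs, hs0⟩ := intermediate_value_Ioo hs₁'.2.le (f := fun s => (c s).2)
      hc.unitSpeed.1.snd.continuous.continuousOn ⟨hs₁, h3⟩
    exact ⟨s, ⟨hs₁'.1.trans hs.1, hs.2⟩, hs0⟩
  have hneg : c (-s) = c s := by
    rw [hc.symm]; exact Prod.ext rfl (by simp [hs0])
  have hne : s ≠ -s := by linarith [hs.1]
  have hd1 : deriv c (-s) = (-(deriv c s).1, (deriv c s).2) := by
    have h1 : HasDerivAt (fun s => c (-s)) _ s :=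
      (hc.unitSpeed.hasDerivAt (-s)).scomp s (hasDerivAt_neg s)
    have h2 : HasDerivAt (fun s => ((c s).1, -(c s).2)) ((deriv c s).1, -(deriv c s).2) s :=
      (hc.unitSpeed.hasDerivAt_fst s).prodMk (hc.unitSpeed.hasDerivAt_snd s).neg
    have h3 : (fun s => c (-s)) = fun s => ((c s).1, -(c s).2) := by ext1 s; exact hc.symm s
    rw [h3] at h1
    have h4 := h1.unique h2
    rw [neg_one_smul, neg_eq_iff_eq_neg] at h4
    rw [h4]; simp
  have hp1 := hc.deriv_fst_pos s hs
  -- If `t'(s) ≤ 0`, then `t' = G(ρ) < 0` before `s`, as both `G` and `ρ` are increasing there, and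
  -- the height could not have returned to `0`. Transversality follows, because the two tangents are
  -- `(±ρ', t')` with both entries nonzero.
  have hp2 : 0 < (deriv c s).2 := by
    by_contra! hle
    rw [hc.deriv_snd] at hle
    have hGmono : StrictMonoOn (Gfun m H d) (Ioi 0) :=
      strictMonoOn_of_deriv_pos (convex_Ioi 0) contDiffOn_Gfun.continuousOn fun x hx => by
        rw [interior_Ioi] at hx; exact deriv_Gfun_pos hH0 hd.le hx
    have hanti : StrictAntiOn (fun s => (c s).2) (Icc 0 s) := by
      refine strictAntiOn_of_deriv_neg (convex_Icc _ _)
        hc.unitSpeed.1.snd.continuous.continuousOn fun x hx => ?_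
      rw [interior_Icc] at hx
      rw [(hc.unitSpeed.hasDerivAt_snd x).deriv, hc.deriv_snd]
      refine (hGmono (hpos x) (hpos s) ?_).trans_le hle
      exact hc.strictMonoOn ⟨hx.1.le, (hx.2.trans hs.2).le⟩ (Ioo_subset_Icc_self hs) hx.2
    have := hanti (left_mem_Icc.2 hs.1.le) (right_mem_Icc.2 hs.1.le) hs.1
    simp [hs0, hc.start] at this
  refine ⟨a, b, L, T, c, hc.isDelaunay ha hab hdom hT, hcurv, by rw [hderiv0]; norm_num,
    by rw [hderivL]; norm_num, ⟨s, -s, hne, hneg.symm, ?_⟩, fun hinj => ?_⟩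
  · rw [hd1, LinearIndependent.pair_iff]
    intro x y hxy
    have h1 := congrArg Prod.fst hxy
    have h2 := congrArg Prod.snd hxy
    simp only [Prod.fst_add, Prod.smul_fst, Prod.snd_add, Prod.smul_snd, smul_eq_mul,
      Prod.fst_zero, Prod.snd_zero] at h1 h2
    have h3 : x - y = 0 := by
      have : (x - y) * (deriv c s).1 = 0 := by linarith
      exact (mul_eq_zero.1 this).resolve_right hp1.ne'
    have h4 : x + y = 0 := by
      have : (x + y) * (deriv c s).2 = 0 := by linarith
      exact (mul_eq_zero.1 this).resolve_right hp2.ne'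
    constructor <;> linarith
  · obtain ⟨ξ, hξ⟩ := (NormedSpace.sphere_nonempty (E := EuclideanSpace ℝ (Fin (m + 1)))
      (x := 0)).2 zero_le_one
    have : ((s, ⟨ξ, hξ⟩) : ℝ × sphere (0 : EuclideanSpace ℝ (Fin (m + 1))) 1) = (-s, ⟨ξ, hξ⟩) :=
      hinj (by simp [rotImm, hneg])
    exact hne (congrArg Prod.fst this)

end delaunay

/-! ### Smooth extension of the slope across the axis when `d = 0` -/

/-- In the coordinate `x = tanh (ρ / 2)` of the ball model, `I_m(ρ) = (2 x)^{m+1} J_m(x²)`, where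
`J_m` is smooth on `(-∞, 1)`. -/
def Jint (m : ℕ) (v : ℝ) : ℝ := ∫ u in (0 : ℝ)..1, u ^ m * ((1 - u ^ 2 * v) ^ (m + 1))⁻¹

/-- In the coordinate `x = tanh (ρ / 2)` of the ball model, the sine of the angle of the generating
curve with `d = 0` is `x g(x²)`. -/
def gfun (m : ℕ) (H v : ℝ) : ℝ := 2 * ((m + 1) * H) * (1 - v) ^ m * Jint m v

section Jint

variable {m : ℕ} {H v : ℝ}

theorem star_Iio_one : ∀ x ∈ Iio (1 : ℝ), ∀ u ∈ Icc (0 : ℝ) 1, u * x ∈ Iio (1 : ℝ) := by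
  intro x hx u hu
  simp only [mem_Iio] at *
  rcases le_total x 0 with h | h
  · nlinarith [hu.1]
  · nlinarith [hu.2]

theorem sq_mem_Icc : ∀ u ∈ Icc (0 : ℝ) 1, u ^ 2 ∈ Icc (0 : ℝ) 1 := fun u hu =>
  ⟨by positivity, by nlinarith [hu.1, hu.2]⟩

theorem one_sub_sq_mul_pos (hv : v < 1) {u : ℝ} (hu : u ∈ Icc (0 : ℝ) 1) : 0 < 1 - u ^ 2 * v :=
  sub_pos.2 (star_Iio_one v hv _ (sq_mem_Icc u hu))

theorem contDiffOn_inv_one_sub_pow :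
    ContDiffOn ℝ ∞ (fun x : ℝ => ((1 - x) ^ (m + 1))⁻¹) (Iio 1) :=
  ((contDiffOn_const.sub contDiffOn_id).pow _).inv fun _ hx =>
    (pow_pos (sub_pos.2 hx) _).ne'

theorem contDiffOn_Jint : ContDiffOn ℝ ∞ (Jint m) (Iio 1) :=
  contDiffOn_integral_dilation (w := fun u => u ^ m) (ψ := fun u => u ^ 2)
    (φ := fun x => ((1 - x) ^ (m + 1))⁻¹) isOpen_Iio star_Iio_one (by fun_prop) sq_mem_Icc
    (by fun_prop) contDiffOn_inv_one_sub_pow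

theorem hasDerivAt_Jint (hv : v < 1) : HasDerivAt (Jint m) (deriv (Jint m) v) v :=
  ((contDiffOn_Jint.contDiffAt (Iio_mem_nhds hv)).differentiableAt (by simp)).hasDerivAt

/-- After differentiating under the integral, the left side is the integral of the `u`-derivative of
`u^(m+1) (1 - u² v)^(-(m+1))`. This is the equation `I_m' = sinh^m` in the variable `v = x²`, valid
also at `v = 0`. -/
theorem Jint_ode (hv : v < 1) :
    (m + 1) * Jint m v + 2 * v * deriv (Jint m) v = ((1 - v) ^ (m + 1))⁻¹ := by
  have h1 : deriv (Jint m) v = ∫ u in (0 : ℝ)..1, (u ^ m * u ^ 2) *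
      deriv (fun x : ℝ => ((1 - x) ^ (m + 1))⁻¹) (u ^ 2 * v) :=
    (hasDerivAt_integral_dilation (w := fun u => u ^ m) (ψ := fun u => u ^ 2)
      (φ := fun x => ((1 - x) ^ (m + 1))⁻¹) isOpen_Iio star_Iio_one (by fun_prop) sq_mem_Icc
      (by fun_prop) (contDiffOn_infty.1 contDiffOn_inv_one_sub_pow 1) hv).deriv
  have hφ : ∀ x : ℝ, x < 1 → HasDerivAt (fun x : ℝ => ((1 - x) ^ (m + 1))⁻¹)
      ((m + 1) * ((1 - x) ^ (m + 2))⁻¹) x := fun x hx => by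
    have hx' : 1 - x ≠ 0 := (sub_pos.2 hx).ne'
    refine ((((hasDerivAt_id x).const_sub 1).fun_pow (m + 1)).fun_inv
      (pow_ne_zero _ hx')).congr_deriv ?_
    simp only [id, Nat.add_sub_cancel]
    push_cast
    field_simp
    ring
  have hne : ∀ u ∈ uIcc (0 : ℝ) 1, 1 - u ^ 2 * v ≠ 0 := fun u hu => by
    rw [uIcc_of_le zero_le_one] at hu
    exact (one_sub_sq_mul_pos hv hu).ne'
  have hi1 : ContinuousOn (fun u : ℝ => u ^ m * ((1 - u ^ 2 * v) ^ (m + 1))⁻¹) (uIcc 0 1) :=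
    ContinuousOn.mul (by fun_prop) (ContinuousOn.inv₀ (by fun_prop)
      fun u hu => pow_ne_zero _ (hne u hu))
  have hi2 : ContinuousOn (fun u : ℝ => (u ^ m * u ^ 2) *
      ((m + 1) * ((1 - u ^ 2 * v) ^ (m + 2))⁻¹)) (uIcc 0 1) :=
    ContinuousOn.mul (by fun_prop) (continuousOn_const.mul (ContinuousOn.inv₀ (by fun_prop)
      fun u hu => pow_ne_zero _ (hne u hu)))
  have h2 : deriv (Jint m) v = ∫ u in (0 : ℝ)..1, (u ^ m * u ^ 2) *
      ((m + 1) * ((1 - u ^ 2 * v) ^ (m + 2))⁻¹) := by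
    rw [h1]
    refine intervalIntegral.integral_congr fun u hu => ?_
    rw [uIcc_of_le zero_le_one] at hu
    rw [(hφ _ (sub_pos.1 (one_sub_sq_mul_pos hv hu))).deriv]
  rw [h2, Jint, ← intervalIntegral.integral_const_mul, ← intervalIntegral.integral_const_mul,
    ← intervalIntegral.integral_add (hi1.intervalIntegrable.const_mul _)
      (hi2.intervalIntegrable.const_mul _)]
  have hd : ∀ u ∈ uIcc (0 : ℝ) 1, HasDerivAt
      (fun u : ℝ => u ^ (m + 1) * ((1 - u ^ 2 * v) ^ (m + 1))⁻¹)
      ((m + 1) * (u ^ m * ((1 - u ^ 2 * v) ^ (m + 1))⁻¹) +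
        2 * v * ((u ^ m * u ^ 2) * ((m + 1) * ((1 - u ^ 2 * v) ^ (m + 2))⁻¹))) u := fun u hu => by
    have hu' := hne u hu
    rw [uIcc_of_le zero_le_one] at hu
    have k1 := hφ _ (sub_pos.1 (one_sub_sq_mul_pos hv hu))
    have k2 : HasDerivAt (fun u : ℝ => u ^ 2 * v) (2 * u * v) u := by
      simpa using ((hasDerivAt_id u).fun_pow 2).mul_const v
    refine (((hasDerivAt_id u).fun_pow (m + 1)).mul
      (HasDerivAt.comp (h := fun u : ℝ => u ^ 2 * v) u k1 k2)).congr_deriv ?_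
    simp only [id, Nat.add_sub_cancel, Function.comp_apply]
    push_cast
    field_simp
    ring
  rw [intervalIntegral.integral_eq_sub_of_hasDerivAt hd
    ((hi1.intervalIntegrable.const_mul _).add (hi2.intervalIntegrable.const_mul _))]
  simp

theorem Jint_pos (hv : v < 1) : 0 < Jint m v := by
  refine intervalIntegral.intervalIntegral_pos_of_pos_on ?_ (fun u hu => ?_) zero_lt_one
  · refine ContinuousOn.intervalIntegrable ?_
    refine ContinuousOn.mul (by fun_prop) (ContinuousOn.inv₀ (by fun_prop) fun u hu => ?_)
    rw [uIcc_of_le zero_le_one] at hu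
    exact pow_ne_zero _ (one_sub_sq_mul_pos hv hu).ne'
  · have := one_sub_sq_mul_pos hv (Ioo_subset_Icc_self hu)
    have := hu.1
    positivity

theorem contDiffOn_gfun : ContDiffOn ℝ ∞ (gfun m H) (Iio 1) :=
  (contDiffOn_const.mul ((contDiffOn_const.sub contDiffOn_id).pow _)).mul contDiffOn_Jint

theorem hasDerivAt_gfun (hv : v < 1) : HasDerivAt (gfun m H) (deriv (gfun m H) v) v :=
  ((contDiffOn_gfun.contDiffAt (Iio_mem_nhds hv)).differentiableAt (by simp)).hasDerivAt

theorem gfun_pos (hH : 0 < H) (hv : v < 1) : 0 < gfun m H v := by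
  have h1 := Jint_pos (m := m) hv
  have h2 : 0 < 1 - v := sub_pos.2 hv
  unfold gfun
  positivity

/-- The constant mean curvature equation in the variable `v = tanh² (ρ / 2)`: the left side is
`dG/dρ`, and `(1 + v) / 2 * g` is `coth ρ G` with the singularity at the axis cancelled. It
therefore holds at the poles as well. -/
theorem gfun_ode (hv : v < 1) :
    (1 - v) / 2 * (gfun m H v + 2 * v * deriv (gfun m H) v) =
      (m + 1) * H - m * ((1 + v) / 2 * gfun m H v) := by
  have h2 : 1 - v ≠ 0 := (sub_pos.2 hv).ne'
  have h1 : HasDerivAt (gfun m H) _ v :=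
    ((((hasDerivAt_id v).const_sub 1).fun_pow m).const_mul (2 * ((m + 1) * H))).mul
      (hasDerivAt_Jint (m := m) hv)
  have h3 := Jint_ode (m := m) hv
  rw [h1.deriv]
  simp only [gfun, id]
  have h4 : (1 - v) * ((m : ℝ) * (1 - v) ^ (m - 1)) = m * (1 - v) ^ m := by
    rcases m with _ | m
    · simp
    · simp only [Nat.add_sub_cancel, pow_succ]; ring
  have h5 : (1 - v) ^ (m + 1) * ((m + 1) * Jint m v + 2 * v * deriv (Jint m) v) = 1 := by
    rw [h3, mul_inv_cancel₀ (pow_ne_zero _ h2)]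
  rw [pow_succ] at h5
  linear_combination ((m + 1) * H) * h5 - 2 * v * ((m + 1) * H) * Jint m v * h4

end Jint

/-- The smooth odd extension of `F_{H,0} / sinh^{n-1}`. -/
def Godd (m : ℕ) (H ρ : ℝ) : ℝ := Real.tanh (ρ / 2) * gfun m H (Real.tanh (ρ / 2) ^ 2)

section Godd

variable {m : ℕ} {H ρ : ℝ}

theorem sinh_eq_tanh_half (ρ : ℝ) :
    Real.sinh ρ = 2 * Real.tanh (ρ / 2) / (1 - Real.tanh (ρ / 2) ^ 2) := by
  have h1 := Real.sinh_two_mul (ρ / 2)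
  rw [mul_div_cancel₀ ρ (two_ne_zero)] at h1
  have h0 := Real.cosh_pos (ρ / 2)
  have h2 := Real.cosh_sq (ρ / 2)
  have h3 : 1 - Real.tanh (ρ / 2) ^ 2 = 1 / Real.cosh (ρ / 2) ^ 2 := by
    rw [Real.tanh_eq_sinh_div_cosh]
    field_simp
    linarith
  rw [h3, h1, Real.tanh_eq_sinh_div_cosh]
  field_simp

/-- Both sides vanish at `0` and have derivative `sinh^m`, by `Jint_ode`. -/
theorem I_eq_Jint (m : ℕ) (ρ : ℝ) :
    I m ρ = 2 ^ (m + 1) * Real.tanh (ρ / 2) ^ (m + 1) * Jint m (Real.tanh (ρ / 2) ^ 2) := by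
  have hd : ∀ ρ, HasDerivAt (fun ρ => 2 ^ (m + 1) * Real.tanh (ρ / 2) ^ (m + 1) *
      Jint m (Real.tanh (ρ / 2) ^ 2)) (Real.sinh ρ ^ m) ρ := fun ρ => by
    have h0 := one_sub_tanh_sq_pos (ρ / 2)
    have hlt : Real.tanh (ρ / 2) ^ 2 < 1 := by linarith
    have h1 := hasDerivAt_tanh_half (hasDerivAt_id ρ)
    have h2 := HasDerivAt.comp (h := fun ρ => Real.tanh (ρ / 2) ^ 2) ρ
      (hasDerivAt_Jint (m := m) hlt) (h1.fun_pow 2)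
    refine (((h1.fun_pow (m + 1)).const_mul (2 ^ (m + 1))).mul h2).congr_deriv ?_
    have h3 := Jint_ode (m := m) hlt
    rw [sinh_eq_tanh_half]
    simp only [id, Function.comp_apply, Nat.add_sub_cancel]
    generalize Real.tanh (ρ / 2) = x at *
    have h5 : (1 - x ^ 2) ^ (m + 1) * ((m + 1) * Jint m (x ^ 2) +
        2 * x ^ 2 * deriv (Jint m) (x ^ 2)) = 1 := by
      rw [h3, mul_inv_cancel₀ (pow_ne_zero _ h0.ne')]
    rw [div_pow, eq_div_iff (pow_ne_zero _ h0.ne')]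
    push_cast
    linear_combination (2 * x) ^ m * h5
  have hE : ∀ x, (fun ρ => I m ρ - 2 ^ (m + 1) * Real.tanh (ρ / 2) ^ (m + 1) *
      Jint m (Real.tanh (ρ / 2) ^ 2)) x = (fun ρ => I m ρ - 2 ^ (m + 1) *
      Real.tanh (ρ / 2) ^ (m + 1) * Jint m (Real.tanh (ρ / 2) ^ 2)) 0 := fun x =>
    is_const_of_deriv_eq_zero
      (fun x => ((hasDerivAt_I m x).fun_sub (hd x)).differentiableAt)
      (fun x => by rw [((hasDerivAt_I m x).fun_sub (hd x)).deriv, sub_self]) x 0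
  have := hE ρ
  simp only [I_zero, zero_div, Real.tanh_zero, zero_pow (Nat.succ_ne_zero m), mul_zero, zero_mul,
    sub_zero] at this
  linarith

theorem Godd_eq_Gfun (hρ : 0 < ρ) : Godd m H ρ = Gfun m H 0 ρ := by
  have h0 := one_sub_tanh_sq_pos (ρ / 2)
  have hx := tanh_half_pos hρ
  rw [Godd, Gfun, F, gfun, I_eq_Jint, sinh_eq_tanh_half, div_pow, mul_pow]
  field_simp
  ring

theorem Godd_neg : Godd m H (-ρ) = -Godd m H ρ := by
  simp [Godd, neg_div, Real.tanh_neg]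

theorem Godd_zero : Godd m H 0 = 0 := by simp [Godd]

theorem contDiff_Godd : ContDiff ℝ ∞ (Godd m H) := by
  have h1 : ContDiff ℝ ∞ fun ρ : ℝ => Real.tanh (ρ / 2) :=
    contDiff_tanh.comp (contDiff_id.div_const 2)
  refine h1.mul ?_
  rw [contDiff_iff_contDiffAt]
  intro ρ
  have hlt : Real.tanh (ρ / 2) ^ 2 < 1 := by linarith [one_sub_tanh_sq_pos (ρ / 2)]
  exact ContDiffAt.comp (f := fun ρ : ℝ => Real.tanh (ρ / 2) ^ 2) ρ
    (contDiffOn_gfun.contDiffAt (Iio_mem_nhds hlt)) (h1.pow 2).contDiffAt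

theorem deriv_Godd (ρ : ℝ) :
    deriv (Godd m H) ρ = (1 - Real.tanh (ρ / 2) ^ 2) / 2 * (gfun m H (Real.tanh (ρ / 2) ^ 2) +
      2 * Real.tanh (ρ / 2) ^ 2 * deriv (gfun m H) (Real.tanh (ρ / 2) ^ 2)) := by
  have hlt : Real.tanh (ρ / 2) ^ 2 < 1 := by linarith [one_sub_tanh_sq_pos (ρ / 2)]
  have h1 := hasDerivAt_tanh_half (hasDerivAt_id ρ)
  have h2 := HasDerivAt.comp (h := fun ρ => Real.tanh (ρ / 2) ^ 2) ρ
      (hasDerivAt_gfun (m := m) (H := H) hlt) (h1.fun_pow 2)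
  have h3 : HasDerivAt (Godd m H) _ ρ := h1.mul h2
  rw [h3.deriv]
  simp only [id]
  push_cast
  ring

/-- Off the axis this is `deriv_Gfun_pos` with `d = 0`, together with evenness of the derivative; on
the axis the derivative is `g(0) / 2`. -/
theorem deriv_Godd_pos (hH : 0 < H) (ρ : ℝ) : 0 < deriv (Godd m H) ρ := by
  have hpos : ∀ ρ, 0 < ρ → 0 < deriv (Godd m H) ρ := fun ρ hρ => by
    have : Godd m H =ᶠ[𝓝 ρ] Gfun m H 0 := by
      filter_upwards [Ioi_mem_nhds hρ] with x hx using Godd_eq_Gfun hx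
    rw [this.deriv_eq]
    exact deriv_Gfun_pos hH le_rfl hρ
  rcases lt_trichotomy ρ 0 with h | rfl | h
  · have := hpos (-ρ) (by linarith)
    rw [deriv_Godd] at this ⊢
    simpa [neg_div, Real.tanh_neg] using this
  · rw [deriv_Godd]
    simpa using gfun_pos hH zero_lt_one
  · exact hpos ρ h

theorem strictMono_Godd (hH : 0 < H) : StrictMono (Godd m H) :=
  strictMono_of_deriv_pos (deriv_Godd_pos hH)

end Godd

/-! ### Strict convexity of a lens -/

/-- A lens bounded by the graph of a strictly convex function and its mirror image. -/
theorem lens_strictConvex {φ : ℝ → ℝ} {a A : ℝ} (ha : 0 < a) (hφ : ContinuousOn φ (Icc (-a) a))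
    (hconv : StrictConvexOn ℝ (Icc (-a) a) φ) (h1 : φ (-a) = A) (h2 : φ a = A) :
    ∃ K : Set (ℝ × ℝ), IsCompact K ∧ StrictConvex ℝ K ∧ (interior K).Nonempty ∧
      frontier K = {q | q.1 ∈ Icc (-a) a ∧ (q.2 = φ q.1 ∨ q.2 = 2 * A - φ q.1)} := by
  have haa : -a ≤ a := by linarith
  -- Extending `φ` by constants to a continuous function on `ℝ` lets strict and weak inequalities
  -- define open and closed sets of the plane.
  set ψ : ℝ → ℝ := IccExtend haa ((Icc (-a) a).domRestrict φ) with hψ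
  have hψc : Continuous ψ := (continuousOn_iff_continuous_domRestrict.1 hφ).Icc_extend'
  have hψφ : ∀ x ∈ Icc (-a) a, ψ x = φ x := fun x hx => by
    simp [hψ, IccExtend_of_mem haa _ hx, domRestrict]
  have hlt : ∀ x ∈ Ioo (-a) a, φ x < A := fun x hx => by
    have := hconv.lt_on_openSegment (left_mem_Icc.2 haa) (right_mem_Icc.2 haa)
      (by linarith) (z := x) (by rw [openSegment_eq_Ioo (by linarith)]; exact hx)
    rwa [h1, h2, max_self] at this
  have hle : ∀ x ∈ Icc (-a) a, φ x ≤ A := fun x hx => by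
    rcases eq_or_lt_of_le hx.1 with rfl | h3
    · exact h1.le
    rcases eq_or_lt_of_le hx.2 with rfl | h4
    · exact h2.le
    exact (hlt x ⟨h3, h4⟩).le
  set K : Set (ℝ × ℝ) := {q | q.1 ∈ Icc (-a) a ∧ ψ q.1 ≤ q.2 ∧ q.2 ≤ 2 * A - ψ q.1} with hK
  have hclosed : IsClosed K := by
    have e1 : IsClosed {q : ℝ × ℝ | q.1 ∈ Icc (-a) a} := isClosed_Icc.preimage continuous_fst
    have e2 : IsClosed {q : ℝ × ℝ | ψ q.1 ≤ q.2} := isClosed_le (by fun_prop) (by fun_prop)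
    have e3 : IsClosed {q : ℝ × ℝ | q.2 ≤ 2 * A - ψ q.1} := isClosed_le (by fun_prop) (by fun_prop)
    exact e1.inter (e2.inter e3)
  set O : Set (ℝ × ℝ) := {q | q.1 ∈ Ioo (-a) a ∧ ψ q.1 < q.2 ∧ q.2 < 2 * A - ψ q.1} with hO
  have hOopen : IsOpen O := by
    have e1 : IsOpen {q : ℝ × ℝ | q.1 ∈ Ioo (-a) a} := isOpen_Ioo.preimage continuous_fst
    have e2 : IsOpen {q : ℝ × ℝ | ψ q.1 < q.2} := isOpen_lt (by fun_prop) (by fun_prop)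
    have e3 : IsOpen {q : ℝ × ℝ | q.2 < 2 * A - ψ q.1} := isOpen_lt (by fun_prop) (by fun_prop)
    exact e1.inter (e2.inter e3)
  have hOK : O ⊆ K := fun q hq => ⟨Ioo_subset_Icc_self hq.1, hq.2.1.le, hq.2.2.le⟩
  have hOint : O ⊆ interior K := interior_maximal hOK hOopen
  have hedge : ∀ q ∈ K, q.2 = ψ q.1 ∨ q.2 = 2 * A - ψ q.1 → q ∉ interior K := by
    rintro ⟨x, y⟩ hq hor hint
    rw [mem_interior_iff_mem_nhds] at hint
    have hc : Continuous fun t : ℝ => ((x, t) : ℝ × ℝ) := by fun_prop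
    have hn : ∀ᶠ t in 𝓝 y, ((x, t) : ℝ × ℝ) ∈ K := hc.continuousAt.eventually hint
    simp only at hor
    rcases hor with h | h
    · obtain ⟨t, ht, ht'⟩ := ((hn.filter_mono nhdsWithin_le_nhds).and
        (self_mem_nhdsWithin (s := Iio y) (a := y))).exists
      exact absurd ht.2.1 (not_le.2 (by rw [← h]; exact ht'))
    · obtain ⟨t, ht, ht'⟩ := ((hn.filter_mono nhdsWithin_le_nhds).and
        (self_mem_nhdsWithin (s := Ioi y) (a := y))).exists
      exact absurd ht.2.2 (not_le.2 (by rw [← h]; exact ht'))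
  have hintO : interior K ⊆ O := by
    intro q hq
    have hqK := interior_subset hq
    have hl : ψ q.1 < q.2 := lt_of_le_of_ne hqK.2.1 fun h => hedge q hqK (Or.inl h.symm) hq
    have hu : q.2 < 2 * A - ψ q.1 := lt_of_le_of_ne hqK.2.2 fun h => hedge q hqK (Or.inr h) hq
    -- A point strictly between the two graphs forces `ψ < A`; this excludes the tips `±a`, where
    -- the graphs meet.
    have hA : ψ q.1 < A := by linarith
    rw [hψφ _ hqK.1] at hA
    refine ⟨⟨lt_of_le_of_ne hqK.1.1 fun h => ?_, lt_of_le_of_ne hqK.1.2 fun h => ?_⟩, hl, hu⟩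
    · rw [← h, h1] at hA; exact lt_irrefl _ hA
    · rw [h, h2] at hA; exact lt_irrefl _ hA
  refine ⟨K, ?_, ?_, ?_, ?_⟩
  · obtain ⟨C, hC⟩ := isCompact_Icc.exists_bound_of_continuousOn (s := Icc (-a) a)
      hψc.continuousOn
    refine (isCompact_Icc.prod (isCompact_Icc (a := -C) (b := 2 * A + C))).of_isClosed_subset
      hclosed fun q hq => ⟨hq.1, ?_⟩
    have := abs_le.1 (hC q.1 hq.1)
    exact ⟨by linarith [hq.2.1], by linarith [hq.2.2]⟩
  · rintro ⟨x, y⟩ hx ⟨x', y'⟩ hx' hne s t hs ht hst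
    refine hOint ?_
    -- On a vertical segment strictness comes from the distinct second coordinates, and otherwise
    -- from strict convexity of `φ`.
    rcases eq_or_ne x x' with rfl | hxx
    · have hyy : y ≠ y' := fun h => hne (by rw [h])
      have hA : φ x < A := by
        by_contra! h
        have e1 := hx.2
        have e2 := hx'.2
        simp only [hψφ x hx.1] at e1 e2
        exact hyy (by linarith)
      have hxI : x ∈ Ioo (-a) a := by
        refine ⟨lt_of_le_of_ne hx.1.1 fun h => ?_, lt_of_le_of_ne hx.1.2 fun h => ?_⟩
        · rw [← h, h1] at hA; exact lt_irrefl _ hA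
        · rw [h, h2] at hA; exact lt_irrefl _ hA
      have e0 : s • (x, y) + t • (x, y') = (x, s * y + t * y') := by
        refine Prod.ext ?_ rfl
        simp only [Prod.fst_add, Prod.smul_fst, smul_eq_mul]
        rw [← add_mul, hst, one_mul]
      rw [e0]
      have e1 := hx.2
      have e2 := hx'.2
      simp only at e1 e2
      have ht' : t = 1 - s := by linarith
      refine ⟨hxI, ?_, ?_⟩ <;> simp only [ht']
      · rcases lt_or_gt_of_ne hyy with h | h <;> nlinarith
      · rcases lt_or_gt_of_ne hyy with h | h <;> nlinarith
    · have e1 := hx.2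
      have e2 := hx'.2
      simp only [hψφ x hx.1, hψφ x' hx'.1] at e1 e2
      have hmem : s • x + t • x' ∈ Ioo (-a) a := by
        have := (strictConvex_Icc (-a) a) hx.1 hx'.1 hxx hs ht hst
        rwa [interior_Icc] at this
      have hc := hconv.2 hx.1 hx'.1 hxx hs ht hst
      have e3 := hψφ _ (Ioo_subset_Icc_self hmem)
      simp only [smul_eq_mul] at hc hmem e3
      refine ⟨hmem, ?_, ?_⟩ <;> simp only [Prod.fst_add, Prod.smul_fst, Prod.snd_add, Prod.smul_snd,
        smul_eq_mul, e3]
      · nlinarith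
      · have k1 := mul_le_mul_of_nonneg_left e1.2 hs.le
        have k2 := mul_le_mul_of_nonneg_left e2.2 ht.le
        have k3 : s * A + t * A = A := by rw [← add_mul, hst, one_mul]
        linarith
  · refine ⟨(0, A), hOint ⟨⟨by linarith, ha⟩, ?_, ?_⟩⟩ <;>
    simp only [hψφ 0 ⟨by linarith, ha.le⟩] <;> linarith [hlt 0 ⟨by linarith, ha⟩]
  · rw [hclosed.frontier_eq]
    ext q
    constructor
    · rintro ⟨hq, hq'⟩
      refine ⟨hq.1, ?_⟩
      by_contra! h
      rw [← hψφ _ hq.1] at h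
      refine hq' (hOint ?_)
      have hl : ψ q.1 < q.2 := lt_of_le_of_ne hq.2.1 h.1.symm
      have hu : q.2 < 2 * A - ψ q.1 := lt_of_le_of_ne hq.2.2 h.2
      have hA : ψ q.1 < A := by linarith
      rw [hψφ _ hq.1] at hA
      refine ⟨⟨lt_of_le_of_ne hq.1.1 fun h => ?_, lt_of_le_of_ne hq.1.2 fun h => ?_⟩, hl, hu⟩
      · rw [← h, h1] at hA; exact lt_irrefl _ hA
      · rw [h, h2] at hA; exact lt_irrefl _ hA
    · rintro ⟨hq, hor⟩
      have hA := hle _ hq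
      rw [← hψφ _ hq] at hor hA
      have hqK : q ∈ K := ⟨hq, by rcases hor with h | h <;> constructor <;> linarith⟩
      exact ⟨hqK, hedge q hqK hor⟩

/-! ### The closed convex curve with `d = 0` -/

section sphereProfile

variable {m : ℕ} {H a L T : ℝ} {c : ℝ → ℝ × ℝ}

theorem Godd_sq_lt_one (hdom : dom m H 0 = Ioo 0 a) {x : ℝ} (hx : x ∈ Ioo (-a) a) :
    Godd m H x ^ 2 < 1 := by
  have hpos : ∀ x ∈ Ioo 0 a, Godd m H x ^ 2 < 1 := fun x hx => by
    rw [Godd_eq_Gfun hx.1, ← mem_dom_iff hx.1, hdom]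
    exact hx
  rcases lt_trichotomy x 0 with h | rfl | h
  · have := hpos (-x) ⟨by linarith, by linarith [hx.1]⟩
    rwa [Godd_neg, neg_sq] at this
  · simp [Godd_zero]
  · exact hpos x ⟨h, hx.2⟩

/-- With the signed distance as radius, `G` runs from `-1` at `-a` to `1` at `a` with positive
derivative. The general construction thus applies on `[-a, a]`, and the curve crosses the axis
smoothly. -/
theorem exists_sphere_profile (hH : 0 < H) (ha : 0 < a) (ha0 : M m H 0 a = 0)
    (hdom : dom m H 0 = Ioo 0 a) : ∃ L T c, IsProfile (Godd m H) (-a) a L T c := by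
  have hGa : Godd m H a = 1 := by rw [Godd_eq_Gfun ha, Gfun_eq_one ha ha0]
  refine exists_profile isOpen_univ (by linarith) (subset_univ _) contDiff_Godd.contDiffOn
    (by rw [Godd_neg, hGa]; norm_num) (by rw [hGa]; norm_num)
    (fun x hx => Godd_sq_lt_one hdom hx) ?_ ?_
  · rw [Godd_neg, hGa]; linarith [deriv_Godd_pos (m := m) hH (-a)]
  · rw [hGa]; linarith [deriv_Godd_pos (m := m) hH a]

/-- The slope `G / √(1 - G²)` of the generating curve with `d = 0`, as an odd function of the signed
distance to the axis. -/
def Qodd (m : ℕ) (H x : ℝ) : ℝ := Godd m H x / √(1 - Godd m H x ^ 2)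

theorem Qodd_neg (x : ℝ) : Qodd m H (-x) = -Qodd m H x := by
  simp [Qodd, Godd_neg, neg_div]

theorem height_eq_Qodd {x : ℝ} (hx : 0 ≤ x) : height m H 0 0 x = ∫ y in (0 : ℝ)..x, Qodd m H y := by
  rw [height, intervalIntegral.integral_of_le hx, intervalIntegral.integral_of_le hx]
  refine setIntegral_congr_fun measurableSet_Ioc fun y hy => ?_
  rw [Q_eq hy.1, Qodd, Godd_eq_Gfun hy.1]

theorem height_abs_eq_Qodd (x : ℝ) : height m H 0 0 |x| = ∫ y in (0 : ℝ)..x, Qodd m H y := by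
  rcases le_total 0 x with h | h
  · rw [abs_of_nonneg h, height_eq_Qodd h]
  · rw [abs_of_nonpos h, height_eq_Qodd (by linarith)]
    have := intervalIntegral.integral_comp_neg (fun y => Qodd m H y) (a := 0) (b := -x)
    simp only [Qodd_neg, neg_zero, neg_neg, intervalIntegral.integral_neg] at this
    rw [intervalIntegral.integral_symm 0 x] at this
    linarith

namespace IsProfile

theorem intervalIntegrable_Qodd (hc : IsProfile (Godd m H) (-a) a L T c) (ha : 0 < a) {x y : ℝ}
    (hx : x ∈ Icc (-a) a) (hy : y ∈ Icc (-a) a) : IntervalIntegrable (Qodd m H) volume x y := by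
  have h : IntervalIntegrable (Qodd m H) volume (-a) a := by
    rw [intervalIntegrable_iff_integrableOn_Ioo_of_le (by linarith)]
    exact hc.integrableOn
  refine h.mono_set ?_
  rw [uIcc_of_le (show -a ≤ a by linarith)]
  exact ordConnected_Icc.uIcc_subset hx hy

theorem snd_eq_sub (hc : IsProfile (Godd m H) (-a) a L T c) (ha : 0 < a) {s : ℝ}
    (hs : s ∈ Icc 0 (L / 2)) :
    (c s).2 = height m H 0 0 |(c s).1| - height m H 0 0 a := by
  have h0 : (0 : ℝ) ∈ Icc (-a) a := ⟨by linarith, ha.le⟩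
  have hl : -a ∈ Icc (-a) a := ⟨le_rfl, by linarith⟩
  rw [hc.snd_eq_integral hs, height_abs_eq_Qodd]
  have h1 := height_abs_eq_Qodd (m := m) (H := H) (-a)
  rw [abs_neg, abs_of_pos ha] at h1
  rw [h1, intervalIntegral.integral_interval_sub_left
    (hc.intervalIntegrable_Qodd ha h0 (hc.mem s)) (hc.intervalIntegrable_Qodd ha h0 hl)]
  rfl

/-- The slope is odd in the signed distance, so the height is even and takes the same value at `-a`
and `a`; the curve closes up after one period. -/
theorem T_eq_zero (hc : IsProfile (Godd m H) (-a) a L T c) (ha : 0 < a) : T = 0 := by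
  have hL := hc.L_pos
  rw [hc.T_eq, hc.snd_eq_sub ha ⟨by linarith, le_rfl⟩, hc.finish, abs_of_pos ha]
  ring

end IsProfile

theorem continuousOn_height_abs (hc : IsProfile (Godd m H) (-a) a L T c) (ha : 0 < a) :
    ContinuousOn (fun x => height m H 0 0 |x|) (Icc (-a) a) := by
  have h0 : (0 : ℝ) ∈ uIcc (-a) a := by
    rw [uIcc_of_le (by linarith)]; exact ⟨by linarith, ha.le⟩
  have h := intervalIntegral.continuousOn_primitive_interval' (μ := volume)
    (hc.intervalIntegrable_Qodd ha ⟨le_rfl, by linarith⟩ ⟨by linarith, le_rfl⟩) h0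
  rw [uIcc_of_le (by linarith)] at h
  exact h.congr fun x _ => height_abs_eq_Qodd x

theorem hasDerivAt_height_abs (hc : IsProfile (Godd m H) (-a) a L T c) (ha : 0 < a) {x : ℝ}
    (hx : x ∈ Ioo (-a) a) : HasDerivAt (fun x => height m H 0 0 |x|) (Qodd m H x) x := by
  have hQ : ContinuousOn (Qodd m H) (Ioo (-a) a) := fun y hy =>
    ((contDiff_Godd.continuous.continuousAt).div
      (Real.continuous_sqrt.continuousAt.comp
        (continuousAt_const.sub (contDiff_Godd.continuous.continuousAt.pow 2)))
      (Real.sqrt_pos.2 (sub_pos.2 (hc.sq_lt_one hy))).ne').continuousWithinAt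
  have h := intervalIntegral.integral_hasDerivAt_right
    (hc.intervalIntegrable_Qodd ha ⟨by linarith, ha.le⟩ (Ioo_subset_Icc_self hx))
    (hQ.stronglyMeasurableAtFilter isOpen_Ioo x hx) (hQ.continuousAt (isOpen_Ioo.mem_nhds hx))
  exact h.congr_of_eventuallyEq (Eventually.of_forall height_abs_eq_Qodd)

theorem div_sqrt_one_sub_sq_lt {x y : ℝ} (hx : x ^ 2 < 1) (hy : y ^ 2 < 1) (hxy : x < y) :
    x / √(1 - x ^ 2) < y / √(1 - y ^ 2) := by
  have hd : ∀ x ∈ Ioo (-1 : ℝ) 1, HasDerivAt (fun x => x / √(1 - x ^ 2))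
      (1 / √(1 - x ^ 2) ^ 3) x := fun x hx => by
    have h0 : 0 < 1 - x ^ 2 := by nlinarith [hx.1, hx.2]
    have h1 := (((hasDerivAt_id x).fun_pow 2).const_sub 1).sqrt h0.ne'
    have h2 := (hasDerivAt_id x).fun_div h1 (Real.sqrt_pos.2 h0).ne'
    refine h2.congr_deriv ?_
    have h3 := Real.sqrt_pos.2 h0
    have h4 := Real.sq_sqrt h0.le
    simp only [id]
    generalize √(1 - x ^ 2) = q at *
    field_simp
    norm_num
    linear_combination 2 * h4
  have hm : StrictMonoOn (fun x : ℝ => x / √(1 - x ^ 2)) (Ioo (-1) 1) := by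
    refine strictMonoOn_of_deriv_pos (convex_Ioo _ _)
      (fun x hx => (hd x hx).continuousAt.continuousWithinAt) fun x hx => ?_
    rw [interior_Ioo] at hx
    rw [(hd x hx).deriv]
    have h0 : 0 < 1 - x ^ 2 := by nlinarith [hx.1, hx.2]
    positivity
  have hx' := abs_lt.1 ((sq_lt_one_iff_abs_lt_one x).1 hx)
  have hy' := abs_lt.1 ((sq_lt_one_iff_abs_lt_one y).1 hy)
  exact hm hx' hy' hxy

/-- The slope `G / √(1 - G²)` is an increasing function of `G`, and `G` is increasing in the signed
distance. -/
theorem strictConvexOn_height_abs (hc : IsProfile (Godd m H) (-a) a L T c) (hH : 0 < H)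
    (ha : 0 < a) : StrictConvexOn ℝ (Icc (-a) a) (fun x => height m H 0 0 |x|) := by
  refine StrictMonoOn.strictConvexOn_of_deriv (convex_Icc _ _) (continuousOn_height_abs hc ha) ?_
  rw [interior_Icc]
  intro x hx y hy hxy
  rw [(hasDerivAt_height_abs hc ha hx).deriv, (hasDerivAt_height_abs hc ha hy).deriv]
  exact div_sqrt_one_sub_sq_lt (hc.sq_lt_one hx) (hc.sq_lt_one hy) (strictMono_Godd hH hxy)

/-- The closed convex curve obtained by reflection from the graph of `λ_{H,0}`. -/
def ovalSet (m : ℕ) (H a : ℝ) : Set (ℝ × ℝ) :=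
  {q | |q.1| ≤ a ∧ (q.2 = height m H 0 0 |q.1| ∨
    q.2 = 2 * height m H 0 0 a - height m H 0 0 |q.1|)}

theorem height_abs_lt (hc : IsProfile (Godd m H) (-a) a L T c) (hH : 0 < H) (ha : 0 < a) {x : ℝ}
    (hx : x ∈ Ioo (-a) a) : height m H 0 0 |x| < height m H 0 0 a := by
  have := (strictConvexOn_height_abs hc hH ha).lt_on_openSegment
    (left_mem_Icc.2 (by linarith)) (right_mem_Icc.2 (by linarith))
    (by linarith) (z := x) (by rw [openSegment_eq_Ioo (by linarith)]; exact hx)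
  simpa [abs_of_pos ha] using this

/-- The profile starts at height `0` at its left tip; adding `A` puts the tips at height `A` and the
lowest point at the origin. The first half period is then the graph of the height function in `|ρ|`,
and the reflection `s ↦ L - s` produces the upper half. -/
theorem isSphereLike_of_profile (hH : 0 < H) (ha : 0 < a) (hdom : dom m H 0 = Ioo 0 a)
    (hc : IsProfile (Godd m H) (-a) a L T c)
    (hsphere : ∃ f : sphere (0 : EuclideanSpace ℝ (Fin (m + 1 + 1))) 1 → Amb (m + 1),
      IsSmoothEmb (𝓡 (m + 1)) f ∧ range f = rotSet m (ovalSet m H a) ∧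
      ∃ ν : sphere (0 : EuclideanSpace ℝ (Fin (m + 1 + 1))) 1 → Amb (m + 1),
        Continuous ν ∧ ∀ p, HasMeanCurvatureAt (𝓡 (m + 1)) f p (ν p) H) :
    IsSphereLike m H a L (fun s => ((c s).1, (c s).2 + height m H 0 0 a)) := by
  have hL := hc.L_pos
  set A := height m H 0 0 a with hA
  have hT := hc.T_eq_zero ha
  have hint : IntervalIntegrable (Q m H 0) volume 0 a := by
    have h := hc.intervalIntegrable_Qodd ha (x := 0) (y := a) ⟨by linarith, ha.le⟩
      ⟨by linarith, le_rfl⟩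
    rw [intervalIntegrable_iff_integrableOn_Ioo_of_le ha.le] at h ⊢
    refine h.congr_fun (fun x hx => ?_) measurableSet_Ioo
    rw [Q_eq hx.1, Qodd, Godd_eq_Gfun hx.1]
  have hd : ∀ s, HasDerivAt (fun s => ((c s).1, (c s).2 + A)) (deriv c s) s := fun s =>
    (hc.unitSpeed.hasDerivAt_fst s).prodMk ((hc.unitSpeed.hasDerivAt_snd s).add_const A)
  have hd' : deriv (fun s => ((c s).1, (c s).2 + A)) = deriv c := by ext1 s; exact (hd s).deriv
  have hper : ∀ s, c (s + L) = c s := fun s => by rw [hc.period, hT]; simp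
  have hlow : ∀ s ∈ Icc 0 (L / 2), (c s).2 + A = height m H 0 0 |(c s).1| := fun s hs => by
    rw [hc.snd_eq_sub ha hs]; ring
  have hrefl : ∀ s, c s = ((c (L - s)).1, -(c (L - s)).2) := fun s => by
    rw [← hc.symm, ← hper (-(L - s))]
    congr 1; ring
  have hup : ∀ s ∈ Icc (L / 2) L, (c s).2 + A = 2 * A - height m H 0 0 |(c s).1| := fun s hs => by
    have h := hlow (L - s) ⟨by linarith [hs.2], by linarith [hs.1]⟩
    have h2 := hrefl s
    have h3 : (c s).1 = (c (L - s)).1 := by rw [h2]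
    have h4 : (c s).2 = -(c (L - s)).2 := by rw [h2]
    rw [h3, h4, ← h]; ring
  have hcper : Function.Periodic (fun s => ((c s).1, (c s).2 + A)) L := fun s => by
    simp only [hper]
  have hrange : range (fun s => ((c s).1, (c s).2 + A)) = ovalSet m H a := by
    ext q
    constructor
    · rintro ⟨s, rfl⟩
      refine ⟨abs_le.2 (hc.mem s), ?_⟩
      obtain ⟨s', hs', h⟩ := hcper.exists_mem_Ico₀ hL s
      have h1 : (c s).1 = (c s').1 := (Prod.mk.inj h).1
      have h2 : (c s).2 + A = (c s').2 + A := (Prod.mk.inj h).2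
      simp only [h1, h2]
      rcases le_total s' (L / 2) with h3 | h3
      · exact Or.inl (hlow s' ⟨hs'.1, h3⟩)
      · exact Or.inr (hup s' ⟨h3, hs'.2.le⟩)
    · rintro ⟨hq, hor⟩
      obtain ⟨s, hs, hs'⟩ := hc.exists_param (abs_le.1 hq)
      rcases hor with h | h
      · exact ⟨s, Prod.ext hs' (by rw [h, ← hs']; exact hlow s hs)⟩
      · refine ⟨L - s, Prod.ext ?_ ?_⟩
        · rw [← hs']; simp only; rw [hrefl (L - s)]; simp
        · have h1 : (c (L - s)).1 = (c s).1 := by rw [hrefl (L - s)]; simp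
          have := hup (L - s) ⟨by linarith [hs.2], by linarith [hs.1]⟩
          rw [h, ← hs', ← h1]; exact this
  have hsimple : InjOn (fun s => ((c s).1, (c s).2 + A)) (Ico 0 L) := by
    -- Away from the tips the lower half lies strictly below `A` and the upper half strictly above,
    -- so the two halves cannot meet there.
    have hmix : ∀ s₁ ∈ Icc 0 (L / 2), ∀ s₂ ∈ Ioo (L / 2) L, (c s₁).1 = (c s₂).1 →
        (c s₁).2 ≠ (c s₂).2 := by
      intro s₁ h1 s₂ h2 he he2
      have h3 : (c s₂).1 = (c (L - s₂)).1 := by rw [hrefl s₂]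
      have hm2 : L - s₂ ∈ Ioo 0 (L / 2) := ⟨by linarith [h2.2], by linarith [h2.1]⟩
      have h4 : (c s₂).1 ∈ Ioo (-a) a := by
        rw [h3]
        have h5 := hc.strictMonoOn (left_mem_Icc.2 (by linarith)) (Ioo_subset_Icc_self hm2) hm2.1
        have h6 := hc.strictMonoOn (Ioo_subset_Icc_self hm2) (right_mem_Icc.2 (by linarith)) hm2.2
        simp only [hc.start] at h5
        simp only [hc.finish] at h6
        exact ⟨h5, h6⟩
      have h7 := height_abs_lt hc hH ha h4
      have h8 := hlow s₁ h1
      have h9 := hup s₂ ⟨h2.1.le, h2.2.le⟩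
      rw [he, he2] at h8
      linarith
    intro s₁ h1 s₂ h2 he
    have e1 : (c s₁).1 = (c s₂).1 := (Prod.mk.inj he).1
    have e2 : (c s₁).2 = (c s₂).2 := add_right_cancel (Prod.mk.inj he).2
    rcases le_or_gt s₁ (L / 2) with k1 | k1 <;> rcases le_or_gt s₂ (L / 2) with k2 | k2
    · exact hc.strictMonoOn.injOn ⟨h1.1, k1⟩ ⟨h2.1, k2⟩ e1
    · exact absurd e2 (hmix s₁ ⟨h1.1, k1⟩ s₂ ⟨k2, h2.2⟩ e1)
    · exact absurd e2.symm (hmix s₂ ⟨h2.1, k2⟩ s₁ ⟨k1, h1.2⟩ e1.symm)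
    · have e3 : (c (L - s₁)).1 = (c (L - s₂)).1 := by
        rw [← (show (c s₁).1 = (c (L - s₁)).1 by rw [hrefl s₁]),
          ← (show (c s₂).1 = (c (L - s₂)).1 by rw [hrefl s₂]), e1]
      have := hc.strictMonoOn.injOn (x₁ := L - s₁) (x₂ := L - s₂)
        ⟨by linarith [h1.2], by linarith⟩ ⟨by linarith [h2.2], by linarith⟩ e3
      linarith
  obtain ⟨K, hK1, hK2, hK3, hK4⟩ := lens_strictConvex (A := A) ha
    (continuousOn_height_abs hc ha) (strictConvexOn_height_abs hc hH ha)
    (by simp [abs_of_pos ha, hA]) (by simp [abs_of_pos ha, hA])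
  have hfront : ovalSet m H a = frontier K := by
    rw [hK4]
    ext q
    simp only [ovalSet, mem_ofPred_eq, abs_le, mem_Icc, hA]
  have hcompact : IsCompact (rotSet m (ovalSet m H a)) := by
    have h1 : IsCompact (ovalSet m H a) := by
      rw [hfront]
      exact hK1.of_isClosed_subset isClosed_frontier hK1.isClosed.frontier_subset
    have htanh : Continuous Real.tanh := (contDiff_tanh (k := 0)).continuous
    have h2 : Continuous fun q : (ℝ × ℝ) × sphere (0 : EuclideanSpace ℝ (Fin (m + 1))) 1 =>
        ((Real.tanh (q.1.1 / 2) • (q.2 : EuclideanSpace ℝ (Fin (m + 1))), q.1.2) :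
          Amb (m + 1)) := by fun_prop
    have h3 : rotSet m (ovalSet m H a) = (fun q : (ℝ × ℝ) ×
        sphere (0 : EuclideanSpace ℝ (Fin (m + 1))) 1 =>
        ((Real.tanh (q.1.1 / 2) • (q.2 : EuclideanSpace ℝ (Fin (m + 1))), q.1.2) :
          Amb (m + 1))) '' (ovalSet m H a ×ˢ univ) := by
      ext q
      constructor
      · rintro ⟨p, hp, ξ, rfl⟩
        exact ⟨(p, ξ), ⟨hp, mem_univ _⟩, rfl⟩
      · rintro ⟨⟨p, ξ⟩, ⟨hp, -⟩, rfl⟩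
        exact ⟨p, hp, ξ, rfl⟩
    rw [h3]
    exact (h1.prod isCompact_univ).image h2
  refine
    { a_pos := ha
      dom_eq := hdom
      integrable := hint
      unitSpeed := ⟨hc.unitSpeed.1.fst.prodMk (hc.unitSpeed.1.snd.add contDiff_const),
        fun s => by rw [hd']; exact hc.unitSpeed.2 s⟩
      L_pos := hL
      closed := hcper
      simple := hsimple
      range_eq := hrange
      convex := ⟨K, hK1, hK2, hK3, hrange.trans hfront⟩
      curv_pos := fun s => ?_
      compact := by rw [hrange]; exact hcompact
      sphere := by rw [hrange]; exact hsphere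
      all := fun J l hl _ h => ?_ }
  · have := hc.curv_eq s
    unfold curv at this ⊢
    rw [hd', this]
    exact deriv_Godd_pos hH _
  · obtain ⟨τ, hτ⟩ := exists_translation hdom hint hl h
    refine ⟨τ, fun ρ hρ => ?_⟩
    obtain ⟨h1, h2⟩ := hτ ρ hρ
    rw [hrange]
    exact ⟨by simpa [abs_of_pos h1.1] using h1.2.le, Or.inl (by simpa [abs_of_pos h1.1] using h2)⟩

end sphereProfile

/-! ### Parametrization of the rotation sphere by the unit sphere -/

/-- The projection that forgets the last coordinate. -/
def initL (n : ℕ) : EuclideanSpace ℝ (Fin (n + 1)) →L[ℝ] EuclideanSpace ℝ (Fin n) :=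
  LinearMap.toContinuousLinearMap
    { toFun := fun y => WithLp.toLp 2 fun i => y i.castSucc
      map_add' := fun _ _ => rfl
      map_smul' := fun _ _ => rfl }

/-- The last coordinate. -/
def lastL (n : ℕ) : EuclideanSpace ℝ (Fin (n + 1)) →L[ℝ] ℝ := EuclideanSpace.proj (Fin.last n)

/-- The vector with given first coordinates and last coordinate. -/
def snocE {n : ℕ} (z : EuclideanSpace ℝ (Fin n)) (u : ℝ) : EuclideanSpace ℝ (Fin (n + 1)) :=
  WithLp.toLp 2 (Fin.snoc (α := fun _ => ℝ) z u)

section coordinates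

variable {n : ℕ}

theorem initL_apply (y : EuclideanSpace ℝ (Fin (n + 1))) (i : Fin n) :
    initL n y i = y i.castSucc := rfl

theorem lastL_apply (y : EuclideanSpace ℝ (Fin (n + 1))) : lastL n y = y (Fin.last n) := rfl

theorem initL_snocE (z : EuclideanSpace ℝ (Fin n)) (u : ℝ) : initL n (snocE z u) = z := by
  ext i; simp [initL_apply, snocE]

theorem lastL_snocE (z : EuclideanSpace ℝ (Fin n)) (u : ℝ) : lastL n (snocE z u) = u := by
  simp [lastL_apply, snocE]

theorem inner_eq_init_last (y z : EuclideanSpace ℝ (Fin (n + 1))) :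
    inner ℝ y z = inner ℝ (initL n y) (initL n z) + lastL n y * lastL n z := by
  simp only [PiLp.inner_apply, Fin.sum_univ_castSucc, initL_apply, lastL_apply]
  congr 1
  simp [mul_comm]

theorem norm_sq_eq_init_last (y : EuclideanSpace ℝ (Fin (n + 1))) :
    ‖y‖ ^ 2 = ‖initL n y‖ ^ 2 + lastL n y ^ 2 := by
  rw [← real_inner_self_eq_norm_sq, inner_eq_init_last, real_inner_self_eq_norm_sq, sq (lastL n y)]

theorem ext_init_last {y z : EuclideanSpace ℝ (Fin (n + 1))} (h1 : initL n y = initL n z)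
    (h2 : lastL n y = lastL n z) : y = z := by
  rw [← sub_eq_zero, ← norm_eq_zero, ← sq_eq_zero_iff, norm_sq_eq_init_last, map_sub, map_sub, h1,
    h2]
  simp

end coordinates

/-- The image of the unit sphere under a map that dilates the horizontal directions and
reparametrizes the vertical one. -/
def sphereMap (m : ℕ) (R : ℝ) (T : ℝ → ℝ)
    (p : sphere (0 : EuclideanSpace ℝ (Fin (m + 1 + 1))) 1) : Amb (m + 1) :=
  (R • initL (m + 1) (p : EuclideanSpace ℝ (Fin (m + 1 + 1))), T (lastL (m + 1) p))

section sphereMap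

variable {m : ℕ} {R : ℝ} {T W : ℝ → ℝ}
  {p : sphere (0 : EuclideanSpace ℝ (Fin (m + 1 + 1))) 1}

theorem inChart_sphereMap :
    inChart (𝓡 (m + 1)) (sphereMap m R T) p = fun z =>
      ((R • initL (m + 1) (sphChart p z), T (lastL (m + 1) (sphChart p z))) : Amb (m + 1)) := rfl

theorem hasFDerivAt_sphereMap (hT : ∀ u, HasDerivAt T (W u) u)
    (z : EuclideanSpace ℝ (Fin (m + 1))) :
    HasFDerivAt (inChart (𝓡 (m + 1)) (sphereMap m R T) p)
      ((R • (initL (m + 1)).comp (fderiv ℝ (sphChart p) z)).prod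
        (W (lastL (m + 1) (sphChart p z)) • (lastL (m + 1)).comp (fderiv ℝ (sphChart p) z))) z := by
  have h1 : HasFDerivAt (fun z => initL (m + 1) (sphChart p z))
      ((initL (m + 1)).comp (fderiv ℝ (sphChart p) z)) z :=
    (initL (m + 1)).hasFDerivAt.comp z (hasFDerivAt_sphChart z)
  have h2 : HasFDerivAt (fun z => lastL (m + 1) (sphChart p z))
      ((lastL (m + 1)).comp (fderiv ℝ (sphChart p) z)) z :=
    (lastL (m + 1)).hasFDerivAt.comp z (hasFDerivAt_sphChart z)
  exact (h1.const_smul R).prodMk ((hT _).comp_hasFDerivAt z h2)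

theorem fderiv_sphereMap_apply (hT : ∀ u, HasDerivAt T (W u) u)
    (z u : EuclideanSpace ℝ (Fin (m + 1))) :
    fderiv ℝ (inChart (𝓡 (m + 1)) (sphereMap m R T) p) z u =
      (R • initL (m + 1) (fderiv ℝ (sphChart p) z u),
        W (lastL (m + 1) (sphChart p z)) * lastL (m + 1) (fderiv ℝ (sphChart p) z u)) := by
  rw [(hasFDerivAt_sphereMap hT z).fderiv]
  rfl

theorem contDiff_of_hasDerivAt (hT : ∀ u, HasDerivAt T (W u) u) (hW : ContDiff ℝ ∞ W) :
    ContDiff ℝ ∞ T := by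
  refine contDiff_infty_iff_deriv.2 ⟨fun s => (hT s).differentiableAt, ?_⟩
  have : deriv T = W := by ext s; exact (hT s).deriv
  rwa [this]

theorem fderiv_fderiv_sphereMap_apply (hT : ∀ u, HasDerivAt T (W u) u) (hW : ContDiff ℝ ∞ W)
    (z u v : EuclideanSpace ℝ (Fin (m + 1))) :
    fderiv ℝ (fderiv ℝ (inChart (𝓡 (m + 1)) (sphereMap m R T) p)) z u v =
      (R • initL (m + 1) (fderiv ℝ (fderiv ℝ (sphChart p)) z u v),
        deriv W (lastL (m + 1) (sphChart p z)) * lastL (m + 1) (fderiv ℝ (sphChart p) z u) *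
          lastL (m + 1) (fderiv ℝ (sphChart p) z v) +
        W (lastL (m + 1) (sphChart p z)) *
          lastL (m + 1) (fderiv ℝ (fderiv ℝ (sphChart p)) z u v)) := by
  have hsm : ContDiff ℝ 2 (inChart (𝓡 (m + 1)) (sphereMap m R T) p) := by
    rw [inChart_sphereMap]
    have h1 := (initL (m + 1)).contDiff.comp (contDiff_sphChart p (k := 2))
    have h2 := (lastL (m + 1)).contDiff.comp (contDiff_sphChart p (k := 2))
    exact (h1.const_smul R).prodMk
      ((contDiff_infty.1 (contDiff_of_hasDerivAt hT hW) 2).comp h2)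
  have hd : DifferentiableAt ℝ (fderiv ℝ (inChart (𝓡 (m + 1)) (sphereMap m R T) p)) z :=
    (hsm.fderiv_right (m := 1) le_rfl).differentiable one_ne_zero z
  have e1 : fderiv ℝ (fderiv ℝ (inChart (𝓡 (m + 1)) (sphereMap m R T) p)) z u v =
      fderiv ℝ (fun y => fderiv ℝ (inChart (𝓡 (m + 1)) (sphereMap m R T) p) y v) z u := by
    rw [fderiv_clm_apply hd (differentiableAt_const v)]
    simp
  have k0 : HasFDerivAt (fun z => fderiv ℝ (sphChart p) z v)
      ((fderiv ℝ (fderiv ℝ (sphChart p)) z).flip v) z := by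
    have := (hasFDerivAt_fderiv_sphChart (ξ := p) z).clm_apply (hasFDerivAt_const v z)
    simpa using this
  have k1 : HasFDerivAt (fun z => initL (m + 1) (fderiv ℝ (sphChart p) z v)) _ z :=
    (initL (m + 1)).hasFDerivAt.comp z k0
  have k2 : HasFDerivAt (fun z => lastL (m + 1) (fderiv ℝ (sphChart p) z v)) _ z :=
    (lastL (m + 1)).hasFDerivAt.comp z k0
  have k3 : HasFDerivAt (fun z => lastL (m + 1) (sphChart p z))
      ((lastL (m + 1)).comp (fderiv ℝ (sphChart p) z)) z :=
    (lastL (m + 1)).hasFDerivAt.comp z (hasFDerivAt_sphChart z)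
  have k4 : HasFDerivAt (fun z => W (lastL (m + 1) (sphChart p z))) _ z :=
    ((hW.differentiable (by simp) (lastL (m + 1) (sphChart p z))).hasDerivAt).comp_hasFDerivAt z k3
  have k5 : HasFDerivAt (fun z => ((R • initL (m + 1) (fderiv ℝ (sphChart p) z v),
      W (lastL (m + 1) (sphChart p z)) * lastL (m + 1) (fderiv ℝ (sphChart p) z v)) :
        Amb (m + 1))) _ z := (k1.const_smul R).prodMk (k4.mul k2)
  have e2 : (fun y => fderiv ℝ (inChart (𝓡 (m + 1)) (sphereMap m R T) p) y v) =
      fun z => ((R • initL (m + 1) (fderiv ℝ (sphChart p) z v),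
        W (lastL (m + 1) (sphChart p z)) * lastL (m + 1) (fderiv ℝ (sphChart p) z v)) :
        Amb (m + 1)) := by
    ext1 y; exact fderiv_sphereMap_apply hT y v
  rw [e1, e2, k5.fderiv]
  simp
  ring

theorem fderiv_sphereMap_injective (hT : ∀ u, HasDerivAt T (W u) u) (hR : 0 < R)
    (hW : ∀ u, 0 < W u) : Function.Injective (fderiv ℝ (inChart (𝓡 (m + 1)) (sphereMap m R T) p)
      (extChartAt (𝓡 (m + 1)) p p)) := by
  rw [injective_iff_map_eq_zero]
  intro u hu
  rw [fderiv_sphereMap_apply hT, Prod.mk_eq_zero, smul_eq_zero, mul_eq_zero] at hu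
  have h1 := hu.1.resolve_left hR.ne'
  have h2 := hu.2.resolve_left (hW _).ne'
  refine fderiv_sphChart_injective p ?_
  rw [map_zero]
  exact ext_init_last (by rw [h1, map_zero]) (by rw [h2, map_zero])

/-- The map restricts a map of the ambient space whose differential is invertible everywhere. It is
injective because `T` is strictly monotone, and an injective continuous map on the compact sphere is
a homeomorphism onto its image. -/
theorem isSmoothEmb_sphereMap (hT : ∀ u, HasDerivAt T (W u) u) (hWsm : ContDiff ℝ ∞ W) (hR : 0 < R)
    (hW : ∀ u, 0 < W u) : IsSmoothEmb (𝓡 (m + 1)) (sphereMap m R T) := by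
  have : Fact (Module.finrank ℝ (EuclideanSpace ℝ (Fin (m + 1 + 1))) = m + 1 + 1) :=
    ⟨finrank_euclideanSpace_fin⟩
  have hsm : ContMDiff (𝓡 (m + 1)) 𝓘(ℝ, Amb (m + 1)) ∞ (sphereMap m R T) := by
    have h : ContDiff ℝ ∞ fun y : EuclideanSpace ℝ (Fin (m + 1 + 1)) =>
        ((R • initL (m + 1) y, T (lastL (m + 1) y)) : Amb (m + 1)) :=
      ((initL (m + 1)).contDiff.const_smul R).prodMk
        ((contDiff_of_hasDerivAt hT hWsm).comp (lastL (m + 1)).contDiff)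
    exact h.contMDiff.comp (contMDiff_coe_sphere (n := m + 1))
  refine ⟨⟨hsm, fun p => ?_⟩, ?_⟩
  · rw [(hsm.mdifferentiable (by simp) p).mfderiv]
    have hr : range (𝓡 (m + 1)) = univ := (𝓡 (m + 1)).range_eq_univ
    rw [hr, fderivWithin_univ]
    exact fderiv_sphereMap_injective hT hR hW
  · refine (hsm.continuous.isClosedEmbedding fun p q hpq => ?_).isEmbedding
    have hmono : StrictMono T := strictMono_of_deriv_pos fun u => by rw [(hT u).deriv]; exact hW u
    have h1 := congrArg Prod.fst hpq
    have h2 := congrArg Prod.snd hpq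
    exact Subtype.ext (ext_init_last (smul_right_injective _ hR.ne' h1) (hmono.injective h2))

/-- The unit normal of the image of the sphere; `g` and `w` are the values at the height in
question. -/
def sphereNormal (m : ℕ) (R g w : ℝ) (y : EuclideanSpace ℝ (Fin (m + 1 + 1))) : Amb (m + 1) :=
  ((-(R * g * (1 - R ^ 2 * (1 - lastL (m + 1) y ^ 2)) / 2)) • initL (m + 1) y,
    -(2 * R ^ 2 * g / (1 - R ^ 2 * (1 - lastL (m + 1) y ^ 2))) * lastL (m + 1) y / w)

theorem norm_sq_initL_sphere (p : sphere (0 : EuclideanSpace ℝ (Fin (m + 1 + 1))) 1) :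
    ‖initL (m + 1) (p : EuclideanSpace ℝ (Fin (m + 1 + 1)))‖ ^ 2 =
      1 - lastL (m + 1) (p : EuclideanSpace ℝ (Fin (m + 1 + 1))) ^ 2 := by
  have h := norm_sq_eq_init_last (p : EuclideanSpace ℝ (Fin (m + 1 + 1)))
  rw [norm_eq_of_mem_sphere] at h
  linarith

/-- Here `u` is the last coordinate and `v` the squared radius in the ball model; `g` and `k` stand
for the values at `v` of the smooth factors in `G = x g(x²)` and `1 - v g² = (R² - v) k`, with `R² -
v = R² u²`, and `g'`, `k'` for their derivatives. Conditions `e1` and `e2` encode this factorization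
and its derivative, `e3` and `e4` the resulting height slope `W` and its derivative, and `e5` the
mean curvature equation. Both fundamental forms are combinations of the round metric and of the
square of the height differential `ℓ = lst ∘ D`, so the shape operator is a multiple of the identity
plus an operator of rank one. Nothing is divided by `u` or by `v`; so equator and poles need no
separate treatment. -/
theorem hasMeanCurvatureAt_sphereMap (hT : ∀ u, HasDerivAt T (W u) u) (hWsm : ContDiff ℝ ∞ W)
    (hR : 0 < R) (hR1 : R < 1) (hW : ∀ u, 0 < W u) {u v g g' k k' H : ℝ}
    (hu : u = lastL (m + 1) (p : EuclideanSpace ℝ (Fin (m + 1 + 1))))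
    (hv : v = R ^ 2 * (1 - u ^ 2)) (hg : 0 < g) (hk : 0 < k)
    (e1 : R ^ 2 * u ^ 2 * k = 1 - v * g ^ 2)
    (e2 : R ^ 2 * u ^ 2 * k' = k - g * (g + 2 * v * g'))
    (e3 : W u ^ 2 * (1 - v) ^ 2 * k = 4 * R ^ 2 * g ^ 2)
    (e4 : deriv W u * (2 * g * (1 - v) * k) =
      W u * (-2 * R ^ 2 * u) * (2 * g' * (1 - v) * k + 2 * g * k - k' * g * (1 - v)))
    (e5 : (1 - v) / 2 * (g + 2 * v * g') = (m + 1) * H - m * ((1 + v) / 2 * g)) :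
    HasMeanCurvatureAt (𝓡 (m + 1)) (sphereMap m R T) p (sphereNormal m R g (W u) p) H := by
  have hnorm := norm_sq_initL_sphere p
  rw [← hu] at hnorm
  have hu1 : u ^ 2 ≤ 1 := by
    nlinarith [sq_nonneg ‖initL (m + 1) (p : EuclideanSpace ℝ (Fin (m + 1 + 1)))‖]
  have hv0 : 0 ≤ v := by rw [hv]; exact mul_nonneg (sq_nonneg R) (by linarith)
  have hv1 : 0 < 1 - v := by
    have : R ^ 2 < 1 := by nlinarith
    rw [hv]; nlinarith [sq_nonneg u, sq_nonneg R]
  have hw := hW u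
  have hnq : ‖(sphereMap m R T p).1‖ ^ 2 = v := by
    rw [sphereMap, norm_smul, mul_pow, hnorm, hv, Real.norm_eq_abs, sq_abs]
  have hlt : ‖(sphereMap m R T p).1‖ < 1 := by
    refine (sq_lt_one_iff₀ (norm_nonneg _)).1 ?_
    rw [hnq]; linarith
  set D := fderiv ℝ (sphChart p) (extChartAt (𝓡 (m + 1)) p p) with hD
  set lst := lastL (m + 1) with hlst
  set ini := initL (m + 1) with hini
  set y : EuclideanSpace ℝ (Fin (m + 1 + 1)) := (p : EuclideanSpace ℝ (Fin (m + 1 + 1))) with hy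
  have hself : sphChart p (extChartAt (𝓡 (m + 1)) p p) = y := sphChart_self p
  have hDy : ∀ a, inner ℝ (ini (D a)) (ini y) = -(lst (D a) * u) := fun a => by
    have := inner_fderiv_sphChart_self p a
    rw [inner_eq_init_last, ← hu] at this
    linarith
  have hDy' : ∀ a, inner ℝ (ini y) (ini (D a)) = -(lst (D a) * u) := fun a => by
    rw [real_inner_comm, hDy]
  have hDD : ∀ a b, inner ℝ (ini (D a)) (ini (D b)) = inner ℝ (D a) (D b) - lst (D a) * lst (D b) :=
    fun a b => by rw [inner_eq_init_last (D a) (D b)]; ring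
  have hyy : inner ℝ (ini y) (ini y) = 1 - u ^ 2 := by rw [real_inner_self_eq_norm_sq, hnorm]
  have hf1 : ∀ a, fderiv ℝ (inChart (𝓡 (m + 1)) (sphereMap m R T) p)
      (extChartAt (𝓡 (m + 1)) p p) a = (R • ini (D a), W u * lst (D a)) := fun a => by
    rw [fderiv_sphereMap_apply hT, hself, ← hu]
  have hmetric : ∀ a b, ghat (sphereMap m R T p) (R • ini (D a), W u * lst (D a))
      (R • ini (D b), W u * lst (D b)) = 4 * R ^ 2 / (1 - v) ^ 2 * inner ℝ (D a) (D b) +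
        (W u ^ 2 - 4 * R ^ 2 / (1 - v) ^ 2) * lst (D a) * lst (D b) := fun a b => by
    rw [ghat, hnq]
    simp only [real_inner_smul_left, real_inner_smul_right, hDD]
    ring
  have hν : sphereNormal m R g (W u) p = ((-(R * g * (1 - v) / 2)) • ini y,
      -(2 * R ^ 2 * g / (1 - v)) * u / W u) := by
    simp only [sphereNormal, hv, hu, hlst, hini, hy]
  have hsecond : ∀ a b, secondFF (𝓡 (m + 1)) (sphereMap m R T) p (sphereNormal m R g (W u) p) a b =
      2 * R ^ 2 * g * (1 + v) / (1 - v) ^ 2 * inner ℝ (D a) (D b) +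
      (-(2 * R ^ 2 * g / (1 - v)) * u * deriv W u / W u -
        4 * R ^ 4 * g * (1 + u ^ 2) / (1 - v) ^ 2) * lst (D a) * lst (D b) := fun a b => by
    have h2 := inner_fderiv_fderiv_sphChart_self p a b
    rw [inner_eq_init_last, ← hu] at h2
    rw [secondFF, christoffel_eq hlt, hf1, hf1, ghat, hnq,
      fderiv_fderiv_sphereMap_apply hT hWsm, hself, hν, ← hu]
    change inner ℝ (ini _) (ini y) + lst _ * u = _ at h2
    simp only [sphereMap, ← hini, ← hlst, ← hy, ← hD, real_inner_smul_left, real_inner_smul_right,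
      hDy, hDy', hDD, hyy]
    have h3 : inner ℝ (ini (fderiv ℝ (fderiv ℝ (sphChart p)) (extChartAt (𝓡 (m + 1)) p p) a b))
        (ini y) = -inner ℝ (D a) (D b) -
          lst (fderiv ℝ (fderiv ℝ (sphChart p)) (extChartAt (𝓡 (m + 1)) p p) a b) * u := by
      rw [hD]; linarith
    rw [h3]
    rw [hv] at hv1 ⊢
    field_simp
    ring
  -- The vector `e'` represents the height differential with respect to the round metric: its image
  -- is the tangential projection of the vertical unit vector.
  have hbas : ∃ e', D e' = snocE 0 1 - u • y := by
    have hmem : snocE 0 1 - u • y ∈ D.range := by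
      rw [hD, fderiv_sphChart_range, Submodule.mem_orthogonal_singleton_iff_inner_right,
        inner_sub_right, real_inner_smul_right, ← hy, real_inner_self_eq_norm_sq,
        inner_eq_init_last, initL_snocE, lastL_snocE, inner_zero_right, hy, norm_eq_of_mem_sphere,
        hu]
      ring
    exact hmem
  obtain ⟨e', he'⟩ := hbas
  have hinner : ∀ b, inner ℝ (D e') (D b) = lst (D b) := fun b => by
    have := inner_fderiv_sphChart_self p b
    rw [he', inner_sub_left, real_inner_smul_left, real_inner_comm (D b) y, this, mul_zero,
      sub_zero, inner_eq_init_last, initL_snocE, lastL_snocE, inner_zero_left, zero_add, one_mul]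
  have hlast : lst (D e') = 1 - u ^ 2 := by
    rw [he', map_sub, map_smul, hlst, lastL_snocE, smul_eq_mul, hu]; ring
  -- This is the factor by which the induced metric differs from the round one on `e'`. It remains
  -- positive at the poles, where `e'` itself vanishes.
  have hAB : 0 < 4 * R ^ 2 / (1 - v) ^ 2 +
      (W u ^ 2 - 4 * R ^ 2 / (1 - v) ^ 2) * (1 - u ^ 2) := by
    have hA : 0 < 4 * R ^ 2 / (1 - v) ^ 2 := by positivity
    have : 4 * R ^ 2 / (1 - v) ^ 2 + (W u ^ 2 - 4 * R ^ 2 / (1 - v) ^ 2) * (1 - u ^ 2) =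
      4 * R ^ 2 / (1 - v) ^ 2 * u ^ 2 + W u ^ 2 * (1 - u ^ 2) := by ring
    rw [this]
    rcases eq_or_ne u 0 with h0 | h0
    · rw [h0] at hw ⊢; simp; positivity
    · have : 0 < u ^ 2 := by positivity
      have h2 : 0 ≤ 1 - u ^ 2 := by linarith
      positivity
  -- The eigenvalue relation in the direction of `e'`: the meridian curvature is `dG/dρ = (1 - v) /
  -- 2 * (g + 2 v g')`. The combination `u² k'` is removed by `e2`, which avoids dividing by `u²`.
  have hkey : 2 * R ^ 2 * g * (1 + v) / (1 - v) ^ 2 +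
      (-(2 * R ^ 2 * g / (1 - v)) * u * deriv W u / W u -
        4 * R ^ 4 * g * (1 + u ^ 2) / (1 - v) ^ 2) * (1 - u ^ 2) =
      (1 - v) / 2 * (g + 2 * v * g') * (4 * R ^ 2 / (1 - v) ^ 2 +
        (W u ^ 2 - 4 * R ^ 2 / (1 - v) ^ 2) * (1 - u ^ 2)) := by
    have hq : deriv W u / W u = (-2 * R ^ 2 * u) * (2 * g' * (1 - v) * k + 2 * g * k -
        k' * g * (1 - v)) / (2 * g * (1 - v) * k) := by
      rw [div_eq_div_iff hw.ne' (by positivity)]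
      linarith
    have hw2 : W u ^ 2 = 4 * R ^ 2 * g ^ 2 / ((1 - v) ^ 2 * k) := by
      rw [eq_div_iff (by positivity)]
      linarith
    have hq2 : -(2 * R ^ 2 * g / (1 - v)) * u * deriv W u / W u =
        2 * R ^ 2 * (R ^ 2 * u ^ 2 * (2 * g' * (1 - v) + 2 * g) * k -
          g * (1 - v) * (R ^ 2 * u ^ 2 * k')) / ((1 - v) ^ 2 * k) := by
      rw [mul_div_assoc, hq]
      field_simp
    rw [hq2, e2, hw2]
    rw [hv] at hv1 ⊢
    field_simp
    ring
  set A := 4 * R ^ 2 / (1 - v) ^ 2 with hA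
  set B := W u ^ 2 - A with hB
  set C := 2 * R ^ 2 * g * (1 + v) / (1 - v) ^ 2 with hC
  set E := -(2 * R ^ 2 * g / (1 - v)) * u * deriv W u / W u -
        4 * R ^ 4 * g * (1 + u ^ 2) / (1 - v) ^ 2 with hE
  have hA0 : 0 < A := by positivity
  have hCA : C / A = (1 + v) / 2 * g := by
    rw [hC, hA]; field_simp; ring
  -- With metric `A ⟨,⟩ + B ℓ²` and second form `C ⟨,⟩ + E ℓ²`, the operator `(C / A) id + s ℓ ⊗ e'`
  -- represents the second form when `s (A + B ℓ(e')) = E - (C / A) B`, where `ℓ(e') = 1 - u²`. Here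
  -- `C / A` is the parallel curvature, and the rank-one trace adds the difference between meridian
  -- and parallel curvature.
  refine ⟨hlt, fderiv_sphereMap_injective hT hR hW, ?_, fun a => ?_,
    (C / A) • LinearMap.id + ((E - C / A * B) / (A + B * (1 - u ^ 2))) •
      ((lst.comp D : EuclideanSpace ℝ (Fin (m + 1)) →L[ℝ] ℝ) :
        EuclideanSpace ℝ (Fin (m + 1)) →ₗ[ℝ] ℝ).smulRight e', fun a b => ?_, ?_⟩
  · rw [hν, ghat, hnq]
    simp only [real_inner_smul_left, real_inner_smul_right, hyy]
    have hw2 : W u ^ 2 = 4 * R ^ 2 * g ^ 2 / ((1 - v) ^ 2 * k) := by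
      rw [eq_div_iff (by positivity)]
      linarith
    have : -(2 * R ^ 2 * g / (1 - v)) * u / W u * (-(2 * R ^ 2 * g / (1 - v)) * u / W u) =
        R ^ 2 * u ^ 2 * k := by
      rw [div_mul_div_comm, ← sq (W u), hw2]
      field_simp
      ring
    rw [this, e1]
    have : v * g ^ 2 = R ^ 2 * (1 - u ^ 2) * g ^ 2 := by rw [← hv]
    rw [this]
    field_simp
    ring
  · rw [hf1, hν, ghat, hnq]
    simp only [real_inner_smul_left, real_inner_smul_right, hDy]
    field_simp
    ring
  · rw [hsecond, hf1, hf1, hmetric]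
    simp only [LinearMap.add_apply, LinearMap.smul_apply, LinearMap.id_apply,
      LinearMap.smulRight_apply, map_add, map_smul, inner_add_left, real_inner_smul_left, hinner,
      hlast, smul_eq_mul, ContinuousLinearMap.coe_coe, ContinuousLinearMap.comp_apply]
    have h1 : C / A * A = C := div_mul_cancel₀ _ hA0.ne'
    have h2 : (E - C / A * B) / (A + B * (1 - u ^ 2)) * (A + B * (1 - u ^ 2)) = E - C / A * B :=
      div_mul_cancel₀ _ hAB.ne'
    linear_combination inner ℝ (D a) (D b) * h1 + lst (D a) * lst (D b) * h2
  · rw [map_add, map_smul, map_smul, LinearMap.trace_smulRight, LinearMap.trace_id,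
      finrank_euclideanSpace_fin]
    simp only [ContinuousLinearMap.coe_coe, ContinuousLinearMap.comp_apply, hlast, smul_eq_mul]
    have h3 : C / A + (E - C / A * B) / (A + B * (1 - u ^ 2)) * (1 - u ^ 2) =
        (1 - v) / 2 * (g + 2 * v * g') := by
      rw [← (div_eq_iff hAB.ne').2 hkey, div_mul_eq_mul_div, ← eq_sub_iff_add_eq', div_sub' hAB.ne']
      congr 1
      have : C / A * A = C := div_mul_cancel₀ _ hA0.ne'
      linear_combination this
    rw [hCA] at h3 ⊢
    push_cast
    linear_combination h3 + e5

end sphereMap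

/-! ### Smoothness of the height at the equator and mean curvature of the sphere -/

/-- The quotient `(1 - v g(v)²) / (v₀ - v)`, extended to `v₀`, where `v₀` is a zero of the
numerator. -/
def kfun (m : ℕ) (H v₀ v : ℝ) : ℝ := -dslope (fun v => 1 - v * gfun m H v ^ 2) v₀ v

/-- `a` is the largest distance to the axis on the curve with `d = 0`. -/
structure IsSphereRadius (m : ℕ) (H a : ℝ) : Prop where
  H_pos : 0 < H
  a_pos : 0 < a
  zero : M m H 0 a = 0
  dom_eq : dom m H 0 = Ioo 0 a

/-- The derivative of the height of the sphere with respect to the last coordinate `u` on the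
unit sphere. -/
def capSlope (m : ℕ) (H a u : ℝ) : ℝ :=
  2 * Real.tanh (a / 2) * gfun m H (Real.tanh (a / 2) ^ 2 * (1 - u ^ 2)) /
    ((1 - Real.tanh (a / 2) ^ 2 * (1 - u ^ 2)) *
      √(kfun m H (Real.tanh (a / 2) ^ 2) (Real.tanh (a / 2) ^ 2 * (1 - u ^ 2))))

/-- The height of the sphere as a function of the last coordinate `u` on the unit sphere. -/
def capHeight (m : ℕ) (H a u : ℝ) : ℝ := height m H 0 0 a + ∫ x in (0 : ℝ)..u, capSlope m H a x

theorem exists_tanh_half_eq {a t : ℝ} (h0 : 0 ≤ t) (h1 : t < 1) :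
    ∃ ρ, 0 ≤ ρ ∧ Real.tanh (ρ / 2) = t ∧ (t ≤ Real.tanh (a / 2) → ρ ≤ a) ∧
      (t < Real.tanh (a / 2) → ρ < a) := by
  have h : Real.tanh (2 * Real.artanh t / 2) = t := by
    rw [mul_div_cancel_left₀ _ two_ne_zero, Real.tanh_artanh ⟨by linarith, h1⟩]
  refine ⟨2 * Real.artanh t, by linarith [Real.artanh_nonneg h0], h, fun hle => ?_, fun hlt => ?_⟩
  · rw [← h, tanh_strictMono.le_iff_le] at hle
    linarith
  · rw [← h, tanh_strictMono.lt_iff_lt] at hlt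
    linarith

section kfun

variable {m : ℕ} {H v₀ v : ℝ}

theorem contDiffOn_one_sub_mul_gfun_sq :
    ContDiffOn ℝ ∞ (fun v => 1 - v * gfun m H v ^ 2) (Iio 1) :=
  contDiffOn_const.sub (contDiffOn_id.mul (contDiffOn_gfun.pow 2))

theorem hasDerivAt_one_sub_mul_gfun_sq (hv : v < 1) :
    HasDerivAt (fun v => 1 - v * gfun m H v ^ 2)
      (-(gfun m H v * (gfun m H v + 2 * v * deriv (gfun m H) v))) v := by
  have h := ((hasDerivAt_id v).fun_mul
    ((hasDerivAt_gfun (m := m) (H := H) hv).fun_pow 2)).const_sub 1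
  refine h.congr_deriv ?_
  simp only [id]
  push_cast
  ring

theorem contDiffOn_kfun (hv₀ : v₀ < 1) : ContDiffOn ℝ ∞ (kfun m H v₀) (Iio 1) :=
  (contDiffOn_dslope isOpen_Iio hv₀ contDiffOn_one_sub_mul_gfun_sq).neg

theorem hasDerivAt_kfun (hv₀ : v₀ < 1) (hv : v < 1) :
    HasDerivAt (kfun m H v₀) (deriv (kfun m H v₀) v) v :=
  (((contDiffOn_kfun hv₀).differentiableOn (by simp)).differentiableAt
    (Iio_mem_nhds hv)).hasDerivAt

theorem sub_mul_kfun (h0 : 1 - v₀ * gfun m H v₀ ^ 2 = 0) (v : ℝ) :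
    (v₀ - v) * kfun m H v₀ v = 1 - v * gfun m H v ^ 2 := by
  have h := sub_smul_dslope (fun v => 1 - v * gfun m H v ^ 2) v₀ v
  simp only [h0, smul_eq_mul] at h
  rw [kfun]
  linarith

theorem kfun_self (hv₀ : v₀ < 1) : kfun m H v₀ v₀ =
    gfun m H v₀ * (gfun m H v₀ + 2 * v₀ * deriv (gfun m H) v₀) := by
  rw [kfun, dslope_same, (hasDerivAt_one_sub_mul_gfun_sq hv₀).deriv, neg_neg]

theorem sub_mul_deriv_kfun (hv₀ : v₀ < 1) (hv : v < 1) (h0 : 1 - v₀ * gfun m H v₀ ^ 2 = 0) :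
    (v₀ - v) * deriv (kfun m H v₀) v =
      kfun m H v₀ v - gfun m H v * (gfun m H v + 2 * v * deriv (gfun m H) v) := by
  have h1 := ((hasDerivAt_id v).const_sub v₀).fun_mul (hasDerivAt_kfun (m := m) (H := H) hv₀ hv)
  have h2 := h1.unique ((hasDerivAt_one_sub_mul_gfun_sq (m := m) (H := H) hv).congr_of_eventuallyEq
    (Eventually.of_forall fun v => sub_mul_kfun h0 v))
  simp only [id] at h2
  linarith

end kfun

namespace IsSphereRadius

variable {m : ℕ} {H a : ℝ}

theorem tanh_pos (h : IsSphereRadius m H a) : 0 < Real.tanh (a / 2) := tanh_half_pos h.a_pos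

theorem tanh_sq_lt_one (_h : IsSphereRadius m H a) : Real.tanh (a / 2) ^ 2 < 1 :=
  Real.tanh_sq_lt_one _

theorem Godd_eq_one (h : IsSphereRadius m H a) : Godd m H a = 1 := by
  rw [Godd_eq_Gfun h.a_pos, Gfun_eq_one h.a_pos h.zero]

theorem root (h : IsSphereRadius m H a) :
    1 - Real.tanh (a / 2) ^ 2 * gfun m H (Real.tanh (a / 2) ^ 2) ^ 2 = 0 := by
  have := h.Godd_eq_one
  rw [Godd] at this
  rw [← mul_pow, this]
  norm_num

/-- At the zero `v = R²` the value is `g (g + 2 v g')`, positive because `dG/dρ > 0` at `a`. Below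
it the quotient has positive denominator, and its numerator is `1 - G²` for `v > 0` and at least `1`
for `v ≤ 0`. -/
theorem kfun_pos (h : IsSphereRadius m H a) {v : ℝ} (hv : v ≤ Real.tanh (a / 2) ^ 2) :
    0 < kfun m H (Real.tanh (a / 2) ^ 2) v := by
  have h1 := h.tanh_sq_lt_one
  rcases hv.eq_or_lt with rfl | hlt
  · rw [kfun_self h1]
    refine mul_pos (gfun_pos h.H_pos h1) ?_
    have hd := deriv_Godd_pos (m := m) h.H_pos a
    rw [deriv_Godd] at hd
    exact pos_of_mul_pos_right hd (by linarith)
  · have h2 := sub_mul_kfun h.root v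
    refine pos_of_mul_pos_right (a := Real.tanh (a / 2) ^ 2 - v) ?_ (by linarith)
    rw [h2, sub_pos]
    rcases le_or_gt v 0 with hv0 | hv0
    · nlinarith [sq_nonneg (gfun m H v)]
    · have hs : √v < Real.tanh (a / 2) := by
        rw [Real.sqrt_lt' h.tanh_pos]; exact hlt
      obtain ⟨ρ, hρ0, hρ, -, hρa⟩ := exists_tanh_half_eq (a := a) (Real.sqrt_nonneg v)
        (hs.trans (Real.tanh_lt_one _))
      have := Godd_sq_lt_one h.dom_eq (x := ρ) ⟨by linarith [h.a_pos], hρa hs⟩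
      rwa [Godd, hρ, Real.sq_sqrt hv0.le, mul_pow, Real.sq_sqrt hv0.le] at this

theorem arg_le (_h : IsSphereRadius m H a) (u : ℝ) :
    Real.tanh (a / 2) ^ 2 * (1 - u ^ 2) ≤ Real.tanh (a / 2) ^ 2 := by
  nlinarith [mul_nonneg (sq_nonneg (Real.tanh (a / 2))) (sq_nonneg u)]

theorem arg_lt_one (h : IsSphereRadius m H a) (u : ℝ) :
    Real.tanh (a / 2) ^ 2 * (1 - u ^ 2) < 1 := (h.arg_le u).trans_lt h.tanh_sq_lt_one

theorem capSlope_pos (h : IsSphereRadius m H a) (u : ℝ) : 0 < capSlope m H a u := by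
  have h1 := h.tanh_pos
  have h2 := gfun_pos (m := m) h.H_pos (h.arg_lt_one u)
  have h3 : 0 < 1 - Real.tanh (a / 2) ^ 2 * (1 - u ^ 2) := sub_pos.2 (h.arg_lt_one u)
  have h4 := Real.sqrt_pos.2 (h.kfun_pos (h.arg_le u))
  unfold capSlope
  positivity

theorem contDiff_gfun_arg (h : IsSphereRadius m H a) :
    ContDiff ℝ ∞ fun u => gfun m H (Real.tanh (a / 2) ^ 2 * (1 - u ^ 2)) :=
  contDiffOn_gfun.comp_contDiff (contDiff_const.mul (contDiff_const.sub (contDiff_id.pow 2)))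
    h.arg_lt_one

theorem contDiff_capSlope (h : IsSphereRadius m H a) : ContDiff ℝ ∞ (capSlope m H a) := by
  have h0 : ContDiff ℝ ∞ fun u : ℝ => Real.tanh (a / 2) ^ 2 * (1 - u ^ 2) :=
    contDiff_const.mul (contDiff_const.sub (contDiff_id.pow 2))
  have h2 := (contDiffOn_kfun (m := m) (H := H) h.tanh_sq_lt_one).comp_contDiff h0 h.arg_lt_one
  refine (contDiff_const.mul h.contDiff_gfun_arg).div ((contDiff_const.sub h0).mul
    (h2.sqrt fun u => (h.kfun_pos (h.arg_le u)).ne')) fun u => ?_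
  exact (mul_pos (sub_pos.2 (h.arg_lt_one u)) (Real.sqrt_pos.2 (h.kfun_pos (h.arg_le u)))).ne'

theorem hasDerivAt_capHeight (h : IsSphereRadius m H a) (u : ℝ) :
    HasDerivAt (capHeight m H a) (capSlope m H a u) u :=
  (intervalIntegral.integral_hasDerivAt_right
    (h.contDiff_capSlope.continuous.intervalIntegrable _ _)
    h.contDiff_capSlope.continuous.aestronglyMeasurable.stronglyMeasurableAtFilter
    h.contDiff_capSlope.continuous.continuousAt).const_add _

theorem capSlope_sq (h : IsSphereRadius m H a) (u : ℝ) :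
    capSlope m H a u ^ 2 * (1 - Real.tanh (a / 2) ^ 2 * (1 - u ^ 2)) ^ 2 *
      kfun m H (Real.tanh (a / 2) ^ 2) (Real.tanh (a / 2) ^ 2 * (1 - u ^ 2)) =
    4 * Real.tanh (a / 2) ^ 2 * gfun m H (Real.tanh (a / 2) ^ 2 * (1 - u ^ 2)) ^ 2 := by
  have h3 : 0 < 1 - Real.tanh (a / 2) ^ 2 * (1 - u ^ 2) := sub_pos.2 (h.arg_lt_one u)
  have h4 := h.kfun_pos (h.arg_le u)
  rw [capSlope, div_pow, mul_pow (1 - _), Real.sq_sqrt h4.le]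
  field_simp
  ring

/-- Obtained by differentiating the squared identity `capSlope_sq` and cancelling a positive factor,
which avoids differentiating the square root. -/
theorem deriv_capSlope (h : IsSphereRadius m H a) {u v g k : ℝ}
    (hv : v = Real.tanh (a / 2) ^ 2 * (1 - u ^ 2)) (hg : g = gfun m H v)
    (hk : k = kfun m H (Real.tanh (a / 2) ^ 2) v) :
    deriv (capSlope m H a) u * (2 * g * (1 - v) * k) =
      capSlope m H a u * (-2 * Real.tanh (a / 2) ^ 2 * u) *
        (2 * deriv (gfun m H) v * (1 - v) * k + 2 * g * k -
          deriv (kfun m H (Real.tanh (a / 2) ^ 2)) v * g * (1 - v)) := by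
  set R := Real.tanh (a / 2) with hR
  have hv1 : v < 1 := hv ▸ h.arg_lt_one u
  have d0 : HasDerivAt (fun u : ℝ => R ^ 2 * (1 - u ^ 2)) (-2 * R ^ 2 * u) u := by
    refine ((((hasDerivAt_id u).fun_pow 2).const_sub 1).const_mul (R ^ 2)).congr_deriv ?_
    simp only [id]; push_cast; ring
  have dg : HasDerivAt (fun u => gfun m H (R ^ 2 * (1 - u ^ 2)))
      (deriv (gfun m H) v * (-2 * R ^ 2 * u)) u := by
    have := hasDerivAt_gfun (m := m) (H := H) hv1
    rw [hv] at this ⊢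
    exact this.comp u d0
  have dk : HasDerivAt (fun u => kfun m H (R ^ 2) (R ^ 2 * (1 - u ^ 2)))
      (deriv (kfun m H (R ^ 2)) v * (-2 * R ^ 2 * u)) u := by
    have := hasDerivAt_kfun (m := m) (H := H) h.tanh_sq_lt_one hv1
    rw [← hR] at this
    rw [hv] at this ⊢
    exact HasDerivAt.comp (h₂ := kfun m H (R ^ 2)) u this d0
  have dw : HasDerivAt (capSlope m H a) (deriv (capSlope m H a) u) u :=
    (h.contDiff_capSlope.differentiable (by simp) u).hasDerivAt
  have l := ((dw.fun_pow 2).fun_mul ((d0.const_sub 1).fun_pow 2)).fun_mul dk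
  have r := (dg.fun_pow 2).const_mul (4 * R ^ 2)
  have key := l.unique (r.congr_of_eventuallyEq (Eventually.of_forall h.capSlope_sq))
  have sq := h.capSlope_sq u
  rw [← hR, ← hv, ← hg, ← hk] at sq
  simp only [← hv, ← hg, ← hk] at key
  norm_num at key
  have hw := h.capSlope_pos u
  have hne : capSlope m H a u * (1 - v) ≠ 0 := (mul_pos hw (by linarith)).ne'
  apply mul_left_cancel₀ hne
  linear_combination g * key + 4 * deriv (gfun m H) v * R ^ 2 * u * sq

theorem capSlope_neg (u : ℝ) : capSlope m H a (-u) = capSlope m H a u := by simp [capSlope]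

theorem capHeight_neg (u : ℝ) :
    capHeight m H a (-u) = 2 * height m H 0 0 a - capHeight m H a u := by
  have := intervalIntegral.integral_comp_neg (fun y => capSlope m H a y) (a := 0) (b := u)
  simp only [capSlope_neg, neg_zero] at this
  rw [intervalIntegral.integral_symm 0 (-u)] at this
  rw [capHeight, capHeight]
  linarith

/-- The lower half of the sphere corresponds to `u = -√(1 - x² / R²)` with `x = tanh (ρ / 2)`. Both
sides agree at `ρ = a`, that is at `u = 0`, and have the same derivative in `ρ` on `(0, a)`. -/
theorem capHeight_neg_sqrt (h : IsSphereRadius m H a) {L T : ℝ} {c : ℝ → ℝ × ℝ}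
    (hc : IsProfile (Godd m H) (-a) a L T c) {ρ : ℝ} (h0 : 0 ≤ ρ) (h1 : ρ ≤ a) :
    capHeight m H a (-√(1 - Real.tanh (ρ / 2) ^ 2 / Real.tanh (a / 2) ^ 2)) =
      height m H 0 0 ρ := by
  have hR := h.tanh_pos
  have hapos := h.a_pos
  set R := Real.tanh (a / 2) with hRdef
  have hend : capHeight m H a (-√(1 - R ^ 2 / R ^ 2)) = height m H 0 0 a := by
    rw [div_self (by positivity)]; simp [capHeight]
  rcases h1.eq_or_lt with rfl | hlt
  · exact hend
  have hcont : ContinuousOn (fun x => capHeight m H a (-√(1 - Real.tanh (x / 2) ^ 2 / R ^ 2)) -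
      height m H 0 0 |x|) (Icc ρ a) := by
    have c1 : Continuous (capHeight m H a) :=
      continuous_iff_continuousAt.2 fun u => (h.hasDerivAt_capHeight u).continuousAt
    have c2 : Continuous Real.tanh := (contDiff_tanh (k := 0)).continuous
    refine ContinuousOn.sub (Continuous.continuousOn ?_)
      ((continuousOn_height_abs hc hapos).mono (Icc_subset_Icc_left (by linarith)))
    fun_prop
  have hder : ∀ x ∈ Ioo ρ a, HasDerivAt
      (fun x => capHeight m H a (-√(1 - Real.tanh (x / 2) ^ 2 / R ^ 2)) - height m H 0 0 |x|)
      ((fun _ => (0 : ℝ)) x) x := fun x hx => by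
    have hx0 : 0 < x := h0.trans_lt hx.1
    have hτ : 0 < Real.tanh (x / 2) := tanh_half_pos hx0
    have hτR : Real.tanh (x / 2) < R := tanh_strictMono (by linarith [hx.2])
    set τ := Real.tanh (x / 2) with hτdef
    have hτ2 : τ ^ 2 < R ^ 2 := by nlinarith
    have hτ1 : 0 < 1 - τ ^ 2 := one_sub_tanh_sq_pos _
    have hpos : 0 < 1 - τ ^ 2 / R ^ 2 := by
      rw [sub_pos, div_lt_one (by positivity)]; exact hτ2
    have harg : R ^ 2 * (1 - (-√(1 - τ ^ 2 / R ^ 2)) ^ 2) = τ ^ 2 := by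
      rw [neg_sq, Real.sq_sqrt hpos.le]; field_simp; ring
    have hk := h.kfun_pos hτ2.le
    have hg := gfun_pos (m := m) h.H_pos (show τ ^ 2 < 1 by linarith)
    have d1 := hasDerivAt_tanh_half (hasDerivAt_id x)
    have d2 := ((((d1.fun_pow 2).div_const (R ^ 2)).const_sub 1).sqrt hpos.ne').fun_neg
    have d3 := ((h.hasDerivAt_capHeight _).comp x d2).fun_sub
      (hasDerivAt_height_abs hc hapos (x := x) ⟨by linarith, hx.2⟩)
    refine d3.congr_deriv ?_
    simp only [id, ← hτdef]
    rw [sub_eq_zero, capSlope, ← hRdef, harg, Qodd, Godd, ← hτdef]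
    -- The factor `R √(1 - τ² / R²) = R |u|`, which vanishes at the equator, is the one that the
    -- derivative of `u` with respect to `ρ` cancels.
    have hroot : √(1 - (τ * gfun m H (τ ^ 2)) ^ 2) =
        R * √(1 - τ ^ 2 / R ^ 2) * √(kfun m H (R ^ 2) (τ ^ 2)) := by
      rw [mul_pow, ← sub_mul_kfun h.root, ← hRdef, Real.sqrt_mul (by linarith)]
      congr 1
      rw [Real.sqrt_eq_iff_mul_self_eq (by linarith) (by positivity), mul_mul_mul_comm,
        Real.mul_self_sqrt hpos.le]
      field_simp
    rw [hroot]
    have s1 := Real.sqrt_pos.2 hpos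
    have s2 := Real.sqrt_pos.2 hk
    push_cast
    field_simp
  -- The mean value theorem needs only continuity at the ends, and so covers `ρ = 0` and the
  -- singular slope at `ρ = a`.
  obtain ⟨x, -, hx⟩ := exists_hasDerivAt_eq_slope _ _ hlt hcont hder
  rw [eq_comm, div_eq_zero_iff, or_iff_left (by linarith), abs_of_pos hapos, abs_of_nonneg h0,
    ← hRdef, hend] at hx
  linarith

/-- Points with `u ≤ 0` cover the lower half of the oval by `capHeight_neg_sqrt`, and those with `u
≥ 0` the upper half by the reflection `capHeight_neg`. The horizontal norm `R √(1 - u²)` fixes the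
distance to the axis. -/
theorem range_sphereMap (h : IsSphereRadius m H a) {L T : ℝ} {c : ℝ → ℝ × ℝ}
    (hc : IsProfile (Godd m H) (-a) a L T c) :
    range (sphereMap m (Real.tanh (a / 2)) (capHeight m H a)) = rotSet m (ovalSet m H a) := by
  have hR := h.tanh_pos
  have hR1 : Real.tanh (a / 2) < 1 := Real.tanh_lt_one _
  have hcap := fun ρ => h.capHeight_neg_sqrt hc (ρ := ρ)
  set R := Real.tanh (a / 2) with hRdef
  ext q
  constructor
  · rintro ⟨p, rfl⟩
    have hn := norm_sq_initL_sphere p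
    set z := initL (m + 1) (p : EuclideanSpace ℝ (Fin (m + 1 + 1))) with hz
    set u := lastL (m + 1) (p : EuclideanSpace ℝ (Fin (m + 1 + 1))) with hu
    have hz1 : ‖z‖ ≤ 1 := by nlinarith [norm_nonneg z, sq_nonneg u]
    obtain ⟨ρ, hρ0, hρ, hρa, -⟩ := exists_tanh_half_eq (a := a) (t := R * ‖z‖) (by positivity)
      (by nlinarith [norm_nonneg z])
    have hle : ρ ≤ a := hρa (by rw [← hRdef]; nlinarith)
    have hval := hcap ρ hρ0 hle
    have harg : 1 - Real.tanh (ρ / 2) ^ 2 / R ^ 2 = u ^ 2 := by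
      rw [hρ, mul_pow, mul_div_cancel_left₀ _ (by positivity), hn]; ring
    rw [harg, Real.sqrt_sq_eq_abs] at hval
    -- At a pole the horizontal part is zero and any direction `ξ` serves.
    have hξ : ∃ ξ : sphere (0 : EuclideanSpace ℝ (Fin (m + 1))) 1,
        z = ‖z‖ • (ξ : EuclideanSpace ℝ (Fin (m + 1))) := by
      rcases eq_or_ne z 0 with h0 | h0
      · obtain ⟨ξ, hξ⟩ := (NormedSpace.sphere_nonempty (E := EuclideanSpace ℝ (Fin (m + 1)))
          (x := 0) (r := 1)).2 zero_le_one
        exact ⟨⟨ξ, hξ⟩, by simp [h0]⟩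
      · refine ⟨⟨‖z‖⁻¹ • z, ?_⟩, ?_⟩
        · rw [mem_sphere_zero_iff_norm, norm_smul, norm_inv, norm_norm,
            inv_mul_cancel₀ (norm_ne_zero_iff.2 h0)]
        · rw [smul_inv_smul₀ (norm_ne_zero_iff.2 h0)]
    obtain ⟨ξ, hξ⟩ := hξ
    refine ⟨(ρ, capHeight m H a u), ⟨by rwa [abs_of_nonneg hρ0], ?_⟩, ξ, ?_⟩
    · simp only [abs_of_nonneg hρ0]
      rcases le_total u 0 with hu0 | hu0
      · left; rw [← hval, abs_of_nonpos hu0, neg_neg]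
      · right; rw [← hval, abs_of_nonneg hu0, capHeight_neg]; ring
    · rw [hρ, mul_smul, ← hξ]
      rfl
  · rintro ⟨⟨x, t⟩, ⟨hx, ht⟩, ξ, rfl⟩
    simp only at hx ht ⊢
    have hval := hcap |x| (abs_nonneg x) hx
    have htx : Real.tanh (|x| / 2) ^ 2 = Real.tanh (x / 2) ^ 2 := by
      rcases abs_choice x with h' | h' <;> rw [h']
      rw [neg_div, Real.tanh_neg, neg_sq]
    have hle : Real.tanh (x / 2) ^ 2 ≤ R ^ 2 := by
      rw [← htx]
      have h1 : Real.tanh (|x| / 2) ≤ R := tanh_strictMono.monotone (by linarith)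
      have h2 : 0 ≤ Real.tanh (|x| / 2) := by
        rw [← Real.tanh_zero]; exact tanh_strictMono.monotone (by positivity)
      exact pow_le_pow_left₀ h2 h1 2
    rw [htx] at hval
    have hpos : 0 ≤ 1 - Real.tanh (x / 2) ^ 2 / R ^ 2 := by
      rw [sub_nonneg, div_le_one (by positivity)]; exact hle
    have hmain : ∀ u, u ^ 2 = 1 - Real.tanh (x / 2) ^ 2 / R ^ 2 → capHeight m H a u = t →
        (Real.tanh (x / 2) • (ξ : EuclideanSpace ℝ (Fin (m + 1))), t) ∈
          range (sphereMap m R (capHeight m H a)) := fun u hu hut => by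
      refine ⟨⟨snocE ((Real.tanh (x / 2) / R) • (ξ : EuclideanSpace ℝ (Fin (m + 1)))) u, ?_⟩, ?_⟩
      · rw [mem_sphere_zero_iff_norm, ← sq_eq_sq₀ (norm_nonneg _) zero_le_one,
          norm_sq_eq_init_last, initL_snocE, lastL_snocE, norm_smul, norm_eq_of_mem_sphere, hu,
          mul_one, Real.norm_eq_abs, sq_abs, div_pow]
        ring
      · rw [sphereMap]
        simp only [initL_snocE, lastL_snocE, hut, smul_smul]
        rw [mul_div_cancel₀ _ hR.ne']
    rcases ht with rfl | rfl
    · exact hmain _ (by rw [neg_sq, Real.sq_sqrt hpos]) hval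
    · refine hmain (√(1 - Real.tanh (x / 2) ^ 2 / R ^ 2)) (Real.sq_sqrt hpos) ?_
      rw [← hval, capHeight_neg]; ring

theorem hasMeanCurvatureAt (h : IsSphereRadius m H a)
    (p : sphere (0 : EuclideanSpace ℝ (Fin (m + 1 + 1))) 1) :
    HasMeanCurvatureAt (𝓡 (m + 1)) (sphereMap m (Real.tanh (a / 2)) (capHeight m H a)) p
      (sphereNormal m (Real.tanh (a / 2))
        (gfun m H (Real.tanh (a / 2) ^ 2 *
          (1 - lastL (m + 1) (p : EuclideanSpace ℝ (Fin (m + 1 + 1))) ^ 2)))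
        (capSlope m H a (lastL (m + 1) (p : EuclideanSpace ℝ (Fin (m + 1 + 1))))) p) H := by
  set u := lastL (m + 1) (p : EuclideanSpace ℝ (Fin (m + 1 + 1))) with hu
  have hlt := h.arg_lt_one u
  have hsub : Real.tanh (a / 2) ^ 2 - Real.tanh (a / 2) ^ 2 * (1 - u ^ 2) =
      Real.tanh (a / 2) ^ 2 * u ^ 2 := by ring
  refine hasMeanCurvatureAt_sphereMap (u := u) h.hasDerivAt_capHeight h.contDiff_capSlope
    h.tanh_pos (Real.tanh_lt_one _) h.capSlope_pos hu rfl (gfun_pos h.H_pos hlt)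
    (h.kfun_pos (h.arg_le u)) ?_ ?_ (h.capSlope_sq u) (h.deriv_capSlope rfl rfl rfl) (gfun_ode hlt)
  · rw [← hsub]; exact sub_mul_kfun h.root _
  · rw [← hsub]; exact sub_mul_deriv_kfun h.tanh_sq_lt_one hlt h.root

theorem exists_embedding (h : IsSphereRadius m H a) {L T : ℝ} {c : ℝ → ℝ × ℝ}
    (hc : IsProfile (Godd m H) (-a) a L T c) :
    ∃ f : sphere (0 : EuclideanSpace ℝ (Fin (m + 1 + 1))) 1 → Amb (m + 1),
      IsSmoothEmb (𝓡 (m + 1)) f ∧ range f = rotSet m (ovalSet m H a) ∧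
      ∃ ν : sphere (0 : EuclideanSpace ℝ (Fin (m + 1 + 1))) 1 → Amb (m + 1),
        Continuous ν ∧ ∀ p, HasMeanCurvatureAt (𝓡 (m + 1)) f p (ν p) H := by
  refine ⟨_, isSmoothEmb_sphereMap h.hasDerivAt_capHeight h.contDiff_capSlope h.tanh_pos
    h.capSlope_pos, h.range_sphereMap hc, _, ?_, h.hasMeanCurvatureAt⟩
  have c1 := h.contDiff_gfun_arg.continuous
  have c2 := h.contDiff_capSlope.continuous
  have c3 : Continuous fun p : sphere (0 : EuclideanSpace ℝ (Fin (m + 1 + 1))) 1 =>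
      lastL (m + 1) (p : EuclideanSpace ℝ (Fin (m + 1 + 1))) :=
    (lastL (m + 1)).continuous.comp continuous_subtype_val
  have c4 := c1.comp c3
  have c5 := c2.comp c3
  have c6 : Continuous fun p : sphere (0 : EuclideanSpace ℝ (Fin (m + 1 + 1))) 1 =>
      initL (m + 1) (p : EuclideanSpace ℝ (Fin (m + 1 + 1))) :=
    (initL (m + 1)).continuous.comp continuous_subtype_val
  have c7 : Continuous fun p : sphere (0 : EuclideanSpace ℝ (Fin (m + 1 + 1))) 1 =>
      1 - Real.tanh (a / 2) ^ 2 *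
        (1 - lastL (m + 1) (p : EuclideanSpace ℝ (Fin (m + 1 + 1))) ^ 2) := by fun_prop
  simp only [Function.comp_def] at c4 c5
  unfold sphereNormal
  refine Continuous.prodMk ?_ ?_
  · exact ((((continuous_const.mul c4).mul c7).div_const 2).neg).smul c6
  · exact (((continuous_const.mul c4).div c7 fun p => (sub_pos.2 (h.arg_lt_one _)).ne').neg.mul
      c3).div c5 fun p => (h.capSlope_pos _).ne'

end IsSphereRadius

theorem exists_isSphereLike {m : ℕ} {H : ℝ} (hm : 1 ≤ m) (hH : (m : ℝ) / (m + 1) < H) :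
    ∃ (a L : ℝ) (c : ℝ → ℝ × ℝ), IsSphereLike m H a L c := by
  obtain ⟨a, ha, ha0, hdom⟩ := dom_eq_sphere hm hH
  have hapos := (CH_pos hm hH).trans ha
  obtain ⟨L, T, c, hc⟩ := exists_sphere_profile (H_pos hH) hapos ha0 hdom
  have hr : IsSphereRadius m H a := ⟨H_pos hH, hapos, ha0, hdom⟩
  exact ⟨a, L, _, isSphereLike_of_profile (H_pos hH) hapos hdom hc (hr.exists_embedding hc)⟩

end RotH

end

open RotH in
/-- Here `n = m + 1 ≥ 2`. -/
theorem theorem3 (m : ℕ) (hm : 1 ≤ m) (H : ℝ) (hH : (m : ℝ) / (m + 1) < H) :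
    -- every rotation `H`-graph has a well-defined constant `d`
    (∀ (J : Set ℝ) (l : ℝ → ℝ), IsHeightFun J l →
      (IsRotHGraph m H J l ↔ ∃! d : ℝ, HasConst m H d J l)) ∧
    -- `d = 0`: the sphere
    (∃ (a L : ℝ) (c : ℝ → ℝ × ℝ), IsSphereLike m H a L c) ∧
    -- `d > 0`: the unduloids; they exist exactly for `d < D_H`
    (0 < DH m H ∧
      (∀ d : ℝ, 0 < d → d < DH m H →
        ∃ (a b L T : ℝ) (c : ℝ → ℝ × ℝ), IsDelaunay m H d a b L T c ∧
          IsSmoothEmb (𝓘(ℝ, ℝ).prod (𝓡 m)) (rotImm m c) ∧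
          (∀ s, 0 < (deriv c s).2)) ∧
      (∀ d : ℝ, DH m H ≤ d → dom m H d = ∅)) ∧
    -- `d < 0`: the nodoids
    (∀ d : ℝ, d < 0 →
      ∃ (a b L T : ℝ) (c : ℝ → ℝ × ℝ), IsDelaunay m H d a b L T c ∧
        (∀ s, 0 < curv c s) ∧
        (deriv c 0).2 < 0 ∧ 0 < (deriv c (L / 2)).2 ∧
        (∃ s₁ s₂ : ℝ, s₁ ≠ s₂ ∧ c s₁ = c s₂ ∧
          LinearIndependent ℝ ![deriv c s₁, deriv c s₂]) ∧
        ¬ Function.Injective (rotImm m c)) :=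
  ⟨fun _ _ hl => isRotHGraph_iff_existsUnique hl, exists_isSphereLike hm hH,
    ⟨DH_pos hm hH, fun _ hd hd' => exists_unduloid hm hH hd hd', fun _ hd => dom_eq_empty hm hH hd⟩,
    fun _ hd => exists_nodoid hm hH hd⟩
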